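/- **Theorem 6.4 (generalized Lawson correspondences).** For $c\in\{0,1,-1\}$ let $\mathfrak M^3_1(c)$ be the Lorentzian space form of curvature $c$: $\mathfrak M^3_1(0)=\mathbf E^3_1$ (Minkowski space), $\mathfrak M^3_1(1)=S^3_1$ (de Sitter space $\{\langle p,p\rangle=1\}$ in $\mathbf R^4$ with scalar product of signature $(-,+,+,+)$), $\mathfrak M^3_1(-1)=H^3_1$ (anti de Sitter space $\{\langle p,p\rangle=-1\}$ in $\mathbf R^4$ with scalar product of signature $(-,-,+,+)$). Let $M$ be a simply connected Lorentz surface, i.e. an oriented surface with a conformal class of Lorentzian metrics, given by its null coordinate systems $(u,v)$ (those for which the metrics of the class are $e^{\omega}\,du\,dv$ and $du\wedge dv$ is positive). Let $f$ be a smooth function on $M$ that is Lorentz holomorphic ($f_v=0$) and $g$ a smooth function that is Lorentz anti-holomorphic ($g_u=0$), in all null coordinates, with $f+g$ nowhere zero, and put $$H_c:=\frac{1-c\,fg}{f+g}.$$ Let $\mathcal C_{H_c}$ be the moduli space of smooth conformal timelike immersions $F:M\to\mathfrak M^3_1(c)$ with mean curvature $H_c$, modulo the identity component of the isometry group of $\mathfrak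 M^3_1(c)$. Here conformal means that $F$ induces a metric $I=e^{\omega}\,du\,dv$ in all null coordinates, $N$ is the unit normal field with $(F_u,F_v,N)$ positively oriented, the mean curvature is $\frac12\operatorname{tr}(-dN)$, and the Hopf differentials are $Q\,du^2$ and $R\,dv^2$ with $Q=\langle F_{uu},N\rangle$, $R=\langle F_{vv},N\rangle$. Then the moduli spaces $\mathcal C_{H_0}$, $\mathcal C_{H_1}$ and, provided that $H_{-1}^2>1$ on $M$ (equivalently $(1-f^2)(1-g^2)>0$), also $\mathcal C_{H_{-1}}$, are mutually isomorphic. More precisely, for any two $c,c'\in\{0,1,-1\}$ (assuming $H_{-1}^2>1$ on $M$ if $-1$ is one of them) there is a bijection $\mathcal C_{H_c}\to\mathcal C_{H_{c'}}$ such that, whenever the class of an immersion with data $(\omega,Q,R)$ is sent to the class of an immersion with data $(\tilde\omega,\tilde Q,\tilde R)$, in every null coordinate system $$(1+c'f^2)(1+c'g^2)\,e^{\tilde\omega}=(1+cf^2)(1+cg^2)\,e^{\omega},\quad (1+c'f^2)\,\tilde Q=(1+cf^2)\,Q,\quad (1+c'g^2)\,\tilde R=(1+cg^2)\,R .$$ In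 particular, for $c=\pm1$ and $c'=0$: $e^{\tilde\omega}=(1+cf^2)(1+cg^2)e^{\omega}$, $\tilde Q=(1+cf^2)Q$, $\tilde R=(1+cg^2)R$. -/

import Mathlib

open Set Matrix
open scoped Manifold ContDiff Topology

noncomputable section

/-! ### Null derivatives and Lorentz surfaces -/

/-- The partial derivative `∂G/∂u` of a map of the null coordinates `(u, v)`. -/
def dU {E : Type*} [NormedAddCommGroup E] [NormedSpace ℝ E] (G : ℝ × ℝ → E) (p : ℝ × ℝ) : E :=
  fderiv ℝ G p (1, 0)

/-- The partial derivative `∂G/∂v` of a map of the null coordinates `(u, v)`. -/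
def dV {E : Type*} [NormedAddCommGroup E] [NormedSpace ℝ E] (G : ℝ × ℝ → E) (p : ℝ × ℝ) : E :=
  fderiv ℝ G p (0, 1)

/-- Smooth maps of open sets of the `(u, v)`-plane that are locally of the form
`(u, v) ↦ (φ u, ψ v)` with `φ' ψ' > 0`, that is: the smooth maps that pull `du dv` back to a
positive multiple of `du dv` and preserve the orientation `du ∧ dv`. The local product form is
expressed by `∂φ/∂v = 0 = ∂ψ/∂u`. -/
def IsNullMap (h : ℝ × ℝ → ℝ × ℝ) (s : Set (ℝ × ℝ)) : Prop :=
  ContDiffOn ℝ ∞ h s ∧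
    ∀ p ∈ s, (dU h p).2 = 0 ∧ (dV h p).1 = 0 ∧ 0 < (dU h p).1 * (dV h p).2

theorem isNullMap_comp {h k : ℝ × ℝ → ℝ × ℝ} {s t : Set (ℝ × ℝ)} (hh : IsNullMap h s)
    (hk : IsNullMap k t) (hs : IsOpen s) (ht : IsOpen t) : IsNullMap (k ∘ h) (s ∩ h ⁻¹' t) := by
  refine ⟨hk.1.comp (hh.1.mono inter_subset_left) (fun x hx => hx.2), ?_⟩
  rintro p ⟨hps, hpt⟩
  have dh : DifferentiableAt ℝ h p :=
    (hh.1.contDiffAt (hs.mem_nhds hps)).differentiableAt (by simp)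
  have dk : DifferentiableAt ℝ k (h p) :=
    (hk.1.contDiffAt (ht.mem_nhds hpt)).differentiableAt (by simp)
  obtain ⟨h1, h2, h3⟩ := hh.2 p hps
  obtain ⟨k1, k2, k3⟩ := hk.2 (h p) hpt
  have lin : ∀ a b : ℝ, fderiv ℝ k (h p) (a, b) = a • dU k (h p) + b • dV k (h p) := by
    intro a b
    have : ((a, b) : ℝ × ℝ) = a • ((1, 0) : ℝ × ℝ) + b • ((0, 1) : ℝ × ℝ) := by simp
    rw [this, map_add, map_smul, map_smul]; rfl
  have e1 : dU (k ∘ h) p = (dU h p).1 • dU k (h p) + (dU h p).2 • dV k (h p) := by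
    rw [← lin]; simp only [dU, fderiv_comp p dk dh]; rfl
  have e2 : dV (k ∘ h) p = (dV h p).1 • dU k (h p) + (dV h p).2 • dV k (h p) := by
    rw [← lin]; simp only [dV, fderiv_comp p dk dh]; rfl
  rw [e1, e2, h1, h2]
  refine ⟨by simp [k1], by simp [k2], ?_⟩
  simp only [zero_smul, add_zero, zero_add, Prod.smul_fst, Prod.smul_snd, smul_eq_mul]
  nlinarith [mul_pos h3 k3]

/-- The pseudogroup of coordinate changes between null coordinate systems. -/
def nullGroupoid : StructureGroupoid (ℝ × ℝ) :=
  Pregroupoid.groupoid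
    { property := IsNullMap
      comp := fun hf hg hu hv _ => isNullMap_comp hf hg hu hv
      id_mem := ⟨contDiff_id.contDiffOn, fun p _ => by simp [dU, dV]⟩
      locality := by
        intro f u hu H
        refine ⟨?_, ?_⟩
        · intro x hx
          obtain ⟨v, hv, hxv, hp⟩ := H x hx
          exact (hp.1.contDiffAt ((hu.inter hv).mem_nhds ⟨hx, hxv⟩)).contDiffWithinAt
        · intro x hx
          obtain ⟨v, hv, hxv, hp⟩ := H x hx
          exact hp.2 x ⟨hx, hxv⟩
      congr := by
        intro f g u hu H hf
        refine ⟨hf.1.congr H, fun p hp => ?_⟩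
        have hfg : g =ᶠ[𝓝 p] f := Filter.eventuallyEq_of_mem (hu.mem_nhds hp) H
        have := hf.2 p hp
        simpa only [dU, dV, hfg.fderiv_eq] using this }

/-- A Lorentz surface: a surface with an atlas of null coordinate systems `(u, v)`. Such an atlas
is the same as an orientation together with a conformal class of Lorentzian metrics, namely the
metrics that are positive multiples of `du dv` in every chart of the atlas. -/
class LorentzSurface (M : Type*) [TopologicalSpace M] [ChartedSpace (ℝ × ℝ) M] : Prop where
  t2 : T2Space M
  secondCountable : SecondCountableTopology M
  hasGroupoid : HasGroupoid M nullGroupoid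

/-- All null coordinate systems of a Lorentz surface. -/
def nullCharts (M : Type*) [TopologicalSpace M] [ChartedSpace (ℝ × ℝ) M] :
    Set (OpenPartialHomeomorph M (ℝ × ℝ)) :=
  nullGroupoid.maximalAtlas M

/-- Lorentz holomorphic: smooth, and (locally) depending only on `u`. -/
def LorentzHolomorphic {M : Type*} [TopologicalSpace M] [ChartedSpace (ℝ × ℝ) M]
    (f : M → ℝ) : Prop :=
  ContMDiff 𝓘(ℝ, ℝ × ℝ) 𝓘(ℝ, ℝ) ∞ f ∧
    ∀ e ∈ nullCharts M, ∀ p ∈ e.target, dV (f ∘ e.symm) p = 0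

/-- Lorentz anti-holomorphic: smooth, and (locally) depending only on `v`. -/
def LorentzAntiholomorphic {M : Type*} [TopologicalSpace M] [ChartedSpace (ℝ × ℝ) M]
    (g : M → ℝ) : Prop :=
  ContMDiff 𝓘(ℝ, ℝ × ℝ) 𝓘(ℝ, ℝ) ∞ g ∧
    ∀ e ∈ nullCharts M, ∀ p ∈ e.target, dU (g ∘ e.symm) p = 0

/-! ### Lorentzian space forms; the curvature `c` is `0`, `1` or `-1` -/

/-- The signs of the diagonal scalar product on `ℝ⁴` attached to `c`. -/
def signature : SignType → Fin 4 → ℝ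
  | 1 => ![-1, 1, 1, 1]
  | 0 => ![-1, -1, 1, 1]
  | -1 => ![-1, -1, 1, 1]

/-- The scalar product `⟨a, b⟩_c` on `ℝ⁴`. -/
def scalarProd (c : SignType) (a b : Fin 4 → ℝ) : ℝ :=
  ∑ i, signature c i * a i * b i

/-- The space form of curvature `c` in `ℝ⁴`: Minkowski space `E³₁` (`c = 0`), de Sitter space `S³₁`
(`c = 1`), anti de Sitter space `H³₁` (`c = -1`). -/
def spaceForm : SignType → Set (Fin 4 → ℝ)
  | 0 => {p | p 0 = 0}
  | 1 => {p | scalarProd 1 p p = 1}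
  | -1 => {p | scalarProd (-1) p p = -1}

/-- A normal vector in `ℝ⁴` of the space form at its point `p`. The tangent space of the space form
at `p` is its orthogonal complement, oriented by putting this vector first. -/
def ambientNormal : SignType → (Fin 4 → ℝ) → (Fin 4 → ℝ)
  | 0, _ => ![1, 0, 0, 0]
  | 1, p => p
  | -1, p => p

/-- The full isometry group of the space form, as the group of affine isometries
`p ↦ A p + b` of `(ℝ⁴, ⟨ , ⟩_c)` that preserve the space form. For `c = 1` and `c = -1` this forces
`b = 0`, and gives `O(1,3)` and `O(2,2)`; for `c = 0` it gives the Poincare group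
`O(1,2) ⋉ ℝ³` (times the reflection of the `p₀`-axis, which acts trivially on `E³₁`). -/
def isometries (c : SignType) : Set (Matrix (Fin 4) (Fin 4) ℝ × (Fin 4 → ℝ)) :=
  {T | (∀ p q, scalarProd c (T.1 *ᵥ p) (T.1 *ᵥ q) = scalarProd c p q) ∧
    ∀ p, T.1 *ᵥ p + T.2 ∈ spaceForm c ↔ p ∈ spaceForm c}

/-- The identity component of the full isometry group. -/
def identityComponent (c : SignType) : Set (Matrix (Fin 4) (Fin 4) ℝ × (Fin 4 → ℝ)) :=
  connectedComponentIn (isometries c) (1, 0)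

/-- Composition of affine maps. -/
def affComp (T S : Matrix (Fin 4) (Fin 4) ℝ × (Fin 4 → ℝ)) :
    Matrix (Fin 4) (Fin 4) ℝ × (Fin 4 → ℝ) :=
  (T.1 * S.1, T.1 *ᵥ S.2 + T.2)

theorem affComp_apply (T S : Matrix (Fin 4) (Fin 4) ℝ × (Fin 4 → ℝ)) (p : Fin 4 → ℝ) :
    (affComp T S).1 *ᵥ p + (affComp T S).2 = T.1 *ᵥ (S.1 *ᵥ p + S.2) + T.2 := by
  simp [affComp, Matrix.mulVec_add, Matrix.mulVec_mulVec, add_assoc]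

theorem continuous_affComp (T : Matrix (Fin 4) (Fin 4) ℝ × (Fin 4 → ℝ)) :
    Continuous (affComp T) := by
  unfold affComp; fun_prop

theorem one_mem_isometries (c : SignType) :
    ((1, 0) : Matrix (Fin 4) (Fin 4) ℝ × (Fin 4 → ℝ)) ∈ isometries c := by
  simp [isometries]

theorem affComp_mem_isometries {c : SignType} {T S : Matrix (Fin 4) (Fin 4) ℝ × (Fin 4 → ℝ)}
    (hT : T ∈ isometries c) (hS : S ∈ isometries c) : affComp T S ∈ isometries c := by
  refine ⟨fun p q => ?_, fun p => ?_⟩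
  · simp only [affComp, ← Matrix.mulVec_mulVec]
    rw [hT.1, hS.1]
  · rw [affComp_apply, hT.2, hS.2]

theorem isUnit_det_of_mem_isometries {c : SignType}
    {T : Matrix (Fin 4) (Fin 4) ℝ × (Fin 4 → ℝ)} (hT : T ∈ isometries c) : IsUnit T.1.det := by
  rw [← Matrix.isUnit_iff_isUnit_det, ← Matrix.mulVec_injective_iff_isUnit]
  intro p q hpq
  have hs : ∀ i, signature c i ≠ 0 := by
    intro i
    cases c <;> fin_cases i <;> simp [signature]
  have h0 : ∀ r, scalarProd c (p - q) r = 0 := by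
    intro r
    rw [← hT.1, Matrix.mulVec_sub]
    rw [hpq, sub_self]
    simp [scalarProd]
  funext i
  have := h0 (Pi.single i 1)
  simp only [scalarProd, Pi.single_apply, mul_ite, mul_one, mul_zero, Finset.sum_ite_eq',
    Finset.mem_univ, if_true, mul_eq_zero, hs i, false_or, Pi.sub_apply] at this
  linarith

/-- The inverse of an invertible affine map. -/
def affInv (T : Matrix (Fin 4) (Fin 4) ℝ × (Fin 4 → ℝ)) :
    Matrix (Fin 4) (Fin 4) ℝ × (Fin 4 → ℝ) :=
  (T.1⁻¹, -(T.1⁻¹ *ᵥ T.2))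

theorem affComp_affInv {c : SignType} {T : Matrix (Fin 4) (Fin 4) ℝ × (Fin 4 → ℝ)}
    (hT : T ∈ isometries c) : affComp T (affInv T) = (1, 0) := by
  have hd := isUnit_det_of_mem_isometries hT
  simp [affComp, affInv, Matrix.mul_nonsing_inv _ hd, Matrix.mulVec_neg, Matrix.mulVec_mulVec]

theorem affInv_affComp {c : SignType} {T : Matrix (Fin 4) (Fin 4) ℝ × (Fin 4 → ℝ)}
    (hT : T ∈ isometries c) : affComp (affInv T) T = (1, 0) := by
  have hd := isUnit_det_of_mem_isometries hT
  simp [affComp, affInv, Matrix.nonsing_inv_mul _ hd]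

theorem affInv_mem_isometries {c : SignType} {T : Matrix (Fin 4) (Fin 4) ℝ × (Fin 4 → ℝ)}
    (hT : T ∈ isometries c) : affInv T ∈ isometries c := by
  have hd := isUnit_det_of_mem_isometries hT
  refine ⟨fun p q => ?_, fun p => ?_⟩
  · rw [← hT.1]
    simp [affInv, Matrix.mulVec_mulVec, Matrix.mul_nonsing_inv _ hd]
  · rw [← hT.2, ← affComp_apply, affComp_affInv hT]
    simp

theorem affComp_mem_identityComponent {c : SignType}
    {T S : Matrix (Fin 4) (Fin 4) ℝ × (Fin 4 → ℝ)}
    (hT : T ∈ identityComponent c) (hS : S ∈ identityComponent c) :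
    affComp T S ∈ identityComponent c := by
  have hTi := connectedComponentIn_subset _ _ hT
  have hpre : IsPreconnected (affComp T '' identityComponent c) :=
    isPreconnected_connectedComponentIn.image _ (continuous_affComp T).continuousOn
  have hone : affComp T (1, 0) = T := by simp [affComp]
  have hsub := hpre.subset_connectedComponentIn (x := T) (F := isometries c)
    ⟨(1, 0), mem_connectedComponentIn (one_mem_isometries c), hone⟩
    (by
      rintro _ ⟨R, hR, rfl⟩
      exact affComp_mem_isometries hTi (connectedComponentIn_subset _ _ hR))
  rw [identityComponent, connectedComponentIn_eq hT]
  exact hsub ⟨S, hS, rfl⟩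

theorem affInv_mem_identityComponent {c : SignType}
    {T : Matrix (Fin 4) (Fin 4) ℝ × (Fin 4 → ℝ)}
    (hT : T ∈ identityComponent c) : affInv T ∈ identityComponent c := by
  have hTi := connectedComponentIn_subset _ _ hT
  have hpre : IsPreconnected (affComp (affInv T) '' identityComponent c) :=
    isPreconnected_connectedComponentIn.image _ (continuous_affComp _).continuousOn
  have hsub := hpre.subset_connectedComponentIn (x := (1, 0)) (F := isometries c)
    ⟨T, hT, affInv_affComp hTi⟩
    (by
      rintro _ ⟨R, hR, rfl⟩
      exact affComp_mem_isometries (affInv_mem_isometries hTi)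
        (connectedComponentIn_subset _ _ hR))
  exact hsub ⟨(1, 0), mem_connectedComponentIn (one_mem_isometries c), by simp [affComp]⟩

/-! ### Conformal timelike immersions with prescribed mean curvature -/

/-- A conformal timelike immersion `F` of the Lorentz surface `M` into the space form of curvature
`c`, with mean curvature `H`, together with its unit normal vector field `N`.

The normal field is tangent to the space form, and it is the one for which `(F_u, F_v, N)` is
positively oriented; so it is determined by `F`. The mean curvature is `(1/2) tr S`, with the shape
operator `S = -dN`. -/
structure TimelikeImmersion (M : Type*) [TopologicalSpace M] [ChartedSpace (ℝ × ℝ) M]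
    (c : SignType) (H : M → ℝ) where
  F : M → (Fin 4 → ℝ)
  N : M → (Fin 4 → ℝ)
  smooth_F : ContMDiff 𝓘(ℝ, ℝ × ℝ) 𝓘(ℝ, Fin 4 → ℝ) ∞ F
  smooth_N : ContMDiff 𝓘(ℝ, ℝ × ℝ) 𝓘(ℝ, Fin 4 → ℝ) ∞ N
  mem_spaceForm : ∀ m, F m ∈ spaceForm c
  /-- The induced metric is a positive multiple of `du dv` in null coordinates. -/
  conformal : ∀ e ∈ nullCharts M, ∀ p ∈ e.target,
    scalarProd c (dU (F ∘ e.symm) p) (dU (F ∘ e.symm) p) = 0 ∧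
    scalarProd c (dV (F ∘ e.symm) p) (dV (F ∘ e.symm) p) = 0 ∧
    0 < scalarProd c (dU (F ∘ e.symm) p) (dV (F ∘ e.symm) p)
  unit_normal : ∀ m, scalarProd c (N m) (N m) = 1
  normal_tangent : ∀ m, scalarProd c (N m) (ambientNormal c (F m)) = 0
  normal_orthogonal : ∀ e ∈ nullCharts M, ∀ p ∈ e.target,
    ∀ w, scalarProd c (fderiv ℝ (F ∘ e.symm) p w) (N (e.symm p)) = 0
  normal_oriented : ∀ e ∈ nullCharts M, ∀ p ∈ e.target,
    0 < (Matrix.of ![ambientNormal c (F (e.symm p)), dU (F ∘ e.symm) p, dV (F ∘ e.symm) p,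
      N (e.symm p)]).det
  /-- `S` is the shape operator in the chart: `dF ∘ S = -dN`. -/
  mean_curvature : ∀ e ∈ nullCharts M, ∀ p ∈ e.target,
    ∃ S : (ℝ × ℝ) →ₗ[ℝ] (ℝ × ℝ),
      (∀ w, fderiv ℝ (F ∘ e.symm) p (S w) = -fderiv ℝ (N ∘ e.symm) p w) ∧
      H (e.symm p) = LinearMap.trace ℝ (ℝ × ℝ) S / 2

namespace TimelikeImmersion

variable {M : Type*} [TopologicalSpace M] [ChartedSpace (ℝ × ℝ) M] {c : SignType} {H : M → ℝ}

/-- The conformal factor `e^ω` of the induced metric `I = e^ω du dv` in a null chart. -/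
def expOmega (X : TimelikeImmersion M c H) (e : OpenPartialHomeomorph M (ℝ × ℝ))
    (p : ℝ × ℝ) : ℝ :=
  2 * scalarProd c (dU (X.F ∘ e.symm) p) (dV (X.F ∘ e.symm) p)

/-- The coefficient `Q = ⟨F_uu, N⟩` of the Hopf differential `Q du²` in a null chart. -/
def hopfQ (X : TimelikeImmersion M c H) (e : OpenPartialHomeomorph M (ℝ × ℝ))
    (p : ℝ × ℝ) : ℝ :=
  scalarProd c (dU (dU (X.F ∘ e.symm)) p) (X.N (e.symm p))

/-- The coefficient `R = ⟨F_vv, N⟩` of the Hopf differential `R dv²` in a null chart. -/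
def hopfR (X : TimelikeImmersion M c H) (e : OpenPartialHomeomorph M (ℝ × ℝ))
    (p : ℝ × ℝ) : ℝ :=
  scalarProd c (dV (dV (X.F ∘ e.symm)) p) (X.N (e.symm p))

/-- Congruence under the identity component of the isometry group. -/
def congruence (M : Type*) [TopologicalSpace M] [ChartedSpace (ℝ × ℝ) M] (c : SignType)
    (H : M → ℝ) : Setoid (TimelikeImmersion M c H) where
  r X Y := ∃ T ∈ identityComponent c, ∀ m, Y.F m = T.1 *ᵥ X.F m + T.2
  iseqv :=
    { refl := fun X => ⟨(1, 0), mem_connectedComponentIn (one_mem_isometries c), by simp⟩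
      symm := by
        rintro X Y ⟨T, hT, h⟩
        refine ⟨affInv T, affInv_mem_identityComponent hT, fun m => ?_⟩
        rw [h, ← affComp_apply, affInv_affComp (connectedComponentIn_subset _ _ hT)]
        simp
      trans := by
        rintro X Y Z ⟨T, hT, h⟩ ⟨S, hS, h'⟩
        refine ⟨affComp S T, affComp_mem_identityComponent hS hT, fun m => ?_⟩
        rw [h', h, affComp_apply] }

end TimelikeImmersion

/-- The moduli space `𝒞_H` of conformal timelike immersions of `M` into the space form of
curvature `c` with mean curvature `H`, modulo the identity component of the isometry group. -/
def ModuliSpace (M : Type*) [TopologicalSpace M] [ChartedSpace (ℝ × ℝ) M] (c : SignType)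
    (H : M → ℝ) : Type _ :=
  Quotient (TimelikeImmersion.congruence M c H)

/-- The congruence class of an immersion. -/
def TimelikeImmersion.toModuli {M : Type*} [TopologicalSpace M] [ChartedSpace (ℝ × ℝ) M]
    {c : SignType} {H : M → ℝ} (X : TimelikeImmersion M c H) : ModuliSpace M c H :=
  Quotient.mk _ X

/-- The function `H_c = (1 - c f g) / (f + g)`. -/
def lawsonH {M : Type*} (f g : M → ℝ) (c : SignType) (m : M) : ℝ :=
  (1 - (c : ℝ) * f m * g m) / (f m + g m)

end

/-! ### Linear total differential equations in the plane -/

/-! In null coordinates put `E = e^ω / 2 = ⟨F_u, F_v⟩`. The tuple `(n, F_u, F_v, N, F)`, with `n`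
the ambient normal, satisfies a linear total differential system whose coefficients are built from
`E, H, Q, R` (`structure_equations`). Its integrability conditions are the Gauss and Codazzi
equations `(log E)_uv = Q R / E - (H² + c) E`, `Q_v = E H_u`, `R_u = E H_v`
(`gaussCodazziAt_of_frame`, `coef_flat`). Hence the fundamental theorem of surface theory: data that
satisfy these equations come from an immersion, which is unique up to an orientation preserving
isometry.

The prescribed function is made for these equations. One has `H_c² + c = (1 + c f²)(1 + c g²) / (f +
g)²`, `(H_c)_u = -f_u (1 + c g²) / (f + g)²` and `(H_c)_v = -g_v (1 + c f²) / (f + g)²`. As `1 + c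
f²` depends on `u` only and `1 + c g²` on `v` only, they pass through the derivatives in the Codazzi
equations, and their product does not change `(log E)_uv`. So `(1 + c f²)(1 + c g²) E`, `(1 + c f²)
Q` and `(1 + c g²) R` satisfy the equations for `c = 0` exactly when `E, Q, R` satisfy those for `c`
(`gaussCodazziAt_lawsonH_iff`). For `c = -1` the condition `H_c² > 1` says that the product of the
factors is positive, so that `E > 0` is preserved in both directions.

The fundamental theorem is proved from scratch. Local solutions of the linear system come from a
contraction argument (`exists_solution_linear_system`). They keep the scalar products of the frame
because the inverse relation `Pᵀ G⁻¹ P = D` has constant right-hand side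
(`eventually_gram_of_structure`). Local solutions are unique up to a unique proper isometry; their
locally constant transition functions define a covering of `M`, and simple connectedness supplies a
section, which glues them (`exists_global_of_local`).

The moduli spaces use the identity component only, whereas the data determine an immersion up to a
proper isometry. The group of proper isometries has the identity component and one further coset,
distinguished by the sign of a minor (`mem_identityComponent_iff`, `mem_identityComponent_or`). So
for every `c` a nonempty fibre of the map from classes to normalised data has exactly two points
(`card_fibre`), and the same normalised data occur for `c` and `c'` (`exists_correspondent`). Any
choice of bijections between corresponding fibres gives the required bijection of moduli spaces. -/

theorem fderiv_apply_eq {E : Type*} [NormedAddCommGroup E] [NormedSpace ℝ E] (G : ℝ × ℝ → E)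
    (p w : ℝ × ℝ) : fderiv ℝ G p w = w.1 • dU G p + w.2 • dV G p := by
  have : w = w.1 • ((1, 0) : ℝ × ℝ) + w.2 • ((0, 1) : ℝ × ℝ) := by simp
  conv_lhs => rw [this, map_add, map_smul, map_smul]
  rfl

/-- A solution of a linear total differential inequality that vanishes at a point vanishes near
that point. -/
theorem eventually_eq_zero_of_norm_partial_le {Z : Type*} [NormedAddCommGroup Z] [NormedSpace ℝ Z]
    {z : ℝ × ℝ → Z} {p : ℝ × ℝ} {C : ℝ}
    (h : ∀ᶠ q in 𝓝 p, DifferentiableAt ℝ z q ∧ ‖dU z q‖ ≤ C * ‖z q‖ ∧ ‖dV z q‖ ≤ C * ‖z q‖)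
    (h0 : z p = 0) : ∀ᶠ q in 𝓝 p, z q = 0 := by
  obtain ⟨r, hr, hball⟩ := Metric.eventually_nhds_iff_ball.1 h
  filter_upwards [Metric.ball_mem_nhds p hr] with q hq
  have hmem : ∀ t ∈ Icc (0 : ℝ) 1, p + t • (q - p) ∈ Metric.ball p r := by
    intro t ht
    have := (convex_ball p r).add_smul_sub_mem (Metric.mem_ball_self hr) hq ht
    exact this
  have hder : ∀ t ∈ Icc (0 : ℝ) 1, HasDerivAt (fun t : ℝ => z (p + t • (q - p)))
      (fderiv ℝ z (p + t • (q - p)) (q - p)) t := by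
    intro t ht
    have h1 : HasDerivAt (fun t : ℝ => p + t • (q - p)) (q - p) t := by
      simpa using ((hasDerivAt_id t).smul_const (q - p)).const_add p
    exact (hball _ (hmem t ht)).1.hasFDerivAt.comp_hasDerivAt t h1
  -- Gronwall's inequality along the segment from `p` to `q`.
  have key := eq_zero_of_abs_deriv_le_mul_abs_self_of_eq_zero_right (a := 0) (b := 1)
    (f := fun t : ℝ => z (p + t • (q - p))) (K := (|(q - p).1| + |(q - p).2|) * C)
    (fun t ht => (hder t ht).continuousAt.continuousWithinAt)
    (fun t ht => (hder t ⟨ht.1, ht.2.le⟩).hasDerivWithinAt) (by simp [h0]) (by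
      intro t ht
      obtain ⟨-, h1, h2⟩ := hball _ (hmem t ⟨ht.1, ht.2.le⟩)
      rw [fderiv_apply_eq]
      refine (norm_add_le _ _).trans ?_
      rw [norm_smul, norm_smul, Real.norm_eq_abs, Real.norm_eq_abs]
      nlinarith [mul_le_mul_of_nonneg_left h1 (abs_nonneg (q - p).1),
        mul_le_mul_of_nonneg_left h2 (abs_nonneg (q - p).2)])
  simpa using key 1 (by simp)

/-- Projection of the line onto the interval of radius `ε` around `a`. -/
def clampAt (a ε x : ℝ) : ℝ := max (a - ε) (min (a + ε) x)

theorem continuous_clampAt (a ε : ℝ) : Continuous (clampAt a ε) := by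
  unfold clampAt; fun_prop

theorem abs_clampAt_sub_le {a ε : ℝ} (hε : 0 ≤ ε) (x : ℝ) : |clampAt a ε x - a| ≤ ε := by
  unfold clampAt
  rw [abs_le]
  constructor
  · linarith [le_max_left (a - ε) (min (a + ε) x)]
  · have : max (a - ε) (min (a + ε) x) ≤ a + ε :=
      max_le (by linarith) (min_le_left _ _)
    linarith

theorem clampAt_of_abs_le {a ε x : ℝ} (h : |x - a| ≤ ε) : clampAt a ε x = x := by
  rw [abs_le] at h
  unfold clampAt
  rw [min_eq_right (by linarith), max_eq_right (by linarith)]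

section Frobenius

variable {Z : Type*} [NormedAddCommGroup Z] [NormedSpace ℝ Z]

/-- A contraction argument along L-shaped paths: first in the `u` direction at height `v₀`, then in
the `v` direction. Integrability plays no role yet; it is what makes the fixed point solve both
equations. Each of the two integrals contributes a Lipschitz constant `ε C`, and `4 ε C ≤ 1` makes
the total at most `1/2`. -/
theorem exists_integral_fixedPoint [CompleteSpace Z] {A B : ℝ × ℝ → Z →L[ℝ] Z}
    (hA : Continuous A) (hB : Continuous B) {C ε : ℝ} (hε : 0 < ε) (hC : 0 ≤ C)
    (hAC : ∀ q, ‖A q‖ ≤ C) (hBC : ∀ q, ‖B q‖ ≤ C) (hεC : 4 * (ε * C) ≤ 1) (u₀ v₀ : ℝ) (z₀ : Z) :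
    ∃ z : ℝ × ℝ → Z, Continuous z ∧ (∃ M, ∀ q, ‖z q‖ ≤ M) ∧
      ∀ u v, |u - u₀| ≤ ε → |v - v₀| ≤ ε →
        z (u, v) = z₀ + (∫ s in u₀..u, A (s, v₀) (z (s, v₀))) +
          ∫ t in v₀..v, B (u, t) (z (u, t)) := by
  let c₁ := clampAt u₀ ε
  let c₂ := clampAt v₀ ε
  have hc₁ : Continuous c₁ := continuous_clampAt _ _
  have hc₂ : Continuous c₂ := continuous_clampAt _ _
  -- Clamping the end points makes the operator act on bounded continuous functions on the whole
  -- plane, with intervals of integration of length at most `ε`.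
  let f : (ℝ × ℝ → Z) → ℝ × ℝ → Z := fun z q =>
    z₀ + (∫ s in u₀..c₁ q.1, A (s, v₀) (z (s, v₀))) +
      ∫ t in v₀..c₂ q.2, B (c₁ q.1, t) (z (c₁ q.1, t))
  have hf : ∀ z : ℝ × ℝ → Z, Continuous z → Continuous (f z) := by
    intro z hz
    have h1 : Continuous fun x : ℝ => ∫ s in u₀..x, A (s, v₀) (z (s, v₀)) :=
      intervalIntegral.continuous_primitive
        (fun a b => Continuous.intervalIntegrable (by fun_prop) a b) u₀
    have h2 : Continuous fun q : ℝ × ℝ => ∫ t in v₀..c₂ q.2, B (c₁ q.1, t) (z (c₁ q.1, t)) :=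
      intervalIntegral.continuous_parametric_intervalIntegral_of_continuous
        (by simp only [Function.uncurry_def]; fun_prop) (by fun_prop)
    exact (continuous_const.add (h1.comp (hc₁.comp continuous_fst))).add h2
  have hI : ∀ (g : ℝ → Z) (a b D : ℝ), |b - a| ≤ ε → (∀ x, ‖g x‖ ≤ D) → 0 ≤ D →
      ‖∫ x in a..b, g x‖ ≤ ε * D := by
    intro g a b D hab hg hD
    refine (intervalIntegral.norm_integral_le_of_norm_le_const fun x _ => hg x).trans ?_
    rw [mul_comm]
    exact mul_le_mul_of_nonneg_right hab hD
  have hAz : ∀ (L : Z →L[ℝ] Z) (x : Z) (D : ℝ), ‖L‖ ≤ C → ‖x‖ ≤ D → ‖L x‖ ≤ C * D := by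
    intro L x D hL hx
    exact (L.le_opNorm x).trans (mul_le_mul hL hx (norm_nonneg _) hC)
  have hfb : ∀ (z : ℝ × ℝ → Z) (D : ℝ), (∀ q, ‖z q‖ ≤ D) → 0 ≤ D → ∀ q,
      ‖f z q‖ ≤ ‖z₀‖ + ε * (C * D) + ε * (C * D) := by
    intro z D hz hD q
    refine (norm_add_le _ _).trans (add_le_add ((norm_add_le _ _).trans (add_le_add le_rfl ?_)) ?_)
    · exact hI _ _ _ _ (abs_clampAt_sub_le hε.le _) (fun x => hAz _ _ _ (hAC _) (hz _))
        (mul_nonneg hC hD)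
    · exact hI _ _ _ _ (abs_clampAt_sub_le hε.le _) (fun x => hAz _ _ _ (hBC _) (hz _))
        (mul_nonneg hC hD)
  let T : BoundedContinuousFunction (ℝ × ℝ) Z → BoundedContinuousFunction (ℝ × ℝ) Z := fun z =>
    BoundedContinuousFunction.ofNormedAddCommGroup (f z) (hf z z.continuous) _
      (hfb z ‖z‖ z.norm_coe_le_norm (norm_nonneg _))
  have hT : ContractingWith (1 / 2) T := by
    refine ⟨by norm_num, LipschitzWith.of_dist_le_mul fun z w => ?_⟩
    rw [BoundedContinuousFunction.dist_le (by positivity)]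
    intro q
    have e : f z q - f w q = (∫ s in u₀..c₁ q.1, A (s, v₀) ((z - w) (s, v₀))) +
        ∫ t in v₀..c₂ q.2, B (c₁ q.1, t) ((z - w) (c₁ q.1, t)) := by
      simp only [f, BoundedContinuousFunction.coe_sub, Pi.sub_apply, map_sub]
      rw [intervalIntegral.integral_sub, intervalIntegral.integral_sub]
      · abel
      all_goals exact Continuous.intervalIntegrable (by fun_prop) _ _
    have hb : ∀ q, ‖(z - w) q‖ ≤ dist z w := fun q => by
      rw [dist_eq_norm]; exact (z - w).norm_coe_le_norm q
    have hd : 0 ≤ dist z w := dist_nonneg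
    have h1 : ‖∫ s in u₀..c₁ q.1, A (s, v₀) ((z - w) (s, v₀))‖ ≤ ε * (C * dist z w) :=
      hI _ _ _ _ (abs_clampAt_sub_le hε.le _) (fun x => hAz _ _ _ (hAC _) (hb _))
        (mul_nonneg hC hd)
    have h2 : ‖∫ t in v₀..c₂ q.2, B (c₁ q.1, t) ((z - w) (c₁ q.1, t))‖ ≤ ε * (C * dist z w) :=
      hI _ _ _ _ (abs_clampAt_sub_le hε.le _) (fun x => hAz _ _ _ (hBC _) (hb _))
        (mul_nonneg hC hd)
    change dist (f z q) (f w q) ≤ _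
    rw [dist_eq_norm, e]
    refine (norm_add_le _ _).trans ?_
    have : ((1 / 2 : NNReal) : ℝ) = 1 / 2 := by norm_num
    rw [this]
    nlinarith [mul_le_mul_of_nonneg_right hεC hd]
  let z := ContractingWith.fixedPoint T hT
  have hz : T z = z := hT.fixedPoint_isFixedPt
  refine ⟨z, z.continuous, ⟨‖z‖, z.norm_coe_le_norm⟩, fun u v hu hv => ?_⟩
  have := congrArg (fun y : BoundedContinuousFunction (ℝ × ℝ) Z => y (u, v)) hz
  rw [← this]
  change f z (u, v) = _
  simp only [f, c₁, c₂, clampAt_of_abs_le hu, clampAt_of_abs_le hv]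

end Frobenius

section Frobenius

variable {Z : Type*} [NormedAddCommGroup Z] [NormedSpace ℝ Z]

/-- The `v` equation is the derivative of the integral equation. For the `u` equation, `z` is
compared with the function `θ` obtained by integrating `A z` in `u` at fixed height `v`. The
flatness condition, where `A'` and `B'` stand for `A_v` and `B_u`, shows that `δ = θ - z` solves a
homogeneous linear integro-differential equation in `v` with initial value zero; hence `δ = 0`. -/
theorem hasDerivAt_of_integral_fixedPoint [CompleteSpace Z] {A B A' B' : ℝ × ℝ → Z →L[ℝ] Z}
    (hA : Continuous A) (hB : Continuous B) (hA' : Continuous A') (hB' : Continuous B')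
    {C ε : ℝ} (hε : 0 < ε) (hε1 : ε ≤ 1) (hC : 0 ≤ C)
    (hAC : ∀ q, ‖A q‖ ≤ C) (hBC : ∀ q, ‖B q‖ ≤ C) (hA'C : ∀ q, ‖A' q‖ ≤ C)
    (hB'C : ∀ q, ‖B' q‖ ≤ C) (hεC : 4 * (ε * C) ≤ 1) {u₀ v₀ : ℝ} {z₀ : Z}
    (hAd : ∀ u v, |u - u₀| < ε → |v - v₀| < ε → HasDerivAt (fun t => A (u, t)) (A' (u, v)) v)
    (hBd : ∀ u v, |u - u₀| < ε → |v - v₀| < ε → HasDerivAt (fun s => B (s, v)) (B' (u, v)) u)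
    (hflat : ∀ u v, |u - u₀| < ε → |v - v₀| < ε → ∀ x,
      A' (u, v) x + A (u, v) (B (u, v) x) = B' (u, v) x + B (u, v) (A (u, v) x))
    {z : ℝ × ℝ → Z} (hz : Continuous z) {M : ℝ} (hM : ∀ q, ‖z q‖ ≤ M)
    (hfix : ∀ u v, |u - u₀| ≤ ε → |v - v₀| ≤ ε →
        z (u, v) = z₀ + (∫ s in u₀..u, A (s, v₀) (z (s, v₀))) +
          ∫ t in v₀..v, B (u, t) (z (u, t))) {u v : ℝ} (hu : |u - u₀| < ε) (hv : |v - v₀| < ε) :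
    HasDerivAt (fun s => z (s, v)) (A (u, v) (z (u, v))) u ∧
      HasDerivAt (fun t => z (u, t)) (B (u, v) (z (u, v))) v := by
  have hev : ∀ {a x : ℝ}, |x - a| < ε → ∀ᶠ y in 𝓝 x, |y - a| < ε := by
    intro a x h
    exact (isOpen_lt (by fun_prop) continuous_const).mem_nhds h
  have hself : ∀ a : ℝ, |a - a| < ε := fun a => by simpa using hε
  have hseg : ∀ {a x s : ℝ}, |x - a| < ε → s ∈ uIcc a x → |s - a| < ε := by
    intro a x s h hs
    exact (abs_sub_left_of_mem_uIcc hs).trans_lt h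
  have hzv : ∀ u v, |u - u₀| < ε → |v - v₀| < ε →
      HasDerivAt (fun t => z (u, t)) (B (u, v) (z (u, v))) v := by
    intro u v hu hv
    have h1 : HasDerivAt (fun y => ∫ t in v₀..y, B (u, t) (z (u, t))) (B (u, v) (z (u, v))) v := by
      have hc : Continuous fun t => B (u, t) (z (u, t)) := by fun_prop
      exact intervalIntegral.integral_hasDerivAt_right (hc.intervalIntegrable _ _)
        (hc.stronglyMeasurableAtFilter _ _) hc.continuousAt
    refine (h1.const_add (z₀ + ∫ s in u₀..u, A (s, v₀) (z (s, v₀)))).congr_of_eventuallyEq ?_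
    filter_upwards [hev hv] with y hy
    exact hfix u y hu.le hy.le
  let θ : ℝ → ℝ → Z := fun u v => z (u₀, v) + ∫ s in u₀..u, A (s, v) (z (s, v))
  have hθu : ∀ u v, HasDerivAt (fun s => θ s v) (A (u, v) (z (u, v))) u := by
    intro u v
    have hc : Continuous fun s => A (s, v) (z (s, v)) := by fun_prop
    exact (intervalIntegral.integral_hasDerivAt_right (hc.intervalIntegrable u₀ u)
      (hc.stronglyMeasurableAtFilter _ _) hc.continuousAt).const_add _
  have hθc : ∀ v, Continuous fun s => θ s v := fun v =>
    continuous_iff_continuousAt.2 fun u => (hθu u v).continuousAt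
  have hθv : ∀ u v, |u - u₀| < ε → |v - v₀| < ε → HasDerivAt (fun t => θ u t)
      (B (u₀, v) (z (u₀, v)) + ∫ s in u₀..u, (A' (s, v) (z (s, v)) +
        A (s, v) (B (s, v) (z (s, v))))) v := by
    intro u v hu hv
    have hM0 : 0 ≤ M := (norm_nonneg _).trans (hM 0)
    refine (hzv u₀ v (hself _) hv).add ?_
    refine (intervalIntegral.hasDerivAt_integral_of_dominated_loc_of_deriv_le
      (F := fun t s => A (s, t) (z (s, t)))
      (F' := fun t s => A' (s, t) (z (s, t)) + A (s, t) (B (s, t) (z (s, t))))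
      (bound := fun _ => C * M + C * (C * M)) (s := {y | |y - v₀| < ε}) (hev hv) ?_ ?_ ?_ ?_ ?_ ?_).2
    · exact Filter.Eventually.of_forall fun t => Continuous.aestronglyMeasurable (by fun_prop)
    · exact Continuous.intervalIntegrable (by fun_prop) _ _
    · exact Continuous.aestronglyMeasurable (by fun_prop)
    · refine Filter.Eventually.of_forall fun s _ t _ => (norm_add_le _ _).trans (add_le_add ?_ ?_)
      · exact ((A' (s, t)).le_opNorm _).trans (mul_le_mul (hA'C _) (hM _) (norm_nonneg _) hC)
      · refine ((A (s, t)).le_opNorm _).trans (mul_le_mul (hAC _) ?_ (norm_nonneg _) hC)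
        exact ((B (s, t)).le_opNorm _).trans (mul_le_mul (hBC _) (hM _) (norm_nonneg _) hC)
    · exact intervalIntegrable_const
    · refine Filter.Eventually.of_forall fun s hs t ht => ?_
      have hs' := hseg hu (uIoc_subset_uIcc hs)
      exact (hAd s t hs' ht).clm_apply (hzv s t hs' ht)
  -- Flatness rewrites the integrand of `θ_v` as `∂_s (B θ) - B' δ`. The total derivative integrates
  -- to a boundary term, and the part at `u₀` cancels against `B z` there.
  let δ : ℝ → ℝ → Z := fun u v => θ u v - z (u, v)
  have hδv : ∀ u v, |u - u₀| < ε → |v - v₀| < ε → HasDerivAt (fun t => δ u t)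
      (B (u, v) (δ u v) - ∫ s in u₀..u, B' (s, v) (δ s v)) v := by
    intro u v hu hv
    have h := (hθv u v hu hv).sub (hzv u v hu hv)
    refine h.congr_deriv ?_
    have hd : ∀ s ∈ uIcc u₀ u, HasDerivAt (fun s => B (s, v) (θ s v))
        (B' (s, v) (θ s v) + B (s, v) (A (s, v) (z (s, v)))) s := fun s hs =>
      (hBd s v (hseg hu hs) hv).clm_apply (hθu s v)
    have hc1 := hθc v
    have e1 := intervalIntegral.integral_eq_sub_of_hasDerivAt hd
      (Continuous.intervalIntegrable (by fun_prop) _ _)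
    have e0 : θ u₀ v = z (u₀, v) := by simp [θ]
    have e2 : (∫ s in u₀..u, (A' (s, v) (z (s, v)) + A (s, v) (B (s, v) (z (s, v))))) =
        (∫ s in u₀..u, (B' (s, v) (θ s v) + B (s, v) (A (s, v) (z (s, v))))) -
          ∫ s in u₀..u, B' (s, v) (δ s v) := by
      rw [← intervalIntegral.integral_sub]
      · refine intervalIntegral.integral_congr fun s hs => ?_
        simp only [hflat s v (hseg hu hs) hv, δ, map_sub]
        abel
      · exact Continuous.intervalIntegrable (by fun_prop) _ _
      · exact Continuous.intervalIntegrable (by fun_prop) _ _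
    rw [e2, e1, e0]
    simp only [δ, map_sub]
    abel
  have hδ0 : ∀ u, |u - u₀| < ε → δ u v₀ = 0 := by
    intro u hu
    have h1 := hfix u v₀ hu.le (hself _).le
    have h2 := hfix u₀ v₀ (hself _).le (hself _).le
    simp only [intervalIntegral.integral_same, add_zero] at h1 h2
    simp only [δ, θ, h1, h2, sub_self]
  -- A bound `D` for `δ` bounds `δ_v` by `2 C D`, using `ε ≤ 1` for the integral term. Integration
  -- over a length below `ε` then improves the bound to `2 ε C D ≤ D / 2`.
  have hind : ∀ n : ℕ, ∀ u v, |u - u₀| < ε → |v - v₀| < ε →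
      ‖δ u v‖ ≤ (2 * M + ε * (C * M)) / 2 ^ n := by
    intro n
    induction n with
    | zero =>
      intro u v hu hv
      have h1 : ‖∫ s in u₀..u, A (s, v) (z (s, v))‖ ≤ C * M * |u - u₀| :=
        intervalIntegral.norm_integral_le_of_norm_le_const fun s _ =>
          ((A (s, v)).le_opNorm _).trans (mul_le_mul (hAC _) (hM _) (norm_nonneg _) hC)
      have hM0 : 0 ≤ M := (norm_nonneg _).trans (hM 0)
      have h2 : C * M * |u - u₀| ≤ ε * (C * M) := by
        rw [mul_comm]; exact mul_le_mul_of_nonneg_right hu.le (mul_nonneg hC hM0)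
      have h3 : ‖δ u v‖ ≤ ‖z (u₀, v)‖ + ‖∫ s in u₀..u, A (s, v) (z (s, v))‖ + ‖z (u, v)‖ :=
        (norm_sub_le _ _).trans (add_le_add (norm_add_le _ _) le_rfl)
      simp only [pow_zero, div_one]
      linarith [hM (u₀, v), hM (u, v)]
    | succ n ih =>
      intro u v hu hv
      set D := (2 * M + ε * (C * M)) / 2 ^ n with hD
      have hD0 : 0 ≤ D := (norm_nonneg _).trans (ih u v hu hv)
      have hb : ∀ y ∈ uIcc v₀ v, ‖B (u, y) (δ u y) - ∫ s in u₀..u, B' (s, y) (δ s y)‖ ≤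
          2 * (C * D) := by
        intro y hy
        have hy' := hseg hv hy
        have h1 : ‖B (u, y) (δ u y)‖ ≤ C * D :=
          ((B (u, y)).le_opNorm _).trans (mul_le_mul (hBC _) (ih _ _ hu hy') (norm_nonneg _) hC)
        have h2 : ‖∫ s in u₀..u, B' (s, y) (δ s y)‖ ≤ C * D * |u - u₀| :=
          intervalIntegral.norm_integral_le_of_norm_le_const fun s hs =>
            ((B' (s, y)).le_opNorm _).trans (mul_le_mul (hB'C _)
              (ih _ _ (hseg hu (uIoc_subset_uIcc hs)) hy') (norm_nonneg _) hC)
        have h3 : C * D * |u - u₀| ≤ C * D * 1 :=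
          mul_le_mul_of_nonneg_left (hu.le.trans hε1) (mul_nonneg hC hD0)
        refine (norm_sub_le _ _).trans ?_
        linarith
      have := (convex_uIcc v₀ v).norm_image_sub_le_of_norm_hasDerivWithin_le
        (f := fun t => δ u t) (fun y hy => (hδv u y hu (hseg hv hy)).hasDerivWithinAt) hb
        left_mem_uIcc right_mem_uIcc
      simp only [hδ0 u hu, sub_zero] at this
      refine this.trans ?_
      rw [Real.norm_eq_abs, pow_succ, ← div_div, ← hD]
      nlinarith [mul_le_mul_of_nonneg_left hv.le (mul_nonneg (mul_nonneg zero_le_two hC) hD0),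
        mul_le_mul_of_nonneg_right hεC hD0]
  have hδ : ∀ u v, |u - u₀| < ε → |v - v₀| < ε → δ u v = 0 := by
    intro u v hu hv
    rw [← norm_le_zero_iff]
    have ht : Filter.Tendsto (fun n : ℕ => (2 * M + ε * (C * M)) / 2 ^ n) Filter.atTop (𝓝 0) :=
      tendsto_const_nhds.div_atTop (tendsto_pow_atTop_atTop_of_one_lt one_lt_two)
    exact ge_of_tendsto' ht fun n => hind n u v hu hv
  refine ⟨(hθu u v).congr_of_eventuallyEq ?_, hzv u v hu hv⟩
  filter_upwards [hev hu] with s hs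
  exact (sub_eq_zero.1 (hδ s v hs hv)).symm

/-- Bootstrapping: if `z` is `C^n`, then so is its differential `A z du + B z dv`, hence `z` is
`C^(n+1)`. -/
theorem contDiffOn_of_linear_system {A B : ℝ × ℝ → Z →L[ℝ] Z} {s : Set (ℝ × ℝ)} (hs : IsOpen s)
    (hA : ContDiffOn ℝ ∞ A s) (hB : ContDiffOn ℝ ∞ B s) {z : ℝ × ℝ → Z}
    (hz : DifferentiableOn ℝ z s) (hu : ∀ q ∈ s, dU z q = A q (z q))
    (hv : ∀ q ∈ s, dV z q = B q (z q)) : ContDiffOn ℝ ∞ z s := by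
  rw [contDiffOn_infty]
  intro n
  induction n with
  | zero => exact contDiffOn_zero.2 hz.continuousOn
  | succ n ih =>
    have hn : ((n + 1 : ℕ) : WithTop ℕ∞) = n + 1 := by norm_cast
    rw [hn, contDiffOn_succ_iff_fderiv_of_isOpen hs]
    refine ⟨hz, fun h => absurd h (by simp), ?_⟩
    have hA' := (contDiffOn_infty.1 hA n).clm_apply ih
    have hB' := (contDiffOn_infty.1 hB n).clm_apply ih
    have h1 : ContDiffOn ℝ n (fun q =>
        (ContinuousLinearMap.fst ℝ ℝ ℝ).smulRight (A q (z q)) +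
          (ContinuousLinearMap.snd ℝ ℝ ℝ).smulRight (B q (z q))) s := by
      have e := (ContinuousLinearMap.smulRightL ℝ (ℝ × ℝ) Z (ContinuousLinearMap.fst ℝ ℝ ℝ)).contDiff.comp_contDiffOn hA'
      have e' := (ContinuousLinearMap.smulRightL ℝ (ℝ × ℝ) Z (ContinuousLinearMap.snd ℝ ℝ ℝ)).contDiff.comp_contDiffOn hB'
      exact e.add e'
    refine h1.congr fun q hq => ContinuousLinearMap.ext fun w => ?_
    rw [fderiv_apply_eq, hu q hq, hv q hq]
    simp

/-- Linear total differential equations `z_u = A z`, `z_v = B z` with smooth coefficients that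
satisfy the integrability condition have local solutions with any initial value. -/
theorem exists_solution_linear_system [CompleteSpace Z] {A B : ℝ × ℝ → Z →L[ℝ] Z} {p : ℝ × ℝ}
    (hA : ∀ᶠ q in 𝓝 p, ContDiffAt ℝ ∞ A q) (hB : ∀ᶠ q in 𝓝 p, ContDiffAt ℝ ∞ B q)
    (hflat : ∀ᶠ q in 𝓝 p, ∀ x, dV A q x + A q (B q x) = dU B q x + B q (A q x)) (z₀ : Z) :
    ∃ z : ℝ × ℝ → Z, z p = z₀ ∧
      ∀ᶠ q in 𝓝 p, ContDiffAt ℝ ∞ z q ∧ dU z q = A q (z q) ∧ dV z q = B q (z q) := by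
  have hcA' : ∀ q, ContDiffAt ℝ ∞ A q → ContinuousAt (dV A) q := fun q hq =>
    (hq.fderiv_right (m := 0) (by simp)).continuousAt.clm_apply continuousAt_const
  have hcB' : ∀ q, ContDiffAt ℝ ∞ B q → ContinuousAt (dU B) q := fun q hq =>
    (hq.fderiv_right (m := 0) (by simp)).continuousAt.clm_apply continuousAt_const
  -- A common bound near `p` for the coefficients and their cross derivatives. The summand `1` makes
  -- the bounds strict at `p`, and it gives `C ≥ 1`, hence `ε ≤ 1` below.
  set C := ‖A p‖ + ‖B p‖ + ‖dV A p‖ + ‖dU B p‖ + 1 with hC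
  have hC1 : 1 ≤ C := by rw [hC]; linarith [norm_nonneg (A p), norm_nonneg (B p), norm_nonneg (dV A p), norm_nonneg (dU B p)]
  have b1 : ∀ᶠ q in 𝓝 p, ‖A q‖ < C := hA.self_of_nhds.continuousAt.norm.eventually_lt
    continuousAt_const (by rw [hC]; linarith [norm_nonneg (B p), norm_nonneg (dV A p), norm_nonneg (dU B p)])
  have b2 : ∀ᶠ q in 𝓝 p, ‖B q‖ < C := hB.self_of_nhds.continuousAt.norm.eventually_lt
    continuousAt_const (by rw [hC]; linarith [norm_nonneg (A p), norm_nonneg (dV A p), norm_nonneg (dU B p)])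
  have b3 : ∀ᶠ q in 𝓝 p, ‖dV A q‖ < C := (hcA' _ hA.self_of_nhds).norm.eventually_lt
    continuousAt_const (by rw [hC]; linarith [norm_nonneg (A p), norm_nonneg (B p), norm_nonneg (dU B p)])
  have b4 : ∀ᶠ q in 𝓝 p, ‖dU B q‖ < C := (hcB' _ hB.self_of_nhds).norm.eventually_lt
    continuousAt_const (by rw [hC]; linarith [norm_nonneg (A p), norm_nonneg (B p), norm_nonneg (dV A p)])
  obtain ⟨r, hr, hball⟩ := Metric.eventually_nhds_iff_ball.1
    (hA.and <| hB.and <| hflat.and <| b1.and <| b2.and <| b3.and b4)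
  obtain ⟨u₀, v₀⟩ := p
  have hmem : ∀ {u v}, |u - u₀| < r → |v - v₀| < r → (u, v) ∈ Metric.ball (u₀, v₀) r := by
    intro u v h1 h2
    rw [Metric.mem_ball, Prod.dist_eq, Real.dist_eq, Real.dist_eq]
    exact max_lt h1 h2
  set ε := min (r / 2) (1 / (4 * C)) with hε
  have hε0 : 0 < ε := lt_min (by linarith) (by positivity)
  have hεr : ε < r := (min_le_left _ _).trans_lt (by linarith)
  have hεC : 4 * (ε * C) ≤ 1 := by
    have : ε ≤ 1 / (4 * C) := min_le_right _ _
    rw [le_div_iff₀ (by positivity)] at this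
    linarith
  have hε1 : ε ≤ 1 := by nlinarith
  -- The retraction onto the closed square of radius `ε` turns the coefficients into bounded
  -- continuous functions on the plane without changing them inside the square.
  let κ : ℝ × ℝ → ℝ × ℝ := fun q => (clampAt u₀ ε q.1, clampAt v₀ ε q.2)
  have hκc : Continuous κ := ((continuous_clampAt _ _).comp continuous_fst).prodMk
    ((continuous_clampAt _ _).comp continuous_snd)
  have hκm : ∀ q, κ q ∈ Metric.ball (u₀, v₀) r := fun q =>
    hmem ((abs_clampAt_sub_le hε0.le _).trans_lt hεr) ((abs_clampAt_sub_le hε0.le _).trans_lt hεr)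
  have hκ : ∀ u v, |u - u₀| < ε → |v - v₀| < ε → κ (u, v) = (u, v) := by
    intro u v h1 h2
    simp only [κ, clampAt_of_abs_le h1.le, clampAt_of_abs_le h2.le]
  have hcomp : ∀ {G : ℝ × ℝ → Z →L[ℝ] Z}, (∀ q ∈ Metric.ball (u₀, v₀) r, ContinuousAt G q) →
      Continuous (G ∘ κ) := fun h =>
    continuous_iff_continuousAt.2 fun q => ContinuousAt.comp (h _ (hκm q)) hκc.continuousAt
  have cA := hcomp (G := A) fun q hq => (hball q hq).1.continuousAt
  have cB := hcomp (G := B) fun q hq => (hball q hq).2.1.continuousAt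
  have cA' := hcomp (G := dV A) fun q hq => hcA' q (hball q hq).1
  have cB' := hcomp (G := dU B) fun q hq => hcB' q (hball q hq).2.1
  have bA : ∀ q, ‖(A ∘ κ) q‖ ≤ C := fun q => (hball _ (hκm q)).2.2.2.1.le
  have bB : ∀ q, ‖(B ∘ κ) q‖ ≤ C := fun q => (hball _ (hκm q)).2.2.2.2.1.le
  have bA' : ∀ q, ‖(dV A ∘ κ) q‖ ≤ C := fun q => (hball _ (hκm q)).2.2.2.2.2.1.le
  have bB' : ∀ q, ‖(dU B ∘ κ) q‖ ≤ C := fun q => (hball _ (hκm q)).2.2.2.2.2.2.le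
  have hopen : ∀ {a x : ℝ}, |x - a| < ε → ∀ᶠ y in 𝓝 x, |y - a| < ε := by
    intro a x h
    exact (isOpen_lt (by fun_prop) continuous_const).mem_nhds h
  have hAd : ∀ u v, |u - u₀| < ε → |v - v₀| < ε →
      HasDerivAt (fun t => (A ∘ κ) (u, t)) ((dV A ∘ κ) (u, v)) v := by
    intro u v hu hv
    have h1 : HasDerivAt (fun t : ℝ => (u, t)) ((0 : ℝ), (1 : ℝ)) v :=
      (hasDerivAt_const v u).prodMk (hasDerivAt_id v)
    have h2 : HasFDerivAt A (fderiv ℝ A (u, v)) (u, v) :=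
      ((hball _ (hmem (hu.trans hεr) (hv.trans hεr))).1.differentiableAt (by simp)).hasFDerivAt
    have h3 := h2.comp_hasDerivAt v h1
    simp only [Function.comp_apply, hκ u v hu hv]
    refine h3.congr_of_eventuallyEq ?_
    filter_upwards [hopen hv] with t ht
    simp only [Function.comp_apply, hκ u t hu ht]
  have hBd : ∀ u v, |u - u₀| < ε → |v - v₀| < ε →
      HasDerivAt (fun s => (B ∘ κ) (s, v)) ((dU B ∘ κ) (u, v)) u := by
    intro u v hu hv
    have h1 : HasDerivAt (fun s : ℝ => (s, v)) ((1 : ℝ), (0 : ℝ)) u :=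
      (hasDerivAt_id u).prodMk (hasDerivAt_const u v)
    have h2 : HasFDerivAt B (fderiv ℝ B (u, v)) (u, v) :=
      ((hball _ (hmem (hu.trans hεr) (hv.trans hεr))).2.1.differentiableAt (by simp)).hasFDerivAt
    have h3 := h2.comp_hasDerivAt u h1
    simp only [Function.comp_apply, hκ u v hu hv]
    refine h3.congr_of_eventuallyEq ?_
    filter_upwards [hopen hu] with t ht
    simp only [Function.comp_apply, hκ t v ht hv]
  obtain ⟨z, hzc, ⟨M, hM⟩, hfix⟩ :=
    exists_integral_fixedPoint cA cB hε0 (by linarith) bA bB hεC u₀ v₀ z₀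
  have hpart := fun (u v : ℝ) (hu : |u - u₀| < ε) (hv : |v - v₀| < ε) =>
    hasDerivAt_of_integral_fixedPoint cA cB cA' cB' hε0 hε1 (by linarith) bA bB bA' bB' hεC hAd hBd
      (fun u v hu hv x => by
        simp only [Function.comp_apply, hκ u v hu hv]
        exact (hball _ (hmem (hu.trans hεr) (hv.trans hεr))).2.2.1 x) hzc hM hfix hu hv
  let W : Set (ℝ × ℝ) := {q | |q.1 - u₀| < ε ∧ |q.2 - v₀| < ε}
  have hWo : IsOpen W := (isOpen_lt (f := fun q : ℝ × ℝ => |q.1 - u₀|) (by fun_prop)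
    continuous_const).inter (isOpen_lt (f := fun q : ℝ × ℝ => |q.2 - v₀|) (by fun_prop)
    continuous_const)
  have hWb : ∀ q ∈ W, q ∈ Metric.ball (u₀, v₀) r := fun q hq =>
    hmem (hq.1.trans hεr) (hq.2.trans hεr)
  have hfd : ∀ q ∈ W, HasFDerivAt z
      ((ContinuousLinearMap.toSpanSingleton ℝ (A q (z q))).coprod
        (ContinuousLinearMap.toSpanSingleton ℝ (B q (z q)))) q := by
    intro q hq
    -- Continuous partial derivatives give total differentiability.
    have := hasStrictFDerivAt_uncurry_coprod (𝕜 := ℝ) (u := q) (f := fun u v => z (u, v))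
      (f₁ := fun u v => ContinuousLinearMap.toSpanSingleton ℝ ((A ∘ κ) (u, v) (z (u, v))))
      (f₂ := fun u v => ContinuousLinearMap.toSpanSingleton ℝ ((B ∘ κ) (u, v) (z (u, v))))
      (by
        filter_upwards [hWo.mem_nhds hq] with y hy
        exact (hpart y.1 y.2 hy.1 hy.2).1.hasFDerivAt)
      (by
        filter_upwards [hWo.mem_nhds hq] with y hy
        exact (hpart y.1 y.2 hy.1 hy.2).2.hasFDerivAt)
      (by
        have : Continuous fun y : ℝ × ℝ =>
          ContinuousLinearMap.toSpanSingleton ℝ ((A ∘ κ) y (z y)) := by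
            have h := cA.clm_apply hzc
            exact (ContinuousLinearMap.toSpanSingletonCLE (𝕜 := ℝ) (E := Z)).continuous.comp h
        exact this.continuousAt)
      (by
        have : Continuous fun y : ℝ × ℝ =>
          ContinuousLinearMap.toSpanSingleton ℝ ((B ∘ κ) y (z y)) := by
            have h := cB.clm_apply hzc
            exact (ContinuousLinearMap.toSpanSingletonCLE (𝕜 := ℝ) (E := Z)).continuous.comp h
        exact this.continuousAt)
    have h := this.hasFDerivAt
    have e : κ q = q := hκ q.1 q.2 hq.1 hq.2
    simpa only [Function.HasUncurry.uncurry, Function.comp_apply, id, Prod.mk.eta, e] using h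
  have hUV : ∀ q ∈ W, dU z q = A q (z q) ∧ dV z q = B q (z q) := by
    intro q hq
    simp [dU, dV, (hfd q hq).fderiv]
  have hsm : ContDiffOn ℝ ∞ z W := contDiffOn_of_linear_system hWo
    (fun q hq => (hball q (hWb q hq)).1.contDiffWithinAt)
    (fun q hq => (hball q (hWb q hq)).2.1.contDiffWithinAt)
    (fun q hq => (hfd q hq).differentiableAt.differentiableWithinAt)
    (fun q hq => (hUV q hq).1) (fun q hq => (hUV q hq).2)
  refine ⟨z, ?_, ?_⟩
  · have := hfix u₀ v₀ (by simpa using hε0.le) (by simpa using hε0.le)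
    simpa using this
  · filter_upwards [hWo.mem_nhds (show (u₀, v₀) ∈ W by simpa [W] using hε0)] with q hq
    exact ⟨hsm.contDiffAt (hWo.mem_nhds hq), hUV q hq⟩

end Frobenius

/-! ### Gluing local solutions that are unique up to a group action -/

section Gluing

variable {M V G : Type*} [TopologicalSpace M] [Group G] [MulAction G V]

/-- Two global solutions of a problem whose local solutions are unique up to a unique group element
differ by a single group element. -/
theorem exists_smul_eq_of_local [PreconnectedSpace M] [Nonempty M] {Sol : (M → V) → M → Prop}
    (uniq : ∀ Y Y' m, (∀ᶠ q in 𝓝 m, Sol Y q) → (∀ᶠ q in 𝓝 m, Sol Y' q) →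
      ∃ g : G, ∀ᶠ q in 𝓝 m, Y' q = g • Y q)
    (faithful : ∀ Y m (g g' : G), (∀ᶠ q in 𝓝 m, Sol Y q) → (∀ᶠ q in 𝓝 m, g • Y q = g' • Y q) →
      g = g') {Y Y' : M → V} (hY : ∀ m, Sol Y m) (hY' : ∀ m, Sol Y' m) :
    ∃ g : G, ∀ m, Y' m = g • Y m := by
  have hall : ∀ {X : M → V}, (∀ m, Sol X m) → ∀ m, ∀ᶠ q in 𝓝 m, Sol X q := fun h m =>
    Filter.Eventually.of_forall h
  choose g hg using fun m => uniq Y Y' m (hall hY m) (hall hY' m)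
  -- The group element that works near `m` also works near every nearby point, so uniqueness makes
  -- it locally constant.
  have hloc : IsLocallyConstant g := by
    rw [IsLocallyConstant.iff_eventually_eq]
    intro m
    filter_upwards [(hg m).eventually_nhds] with x hx
    refine faithful Y x _ _ (hall hY x) ?_
    filter_upwards [hx, hg x] with q h1 h2
    rw [← h2, h1]
  obtain ⟨m₀⟩ := ‹Nonempty M›
  refine ⟨g m₀, fun m => ?_⟩
  rw [← hloc.apply_eq_of_preconnectedSpace m m₀]
  exact (hg m).self_of_nhds

/-- On a simply connected space, a problem whose local solutions exist and are unique up to a unique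
group element has a global solution. -/
theorem exists_global_of_local [SimplyConnectedSpace M] [LocallyPathConnectedSpace M]
    {Sol : (M → V) → M → Prop}
    (germ : ∀ Y Y' m, (∀ᶠ q in 𝓝 m, Y q = Y' q) → Sol Y m → Sol Y' m)
    (smul : ∀ (g : G) Y m, Sol Y m → Sol (fun q => g • Y q) m)
    (loc : ∀ m, ∃ Y, ∀ᶠ q in 𝓝 m, Sol Y q)
    (uniq : ∀ Y Y' m, (∀ᶠ q in 𝓝 m, Sol Y q) → (∀ᶠ q in 𝓝 m, Sol Y' q) →
      ∃ g : G, ∀ᶠ q in 𝓝 m, Y' q = g • Y q)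
    (faithful : ∀ Y m (g g' : G), (∀ᶠ q in 𝓝 m, Sol Y q) → (∀ᶠ q in 𝓝 m, g • Y q = g' • Y q) →
      g = g') :
    ∃ Y, ∀ m, Sol Y m := by
  classical
  let _ : TopologicalSpace G := ⊥
  have _ : DiscreteTopology G := ⟨rfl⟩
  choose Y hY using loc
  choose U hUsub hUo hmU using fun m => mem_nhds_iff.1 (hY m)
  have hsol : ∀ i, ∀ x ∈ U i, ∀ᶠ q in 𝓝 x, Sol (Y i) q := fun i x hx =>
    Filter.mem_of_superset ((hUo i).mem_nhds hx) (hUsub i)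
  have hT : ∀ i j x, ∃ g : G, x ∈ U i ∩ U j → ∀ᶠ q in 𝓝 x, Y i q = g • Y j q := by
    intro i j x
    by_cases hx : x ∈ U i ∩ U j
    · obtain ⟨g, hg⟩ := uniq _ _ x (hsol j x hx.2) (hsol i x hx.1)
      exact ⟨g, fun _ => hg⟩
    · exact ⟨1, fun h => absurd h hx⟩
  choose T hT using hT
  have hTu : ∀ i j x, x ∈ U i ∩ U j → ∀ g : G, (∀ᶠ q in 𝓝 x, Y i q = g • Y j q) →
      T i j x = g := by
    intro i j x hx g hg
    refine faithful _ x _ _ (hsol j x hx.2) ?_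
    filter_upwards [hT i j x hx, hg] with q h1 h2
    rw [← h1, h2]
  -- The transition elements `T i j` are locally constant, so with the discrete topology on `G` they
  -- define a bundle that is a covering of `M`. They act on fibres from the right: since `Y i = T i
  -- j • Y j`, the local solution `h • Y i` is also `(h * T i j) • Y j`, and a point of the fibre is
  -- a germ of a solution.
  let Z : FiberBundleCore M M G :=
    { baseSet := U
      isOpen_baseSet := hUo
      indexAt := id
      mem_baseSet_at := hmU
      coordChange := fun i j x h => h * T i j x
      coordChange_self := by
        intro i x hx v
        rw [hTu i i x ⟨hx, hx⟩ 1 (by simp), mul_one]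
      continuousOn_coordChange := by
        intro i j
        rintro ⟨x, h⟩ ⟨hx, -⟩
        have hev : ∀ᶠ y in 𝓝 x, T i j y = T i j x := by
          filter_upwards [(hT i j x hx).eventually_nhds, ((hUo i).inter (hUo j)).mem_nhds hx]
            with y hy hyU
          exact hTu i j y hyU _ hy
        refine ContinuousAt.continuousWithinAt ?_
        have hc : ContinuousAt (fun p : M × G => p.2 * T i j x) (x, h) :=
          (continuous_of_discreteTopology (f := fun a : G => a * T i j x)).continuousAt.comp
            continuousAt_snd
        refine hc.congr ?_
        filter_upwards [(continuousAt_fst (p := (x, h))).eventually hev] with p hp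
        simp only [hp]
      coordChange_comp := by
        intro i j k x hx v
        rw [mul_assoc, hTu i k x ⟨hx.1.1, hx.2⟩ (T i j x * T j k x)]
        filter_upwards [hT i j x hx.1, hT j k x ⟨hx.1.2, hx.2⟩] with q h1 h2
        rw [h1, h2, mul_smul] }
  have hcov : IsCoveringMap (Bundle.TotalSpace.proj : Z.TotalSpace → M) :=
    FiberBundle.isCoveringMap (F := G) (E := Z.Fiber)
  obtain ⟨m₀⟩ : Nonempty M := inferInstance
  -- Lifting the identity of the simply connected space `M` gives a global section.
  obtain ⟨s, ⟨-, hs⟩, -⟩ := hcov.existsUnique_continuousMap_lifts (ContinuousMap.id M) m₀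
    (⟨m₀, (1 : G)⟩ : Z.TotalSpace) rfl
  have hs1 : ∀ x, (s x).proj = x := fun x => congrFun hs x
  let g : M → G := fun x => (s x).2
  -- The trivialisation preferred at `x` has index `x` itself, so the section reads `g x • Y x`
  -- there. Near `m` this is a constant element times the single local solution `Y m`.
  refine ⟨fun x => g x • Y x x, fun m => ?_⟩
  have hcont : ContinuousAt (fun x => ((Z.localTriv m) (s x)).2) m := by
    have h1 : ContinuousAt (Z.localTriv m) (s m) :=
      (Z.localTriv m).continuousAt ((Z.mem_localTriv_source m _).2 (by
        rw [hs1]; exact hmU m))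
    exact (continuousAt_snd.comp h1).comp s.continuous.continuousAt
  have hval : ∀ x, ((Z.localTriv m) (s x)).2 = g x * T x m x := by
    intro x
    rw [Z.localTriv_apply]
    change g x * T (s x).proj m (s x).proj = _
    rw [hs1]
  have hconst : ∀ᶠ x in 𝓝 m, g x * T x m x = g m * T m m m := by
    have := hcont.eventually ((isOpen_discrete {g m * T m m m}).mem_nhds (hval m))
    filter_upwards [this] with x hx
    rw [← hval]
    exact hx
  refine germ (fun q => (g m * T m m m) • Y m q) _ m ?_ (smul _ _ _ (hsol m m (hmU m)).self_of_nhds)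
  filter_upwards [hconst, (hUo m).mem_nhds (hmU m)] with x hx hxU
  rw [← hx, mul_smul, ← (hT x m x ⟨hmU x, hxU⟩).self_of_nhds]

end Gluing

/-! ### The scalar products -/

theorem scalarProd_comm (c : SignType) (a b : Fin 4 → ℝ) : scalarProd c a b = scalarProd c b a := by
  simp only [scalarProd]
  exact Finset.sum_congr rfl fun i _ => by ring

theorem scalarProd_add_left (c : SignType) (a a' b : Fin 4 → ℝ) :
    scalarProd c (a + a') b = scalarProd c a b + scalarProd c a' b := by
  simp only [scalarProd, Pi.add_apply, ← Finset.sum_add_distrib]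
  exact Finset.sum_congr rfl fun i _ => by ring

theorem scalarProd_smul_left (c : SignType) (r : ℝ) (a b : Fin 4 → ℝ) :
    scalarProd c (r • a) b = r * scalarProd c a b := by
  simp only [scalarProd, Pi.smul_apply, smul_eq_mul, Finset.mul_sum]
  exact Finset.sum_congr rfl fun i _ => by ring

theorem scalarProd_add_right (c : SignType) (a b b' : Fin 4 → ℝ) :
    scalarProd c a (b + b') = scalarProd c a b + scalarProd c a b' := by
  rw [scalarProd_comm, scalarProd_add_left, scalarProd_comm c b, scalarProd_comm c b']

theorem scalarProd_smul_right (c : SignType) (r : ℝ) (a b : Fin 4 → ℝ) :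
    scalarProd c a (r • b) = r * scalarProd c a b := by
  rw [scalarProd_comm, scalarProd_smul_left, scalarProd_comm]

theorem scalarProd_neg_left (c : SignType) (a b : Fin 4 → ℝ) :
    scalarProd c (-a) b = -scalarProd c a b := by
  rw [← neg_one_smul ℝ a, scalarProd_smul_left, neg_one_mul]

theorem scalarProd_neg_right (c : SignType) (a b : Fin 4 → ℝ) :
    scalarProd c a (-b) = -scalarProd c a b := by
  rw [scalarProd_comm, scalarProd_neg_left, scalarProd_comm]

theorem scalarProd_single_left (c : SignType) (i : Fin 4) (b : Fin 4 → ℝ) :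
    scalarProd c (Pi.single i 1) b = signature c i * b i := by
  simp [scalarProd, Pi.single_apply]

theorem signature_mul_self (c : SignType) (i : Fin 4) : signature c i * signature c i = 1 := by
  cases c <;> fin_cases i <;> simp [signature]

theorem signature_ne_zero (c : SignType) (i : Fin 4) : signature c i ≠ 0 := by
  have := signature_mul_self c i
  intro h
  simp [h] at this

/-- The matrix preserves the scalar product. -/
def PreservesProd (c : SignType) (A : Matrix (Fin 4) (Fin 4) ℝ) : Prop :=
  ∀ p q, scalarProd c (A *ᵥ p) (A *ᵥ q) = scalarProd c p q

theorem scalarProd_eq_dotProduct (c : SignType) (a b : Fin 4 → ℝ) :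
    scalarProd c a b = a ⬝ᵥ (diagonal (signature c) *ᵥ b) := by
  simp only [scalarProd, dotProduct, mulVec_diagonal]
  exact Finset.sum_congr rfl fun i _ => by ring

theorem preservesProd_iff {c : SignType} {A : Matrix (Fin 4) (Fin 4) ℝ} :
    PreservesProd c A ↔ Aᵀ * diagonal (signature c) * A = diagonal (signature c) := by
  have key : ∀ p q, scalarProd c (A *ᵥ p) (A *ᵥ q) =
      p ⬝ᵥ ((Aᵀ * diagonal (signature c) * A) *ᵥ q) := by
    intro p q
    rw [scalarProd_eq_dotProduct, ← mulVec_mulVec, ← mulVec_mulVec, mulVec_transpose,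
      dotProduct_comm, dotProduct_comm p, ← dotProduct_mulVec]
  constructor
  · intro h
    ext i j
    have := h (Pi.single i 1) (Pi.single j 1)
    rw [key, scalarProd_single_left] at this
    by_cases hij : i = j
    · subst hij; simpa using this
    · simpa [hij, Ne.symm hij] using this
  · intro h p q
    rw [key, h, scalarProd_eq_dotProduct]

theorem diagonal_signature_mul_self (c : SignType) :
    diagonal (signature c) * diagonal (signature c) = (1 : Matrix (Fin 4) (Fin 4) ℝ) := by
  rw [diagonal_mul_diagonal, ← diagonal_one]
  congr 1
  funext i
  exact signature_mul_self c i

/-- With `D` the matrix of signs, `Aᵀ D A = D` makes `D Aᵀ D` a left inverse of `A`, hence a right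
inverse. Orthogonality relations for columns thereby hold for rows. -/
theorem PreservesProd.transpose {c : SignType} {A : Matrix (Fin 4) (Fin 4) ℝ}
    (h : PreservesProd c A) : PreservesProd c Aᵀ := by
  rw [preservesProd_iff] at h ⊢
  rw [transpose_transpose]
  set D := diagonal (signature c) with hD
  have hDD : D * D = 1 := diagonal_signature_mul_self c
  have h1 : (D * Aᵀ * D) * A = 1 := by
    rw [mul_assoc D, mul_assoc D, h, hDD]
  have h2 : A * (D * Aᵀ * D) = 1 := mul_eq_one_comm.1 h1
  calc A * D * Aᵀ = A * (D * Aᵀ * D) * D := by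
        simp only [mul_assoc, hDD, mul_one]
    _ = D := by rw [h2, one_mul]

theorem PreservesProd.mul {c : SignType} {A B : Matrix (Fin 4) (Fin 4) ℝ}
    (hA : PreservesProd c A) (hB : PreservesProd c B) : PreservesProd c (A * B) := by
  intro p q
  rw [← mulVec_mulVec, ← mulVec_mulVec, hA, hB]

theorem PreservesProd.scalarProd_col {c : SignType} {A : Matrix (Fin 4) (Fin 4) ℝ}
    (hA : PreservesProd c A) (i j : Fin 4) :
    scalarProd c (fun k => A k i) (fun k => A k j) = if i = j then signature c i else 0 := by
  have h := hA (Pi.single i 1) (Pi.single j 1)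
  rw [scalarProd_single_left] at h
  have e : ∀ i, A *ᵥ Pi.single i 1 = fun k => A k i := fun i => by
    ext k; simp
  rw [e, e] at h
  rw [h]
  by_cases hij : i = j
  · subst hij; simp
  · simp [hij]

/-! ### Sign of the action on the negative definite directions -/

/-- The determinant of the action on the negative definite coordinate subspace; it is taken for
`c = 0` on the same subspace as for `c = -1`. -/
def negMinor : SignType → Matrix (Fin 4) (Fin 4) ℝ → ℝ
  | 1, A => A 0 0
  | 0, A => A 0 0 * A 1 1 - A 0 1 * A 1 0
  | -1, A => A 0 0 * A 1 1 - A 0 1 * A 1 0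

/-- The vectors `p`, `q` span a negative definite plane in signature `(2, 2)`. The projection to the
two negative coordinates is injective on it, because the kernel of this projection is positive
definite. A vanishing minor would give a combination of `p` and `q` in that kernel. -/
theorem minor_ne_zero_of_signature {p q : Fin 4 → ℝ}
    (hp : -p 0 ^ 2 - p 1 ^ 2 + p 2 ^ 2 + p 3 ^ 2 = -1)
    (hq : -q 0 ^ 2 - q 1 ^ 2 + q 2 ^ 2 + q 3 ^ 2 = -1)
    (hpq : -(p 0 * q 0) - p 1 * q 1 + p 2 * q 2 + p 3 * q 3 = 0) :
    p 0 * q 1 - q 0 * p 1 ≠ 0 := by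
  intro h
  have key : ∀ r s : ℝ, r * p 0 - s * q 0 = 0 → r * p 1 - s * q 1 = 0 → r = 0 := by
    intro r s h0 h1
    have e : (r * p 0 - s * q 0) ^ 2 + (r * p 1 - s * q 1) ^ 2 =
        (r * p 2 - s * q 2) ^ 2 + (r * p 3 - s * q 3) ^ 2 + r ^ 2 + s ^ 2 := by
      linear_combination (-r ^ 2) * hp - s ^ 2 * hq + 2 * r * s * hpq
    rw [h0, h1] at e
    nlinarith [sq_nonneg (r * p 2 - s * q 2), sq_nonneg (r * p 3 - s * q 3), sq_nonneg r,
      sq_nonneg s]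
  have q0 : q 0 = 0 := key (q 0) (p 0) (by ring) (by linarith)
  have q1 : q 1 = 0 := key (q 1) (p 1) (by linarith) (by ring)
  rw [q0, q1] at hq
  nlinarith [sq_nonneg (q 2), sq_nonneg (q 3)]

theorem PreservesProd.negMinor_ne_zero {c : SignType} {A : Matrix (Fin 4) (Fin 4) ℝ}
    (hA : PreservesProd c A) : negMinor c A ≠ 0 := by
  have h0 := hA.scalarProd_col 0 0
  have h1 := hA.scalarProd_col 1 1
  have h01 := hA.scalarProd_col 0 1
  cases c
  · simp [scalarProd, Fin.sum_univ_four, signature] at h0 h1 h01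
    exact minor_ne_zero_of_signature (p := fun k => A k 0) (q := fun k => A k 1)
      (by linarith) (by linarith) (by linarith)
  · simp [scalarProd, Fin.sum_univ_four, signature] at h0 h1 h01
    exact minor_ne_zero_of_signature (p := fun k => A k 0) (q := fun k => A k 1)
      (by linarith) (by linarith) (by linarith)
  · simp [scalarProd, Fin.sum_univ_four, signature] at h0
    change A 0 0 ≠ 0
    intro h
    rw [h] at h0
    nlinarith [sq_nonneg (A 1 0), sq_nonneg (A 2 0), sq_nonneg (A 3 0)]

theorem PreservesProd.det_ne_zero {c : SignType} {A : Matrix (Fin 4) (Fin 4) ℝ}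
    (hA : PreservesProd c A) : A.det ≠ 0 := by
  have h := congrArg Matrix.det (preservesProd_iff.1 hA)
  rw [det_mul, det_mul, det_transpose] at h
  intro h0
  rw [h0] at h
  simp [Finset.prod_eq_zero_iff, signature_ne_zero, eq_comm] at h

/-! ### Orientation preserving isometries -/

/-- The isometries that preserve the orientation of the ambient space and, for `c = 0`, the
ambient normal vector of the hyperplane. -/
def properIsometries (c : SignType) : Set (Matrix (Fin 4) (Fin 4) ℝ × (Fin 4 → ℝ)) :=
  {T | PreservesProd c T.1 ∧ 0 < T.1.det ∧
    (c = 0 → T.1 *ᵥ Pi.single 0 1 = Pi.single 0 1 ∧ T.2 0 = 0) ∧ (c ≠ 0 → T.2 = 0)}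

theorem scalarProd_zero_single (x : Fin 4 → ℝ) : scalarProd 0 x (Pi.single 0 1) = -x 0 := by
  rw [scalarProd_comm, scalarProd_single_left]
  simp [signature]

theorem spaceForm_of_ne_zero {c : SignType} (hc : c ≠ 0) :
    spaceForm c = {p | scalarProd c p p = (c : ℝ)} := by
  cases c
  · exact absurd rfl hc
  · simp [spaceForm]
  · simp [spaceForm]

theorem mem_isometries_of_preservesProd {c : SignType} {A : Matrix (Fin 4) (Fin 4) ℝ}
    {b : Fin 4 → ℝ} (h1 : PreservesProd c A)
    (h3 : c = 0 → A *ᵥ Pi.single 0 1 = Pi.single 0 1 ∧ b 0 = 0) (h4 : c ≠ 0 → b = 0) :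
    (A, b) ∈ isometries c := by
  refine ⟨h1, fun p => ?_⟩
  by_cases hc : c = 0
  · subst hc
    obtain ⟨h5, h6⟩ := h3 rfl
    have : (A *ᵥ p) 0 = p 0 := by
      have := h1 p (Pi.single 0 1)
      rw [h5, scalarProd_zero_single, scalarProd_zero_single] at this
      linarith
    simp [spaceForm, this, h6]
  · have h1' : scalarProd c (A *ᵥ p) (A *ᵥ p) = scalarProd c p p := h1 p p
    simp only [spaceForm_of_ne_zero hc, mem_ofPred_eq, h4 hc, add_zero, h1']

theorem properIsometries_subset (c : SignType) : properIsometries c ⊆ isometries c :=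
  fun _ h => mem_isometries_of_preservesProd h.1 h.2.2.1 h.2.2.2

/-- The quadric is symmetric under `p ↦ -p`. If `b = A b'`, then `p + b'` and `-p + b'` both have
the scalar square `c`, so `b'` is orthogonal to every point `p` of the quadric, and the quadric
spans the whole space. -/
theorem snd_eq_zero_of_mem_isometries {c : SignType} (hc : c ≠ 0)
    {T : Matrix (Fin 4) (Fin 4) ℝ × (Fin 4 → ℝ)} (hT : T ∈ isometries c) : T.2 = 0 := by
  obtain ⟨A, b⟩ := T
  have hd := isUnit_det_of_mem_isometries hT
  obtain ⟨h1, h2⟩ := hT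
  simp only at h1 h2 hd ⊢
  set b' := A⁻¹ *ᵥ b with hb'
  have hb : b = A *ᵥ b' := by
    rw [hb', mulVec_mulVec, mul_nonsing_inv _ hd, one_mulVec]
  have key : ∀ p, scalarProd c p p = c → scalarProd c p b' = 0 := by
    intro p hp
    rw [spaceForm_of_ne_zero hc] at h2
    have e1 := (h2 p).2 hp
    have e2 := (h2 (-p)).2 (by
      simpa only [mem_ofPred_eq, scalarProd_neg_left, scalarProd_neg_right, neg_neg] using hp)
    simp only [mem_ofPred_eq, hb, ← mulVec_add, h1] at e1 e2
    rw [scalarProd_add_left, scalarProd_add_right, scalarProd_add_right] at e1 e2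
    simp only [scalarProd_neg_left, scalarProd_neg_right, neg_neg] at e2
    rw [scalarProd_comm c b' p] at e1 e2
    linarith
  -- Coordinate vectors of the wrong sign are not on the quadric; adding a vector of the right sign,
  -- with `√2` on the latter, puts the sum on it.
  have hs : (Real.sqrt 2) * Real.sqrt 2 = 2 := Real.mul_self_sqrt (by norm_num)
  have h0 : b' = 0 := by
    cases c
    · exact absurd rfl hc
    · have k0 := key ![1, 0, 0, 0] (by simp [scalarProd, Fin.sum_univ_four, signature])
      have k1 := key ![0, 1, 0, 0] (by simp [scalarProd, Fin.sum_univ_four, signature])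
      have k2 := key ![Real.sqrt 2, 0, 1, 0] (by
        simp [scalarProd, Fin.sum_univ_four, signature]; linarith)
      have k3 := key ![Real.sqrt 2, 0, 0, 1] (by
        simp [scalarProd, Fin.sum_univ_four, signature]; linarith)
      simp [scalarProd, Fin.sum_univ_four, signature] at k0 k1 k2 k3
      simp [k0] at k2 k3
      funext i; fin_cases i <;> simp [k0, k1, k2, k3]
    · have k0 := key ![0, 1, 0, 0] (by simp [scalarProd, Fin.sum_univ_four, signature])
      have k1 := key ![0, 0, 1, 0] (by simp [scalarProd, Fin.sum_univ_four, signature])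
      have k2 := key ![0, 0, 0, 1] (by simp [scalarProd, Fin.sum_univ_four, signature])
      have k3 := key ![1, Real.sqrt 2, 0, 0] (by
        simp [scalarProd, Fin.sum_univ_four, signature]; linarith)
      simp [scalarProd, Fin.sum_univ_four, signature] at k0 k1 k2 k3
      simp [k0] at k3
      funext i; fin_cases i <;> simp_all
  rw [hb, h0, mulVec_zero]

/-- By the intermediate value theorem, a continuous function without zeros on the group keeps its
sign on the identity component. -/
theorem pos_of_mem_identityComponent {c : SignType}
    {φ : Matrix (Fin 4) (Fin 4) ℝ × (Fin 4 → ℝ) → ℝ} (hφ : Continuous φ)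
    (hne : ∀ T ∈ isometries c, φ T ≠ 0) (h1 : 0 < φ (1, 0))
    {T : Matrix (Fin 4) (Fin 4) ℝ × (Fin 4 → ℝ)} (hT : T ∈ identityComponent c) : 0 < φ T := by
  by_contra hn
  obtain ⟨S, hS, h0⟩ := (isPreconnected_connectedComponentIn (x := (1, 0))
    (F := isometries c)).intermediate_value hT (mem_connectedComponentIn (one_mem_isometries c))
    hφ.continuousOn ⟨not_lt.1 hn, h1.le⟩
  exact hne S (connectedComponentIn_subset _ _ hS) h0

theorem continuous_negMinor (c : SignType) : Continuous (negMinor c) := by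
  cases c
  · change Continuous fun A : Matrix (Fin 4) (Fin 4) ℝ => A 0 0 * A 1 1 - A 0 1 * A 1 0
    fun_prop
  · change Continuous fun A : Matrix (Fin 4) (Fin 4) ℝ => A 0 0 * A 1 1 - A 0 1 * A 1 0
    fun_prop
  · change Continuous fun A : Matrix (Fin 4) (Fin 4) ℝ => A 0 0
    fun_prop

theorem negMinor_one (c : SignType) : negMinor c 1 = 1 := by
  cases c
  · change (1 : Matrix (Fin 4) (Fin 4) ℝ) 0 0 * (1 : Matrix (Fin 4) (Fin 4) ℝ) 1 1 -
      (1 : Matrix (Fin 4) (Fin 4) ℝ) 0 1 * (1 : Matrix (Fin 4) (Fin 4) ℝ) 1 0 = 1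
    simp
  · change (1 : Matrix (Fin 4) (Fin 4) ℝ) 0 0 * (1 : Matrix (Fin 4) (Fin 4) ℝ) 1 1 -
      (1 : Matrix (Fin 4) (Fin 4) ℝ) 0 1 * (1 : Matrix (Fin 4) (Fin 4) ℝ) 1 0 = 1
    simp
  · rfl

/-- Mapping the hyperplane to itself kills the off-diagonal entries of row `0`. The orthogonality of
row `0` to the other rows then kills those of column `0`. -/
theorem isometries_zero_normal {T : Matrix (Fin 4) (Fin 4) ℝ × (Fin 4 → ℝ)}
    (hT : T ∈ isometries 0) : T.2 0 = 0 ∧ T.1 *ᵥ Pi.single 0 1 = Pi.single 0 (T.1 0 0) ∧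
      T.1 0 0 ≠ 0 := by
  obtain ⟨A, b⟩ := T
  obtain ⟨h1, h2⟩ := hT
  simp only at h1 h2 ⊢
  have hb : b 0 = 0 := by
    have := (h2 0).2 (by simp [spaceForm])
    simpa [spaceForm] using this
  have hrow : ∀ j : Fin 4, j ≠ 0 → A 0 j = 0 := by
    intro j hj
    have := (h2 (Pi.single j 1)).2 (by simp [spaceForm, hj.symm])
    simpa [spaceForm, hb] using this
  have hP : PreservesProd 0 A := h1
  have r : ∀ i, scalarProd 0 (fun k => A 0 k) (fun k => A i k) =
      if 0 = i then signature 0 0 else 0 := fun i => hP.transpose.scalarProd_col 0 i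
  have a1 := hrow 1 (by decide)
  have a2 := hrow 2 (by decide)
  have a3 := hrow 3 (by decide)
  have r0 := r 0
  have r1 := r 1
  have r2 := r 2
  have r3 := r 3
  simp [scalarProd, Fin.sum_univ_four, signature, a1, a2, a3] at r0 r1 r2 r3
  have h00 : A 0 0 ≠ 0 := by
    intro h; rw [h] at r0; norm_num at r0
  refine ⟨hb, ?_, h00⟩
  funext i
  fin_cases i <;> simp_all

/-- The determinant, the minor and, for `c = 0`, the entry `A 0 0` have no zeros on the isometry
group and are positive at the identity. In the last case the entry is also of square `1`, so it
equals `1`. -/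
theorem identityComponent_subset (c : SignType) :
    identityComponent c ⊆ {T | T ∈ properIsometries c ∧ 0 < negMinor c T.1} := by
  intro T hT
  have hTi : T ∈ isometries c := connectedComponentIn_subset _ _ hT
  refine ⟨⟨hTi.1, ?_, ?_, fun hc => snd_eq_zero_of_mem_isometries hc hTi⟩, ?_⟩
  · exact pos_of_mem_identityComponent (φ := fun T => T.1.det) (by fun_prop)
      (fun S hS => PreservesProd.det_ne_zero hS.1) (by simp) hT
  · rintro rfl
    obtain ⟨h1, h2, h3⟩ := isometries_zero_normal hTi
    refine ⟨?_, h1⟩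
    have hpos : 0 < T.1 0 0 := pos_of_mem_identityComponent (φ := fun T => T.1 0 0) (by fun_prop)
      (fun S hS => (isometries_zero_normal hS).2.2) (by simp) hT
    have hP : PreservesProd 0 T.1 := hTi.1
    have := hP (Pi.single 0 1) (Pi.single 0 1)
    rw [h2] at this
    simp [scalarProd, Fin.sum_univ_four, signature] at this
    have : T.1 0 0 = 1 := by nlinarith
    rw [h2, this]
  · exact pos_of_mem_identityComponent (φ := fun T => negMinor c T.1)
      ((continuous_negMinor c).comp continuous_fst)
      (fun S hS => PreservesProd.negMinor_ne_zero hS.1) (by simp [negMinor_one]) hT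

/-! ### The identity component of the isometry group -/

/-- The linear map that acts on the `i`-th and the `j`-th coordinate by `(x, y) ↦ (a x + s b y, b x + a y)`
with `s = -1` (a rotation) if the signs of both coordinates agree and `s = 1` (a boost) if not. -/
def planeMap (c : SignType) (i j : Fin 4) (a b : ℝ) : Matrix (Fin 4) (Fin 4) ℝ :=
  of fun k l => if k = i then (if l = i then a else if l = j then
    -(signature c i * signature c j) * b else 0) else
    if k = j then (if l = i then b else if l = j then a else 0) else if k = l then 1 else 0

theorem planeMap_mulVec {c : SignType} {i j : Fin 4} (hij : i ≠ j) (a b : ℝ) (x : Fin 4 → ℝ)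
    (k : Fin 4) : (planeMap c i j a b *ᵥ x) k =
      if k = i then a * x i - signature c i * signature c j * b * x j else
        if k = j then b * x i + a * x j else x k := by
  simp only [mulVec, dotProduct, planeMap, of_apply]
  by_cases hki : k = i
  · simp only [hki, if_true]
    rw [Finset.sum_eq_add i j hij (fun l _ h => by simp [h.1, h.2]) (by simp) (by simp)]
    simp [hij.symm]
    ring
  · by_cases hkj : k = j
    · simp only [hkj, hij.symm, if_true, if_false]
      rw [Finset.sum_eq_add i j hij (fun l _ h => by simp [h.1, h.2]) (by simp) (by simp)]
      simp [hij.symm]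
    · simp [hki, hkj]

theorem planeMap_preservesProd {c : SignType} {i j : Fin 4} (hij : i ≠ j) {a b : ℝ}
    (h : a ^ 2 + signature c i * signature c j * b ^ 2 = 1) :
    PreservesProd c (planeMap c i j a b) := by
  intro x y
  rw [← sub_eq_zero]
  simp only [scalarProd, ← Finset.sum_sub_distrib]
  rw [Finset.sum_eq_add i j hij]
  · simp only [planeMap_mulVec hij, if_true, hij.symm, if_false]
    have h1 := signature_mul_self c i
    set s := signature c i
    set t := signature c j
    linear_combination (s * x i * y i + t * x j * y j) * h + (s * b ^ 2 * t ^ 2 * x j * y j -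
      t * b ^ 2 * x i * y i - a * b * t * (x i * y j + x j * y i)) * h1
  · intro k _ hk
    simp only [planeMap_mulVec hij, hk.1, hk.2, if_false, sub_self]
  · simp
  · simp

theorem mem_identityComponent_of_path {c : SignType}
    {γ : ℝ → Matrix (Fin 4) (Fin 4) ℝ × (Fin 4 → ℝ)} (hγ : Continuous γ) (h0 : γ 0 = (1, 0))
    (hm : ∀ t, γ t ∈ isometries c) (t : ℝ) : γ t ∈ identityComponent c := by
  have hpre : IsPreconnected (range γ) := isPreconnected_range hγ
  exact hpre.subset_connectedComponentIn ⟨0, h0⟩ (by rintro _ ⟨s, rfl⟩; exact hm s) ⟨t, rfl⟩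

/-- The path in the parameter starts at the identity. It is used with `(cos, sin)` for rotations and
with `(√(1 + t²), t)` for boosts. For `c = 0` the axis `0`, normal to the space form, must stay
fixed. -/
theorem planeMap_mem_identityComponent {c : SignType} {i j : Fin 4} (hij : i ≠ j)
    (hc : c = 0 → i ≠ 0 ∧ j ≠ 0) {α β : ℝ → ℝ} (hα : Continuous α) (hβ : Continuous β)
    (hα0 : α 0 = 1) (hβ0 : β 0 = 0)
    (h : ∀ t, α t ^ 2 + signature c i * signature c j * β t ^ 2 = 1) (t : ℝ) :
    ((planeMap c i j (α t) (β t), 0) : Matrix (Fin 4) (Fin 4) ℝ × (Fin 4 → ℝ)) ∈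
      identityComponent c := by
  refine mem_identityComponent_of_path
    (γ := fun t => ((planeMap c i j (α t) (β t), 0) : Matrix (Fin 4) (Fin 4) ℝ × (Fin 4 → ℝ)))
    ?_ ?_ ?_ t
  · refine Continuous.prodMk ?_ continuous_const
    refine continuous_matrix fun k l => ?_
    simp only [planeMap, of_apply]
    split_ifs <;> fun_prop
  · refine Prod.ext ?_ rfl
    ext k l
    simp only [planeMap, of_apply, hα0, hβ0, one_apply, mul_zero]
    split_ifs <;> simp_all
  · intro t
    refine mem_isometries_of_preservesProd (planeMap_preservesProd hij (h t)) (fun h0 => ⟨?_, rfl⟩)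
      (fun _ => rfl)
    obtain ⟨hi, hj⟩ := hc h0
    funext k
    rw [planeMap_mulVec hij]
    by_cases hki : k = i
    · simp [hki, hi, hj]
    · by_cases hkj : k = j <;> simp [hki, hkj, hi, hj]

/-- `y` is the image of `x` under a linear isometry in the identity component that fixes the
coordinate vectors with index in `F`. -/
def Reachable (c : SignType) (F : Set (Fin 4)) (x y : Fin 4 → ℝ) : Prop :=
  ∃ S : Matrix (Fin 4) (Fin 4) ℝ, (S, 0) ∈ identityComponent c ∧
    (∀ k ∈ F, S *ᵥ Pi.single k 1 = Pi.single k 1) ∧ S *ᵥ x = y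

theorem Reachable.trans {c : SignType} {F : Set (Fin 4)} {x y z : Fin 4 → ℝ}
    (h : Reachable c F x y) (h' : Reachable c F y z) : Reachable c F x z := by
  obtain ⟨S, hS, hSF, rfl⟩ := h
  obtain ⟨T, hT, hTF, rfl⟩ := h'
  refine ⟨T * S, ?_, fun k hk => ?_, ?_⟩
  · simpa [affComp] using affComp_mem_identityComponent hT hS
  · rw [← mulVec_mulVec, hSF k hk, hTF k hk]
  · rw [mulVec_mulVec]

theorem Reachable.scalarProd_eq {c : SignType} {F : Set (Fin 4)} {x y : Fin 4 → ℝ}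
    (h : Reachable c F x y) : scalarProd c y y = scalarProd c x x := by
  obtain ⟨S, hS, -, rfl⟩ := h
  exact (identityComponent_subset c hS).1.1 x x

theorem reachable_planeMap {c : SignType} {F : Set (Fin 4)} {i j : Fin 4} (hij : i ≠ j)
    (hi : i ∉ F) (hj : j ∉ F) {a b : ℝ}
    (h : ((planeMap c i j a b, 0) : Matrix (Fin 4) (Fin 4) ℝ × (Fin 4 → ℝ)) ∈
      identityComponent c) (x : Fin 4 → ℝ) : Reachable c F x (planeMap c i j a b *ᵥ x) := by
  refine ⟨_, h, fun k hk => ?_, rfl⟩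
  have hki : i ≠ k := fun e => hi (e ▸ hk)
  have hkj : j ≠ k := fun e => hj (e ▸ hk)
  funext l
  rw [planeMap_mulVec hij]
  by_cases hli : l = i
  · simp [hli, hki, hkj]
  · by_cases hlj : l = j <;> simp [hli, hlj, hki, hkj]

/-- A coordinate can be rotated away. -/
theorem exists_reachable_rotation {c : SignType} {F : Set (Fin 4)} {i j : Fin 4} (hij : i ≠ j)
    (hs : signature c i * signature c j = 1) (hc : c = 0 → i ≠ 0 ∧ j ≠ 0)
    (hi : i ∉ F) (hj : j ∉ F) (x : Fin 4 → ℝ) :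
    ∃ y, Reachable c F x y ∧ y j = 0 ∧ 0 ≤ y i ∧ ∀ k, k ≠ i → k ≠ j → y k = x k := by
  -- The polar form of the two coordinates; rotation by minus the argument moves them to `(‖w‖, 0)`.
  set w : ℂ := ⟨x i, x j⟩ with hw
  have hmem := planeMap_mem_identityComponent hij hc Real.continuous_cos Real.continuous_sin
    Real.cos_zero Real.sin_zero (fun t => by rw [hs, one_mul]; exact Real.cos_sq_add_sin_sq t)
    (-w.arg)
  refine ⟨_, reachable_planeMap hij hi hj hmem x, ?_, ?_, ?_⟩
  · rw [planeMap_mulVec hij]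
    simp only [hij.symm, if_true, if_false, Real.cos_neg, Real.sin_neg]
    have h1 : ‖w‖ * Real.cos w.arg = x i := Complex.norm_mul_cos_arg w
    have h2 : ‖w‖ * Real.sin w.arg = x j := Complex.norm_mul_sin_arg w
    rw [← h1, ← h2]; ring
  · rw [planeMap_mulVec hij]
    simp only [if_true, Real.cos_neg, Real.sin_neg, hs]
    have h1 : ‖w‖ * Real.cos w.arg = x i := Complex.norm_mul_cos_arg w
    have h2 : ‖w‖ * Real.sin w.arg = x j := Complex.norm_mul_sin_arg w
    rw [← h1, ← h2]
    have : Real.cos w.arg * (‖w‖ * Real.cos w.arg) -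
        1 * -Real.sin w.arg * (‖w‖ * Real.sin w.arg) = ‖w‖ := by
      linear_combination ‖w‖ * Real.cos_sq_add_sin_sq w.arg
    rw [this]
    exact norm_nonneg _
  · intro k hki hkj
    rw [planeMap_mulVec hij]
    simp [hki, hkj]

/-- A coordinate can be boosted away. -/
theorem exists_reachable_boost {c : SignType} {F : Set (Fin 4)} {i j : Fin 4} (hij : i ≠ j)
    (hs : signature c i * signature c j = -1) (hc : c = 0 → i ≠ 0 ∧ j ≠ 0)
    (hi : i ∉ F) (hj : j ∉ F) (x : Fin 4 → ℝ) (hx : |x j| < x i) :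
    ∃ y, Reachable c F x y ∧ y j = 0 ∧ 0 < y i ∧ ∀ k, k ≠ i → k ≠ j → y k = x k := by
  have hx0 : 0 < x i := (abs_nonneg _).trans_lt hx
  have hsq : x j ^ 2 < x i ^ 2 := sq_lt_sq.2 (by rwa [abs_of_pos hx0])
  set r := Real.sqrt (x i ^ 2 - x j ^ 2) with hr
  have hr0 : 0 < r := Real.sqrt_pos.2 (by linarith)
  have hr2 : r ^ 2 = x i ^ 2 - x j ^ 2 := Real.sq_sqrt (by linarith)
  -- The parameter `t` is a hyperbolic sine and `√(1 + t²)` the hyperbolic cosine. The value `-x j /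
  -- r`, with `r` the length of the pair, sends it to `(r, 0)`.
  have hmem := planeMap_mem_identityComponent hij hc (α := fun t => Real.sqrt (1 + t ^ 2))
    (β := fun t => t) (by fun_prop) continuous_id (by simp) rfl
    (fun t => by rw [hs, Real.sq_sqrt (by positivity)]; ring) (-x j / r)
  have hα : Real.sqrt (1 + (-x j / r) ^ 2) = x i / r := by
    rw [← Real.sqrt_sq (div_nonneg hx0.le hr0.le)]
    congr 1
    field_simp
    linarith
  rw [hα] at hmem
  refine ⟨_, reachable_planeMap hij hi hj hmem x, ?_, ?_, ?_⟩
  · rw [planeMap_mulVec hij]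
    simp only [hij.symm, if_true, if_false]
    ring
  · rw [planeMap_mulVec hij]
    simp only [if_true, hs]
    have : x i / r * x i - -1 * (-x j / r) * x j = r := by
      field_simp
      linarith
    rw [this]
    exact hr0
  · intro k hki hkj
    rw [planeMap_mulVec hij]
    simp [hki, hkj]

/-- Rotations among coordinates of equal sign leave at most one coordinate of each sign; a single
boost removes the positive one. For `c = -1` a rotation also fixes the sign of coordinate `0`. For
`c = 1` there is only one negative coordinate, whose sign no such map changes, so it has to be
given. -/
theorem exists_reachable_single_zero {c : SignType} (hc : c ≠ 0) {x : Fin 4 → ℝ}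
    (hx : scalarProd c x x = signature c 0) (hpos : c = 1 → 0 < x 0) :
    Reachable c ∅ x (Pi.single 0 1) := by
  cases c
  · exact absurd rfl hc
  · obtain ⟨y, hxy, y1, y0, yr⟩ := exists_reachable_rotation (c := -1) (F := ∅) (i := 0) (j := 1)
      (by decide) (by simp [signature]) (by simp) (by simp) (by simp) x
    obtain ⟨z, hyz, z3, z2, zr⟩ := exists_reachable_rotation (c := -1) (F := ∅) (i := 2) (j := 3)
      (by decide) (by simp [signature]) (by simp) (by simp) (by simp) y
    have z0 := zr 0 (by decide) (by decide)
    have z1 := zr 1 (by decide) (by decide)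
    have hxz := hxy.trans hyz
    have e := hxz.scalarProd_eq
    have e' := e.trans hx
    simp [scalarProd, Fin.sum_univ_four, signature, z3, z1, y1] at e'
    obtain ⟨w, hzw, w2, w0, wr⟩ := exists_reachable_boost (c := -1) (F := ∅) (i := 0) (j := 2)
      (by decide) (by simp [signature]) (by simp) (by simp) (by simp) z
      (by rw [abs_of_nonneg z2]; rw [z0] at e' ⊢; nlinarith)
    have w1 := wr 1 (by decide) (by decide)
    have w3 := wr 3 (by decide) (by decide)
    have hxw := hxz.trans hzw
    have e2 := hxw.scalarProd_eq.trans hx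
    simp [scalarProd, Fin.sum_univ_four, signature, w1, w2, w3, z1, z3, y1] at e2
    have : w = Pi.single 0 1 := by
      funext i
      fin_cases i
      · simp; nlinarith
      · simp [w1, z1, y1]
      · simp [w2]
      · simp [w3, z3]
    exact this ▸ hxw
  · obtain ⟨y, hxy, y3, y2, yr⟩ := exists_reachable_rotation (c := 1) (F := ∅) (i := 2) (j := 3)
      (by decide) (by simp [signature]) (by simp) (by simp) (by simp) x
    obtain ⟨z, hyz, z2, z1, zr⟩ := exists_reachable_rotation (c := 1) (F := ∅) (i := 1) (j := 2)
      (by decide) (by simp [signature]) (by simp) (by simp) (by simp) y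
    have z0 := (zr 0 (by decide) (by decide)).trans (yr 0 (by decide) (by decide))
    have z3 := zr 3 (by decide) (by decide)
    have hxz := hxy.trans hyz
    have e' := hxz.scalarProd_eq.trans hx
    have hpos' := hpos rfl
    rw [← z0] at hpos'
    simp [scalarProd, Fin.sum_univ_four, signature, z2, z3, y3] at e'
    obtain ⟨w, hzw, w1, w0, wr⟩ := exists_reachable_boost (c := 1) (F := ∅) (i := 0) (j := 1)
      (by decide) (by simp [signature]) (by simp) (by simp) (by simp) z
      (by rw [abs_of_nonneg z1]; nlinarith)
    have w2 := wr 2 (by decide) (by decide)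
    have w3 := wr 3 (by decide) (by decide)
    have hxw := hxz.trans hzw
    have e2 := hxw.scalarProd_eq.trans hx
    simp [scalarProd, Fin.sum_univ_four, signature, w1, w2, w3, z2, z3, y3] at e2
    have : w = Pi.single 0 1 := by
      funext i
      fin_cases i
      · simp; nlinarith
      · simp [w1]
      · simp [w2, z2]
      · simp [w3, z3, y3]
    exact this ▸ hxw

/-- The same reduction in the coordinates `1, 2, 3`. For `c = 1` they are all positive and rotations
suffice; otherwise coordinate `1` is the only negative one left, and its sign is part of the
hypotheses. -/
theorem exists_reachable_single_one {c : SignType} {x : Fin 4 → ℝ}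
    (hx : scalarProd c x x = signature c 1) (hx0 : x 0 = 0) (hpos : c ≠ 1 → 0 < x 1) :
    Reachable c {0} x (Pi.single 1 1) := by
  obtain ⟨y, hxy, y3, y2, yr⟩ := exists_reachable_rotation (c := c) (F := {0}) (i := 2) (j := 3)
    (by decide) (by cases c <;> simp [signature]) (by simp) (by simp) (by simp) x
  have y0 := (yr 0 (by decide) (by decide)).trans hx0
  have y1 := yr 1 (by decide) (by decide)
  have e := hxy.scalarProd_eq.trans hx
  by_cases hc : c = 1
  · subst hc
    obtain ⟨z, hyz, z2, z1, zr⟩ := exists_reachable_rotation (c := 1) (F := {0}) (i := 1) (j := 2)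
      (by decide) (by simp [signature]) (by simp) (by simp) (by simp) y
    have z0 := (zr 0 (by decide) (by decide)).trans y0
    have z3 := (zr 3 (by decide) (by decide)).trans y3
    have hxz := hxy.trans hyz
    have e' := hxz.scalarProd_eq.trans hx
    simp [scalarProd, Fin.sum_univ_four, signature, z2, z3, z0] at e'
    have : z = Pi.single 1 1 := by
      funext i
      fin_cases i
      · simp [z0]
      · simp; nlinarith
      · simp [z2]
      · simp [z3]
    exact this ▸ hxz
  · have hpos' := hpos hc
    rw [← y1] at hpos'
    have hs1 : signature c 1 = -1 := by
      cases c
      · simp [signature]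
      · simp [signature]
      · exact absurd rfl hc
    have hs2 : signature c 2 = 1 := by cases c <;> simp [signature]
    simp [scalarProd, Fin.sum_univ_four, y3, y0, hs1, hs2] at e
    obtain ⟨z, hyz, z2, z1, zr⟩ := exists_reachable_boost (c := c) (F := {0}) (i := 1) (j := 2)
      (by decide) (by simp [hs1, hs2]) (by simp) (by simp) (by simp) y
      (by rw [abs_of_nonneg y2]; nlinarith)
    have z0 := (zr 0 (by decide) (by decide)).trans y0
    have z3 := (zr 3 (by decide) (by decide)).trans y3
    have hxz := hxy.trans hyz
    have e' := hxz.scalarProd_eq.trans hx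
    simp [scalarProd, Fin.sum_univ_four, z2, z3, z0, hs1] at e'
    have : z = Pi.single 1 1 := by
      funext i
      fin_cases i
      · simp [z0]
      · simp; nlinarith
      · simp [z2]
      · simp [z3]
    exact this ▸ hxz

theorem exists_reachable_single_two {c : SignType} {x : Fin 4 → ℝ}
    (hx : scalarProd c x x = signature c 2) (hx0 : x 0 = 0) (hx1 : x 1 = 0) :
    Reachable c {0, 1} x (Pi.single 2 1) := by
  obtain ⟨y, hxy, y3, y2, yr⟩ := exists_reachable_rotation (c := c) (F := {0, 1}) (i := 2) (j := 3)
    (by decide) (by cases c <;> simp [signature]) (by simp) (by simp) (by simp) x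
  have y0 := (yr 0 (by decide) (by decide)).trans hx0
  have y1 := (yr 1 (by decide) (by decide)).trans hx1
  have e := hxy.scalarProd_eq.trans hx
  have hs2 : signature c 2 = 1 := by cases c <;> simp [signature]
  simp [scalarProd, Fin.sum_univ_four, y3, y0, y1, hs2] at e
  have : y = Pi.single 2 1 := by
    funext i
    fin_cases i
    · simp [y0]
    · simp [y1]
    · simp; nlinarith
    · simp [y3]
  exact this ▸ hxy

theorem affComp_mem_properIsometries {c : SignType}
    {S T : Matrix (Fin 4) (Fin 4) ℝ × (Fin 4 → ℝ)} (hS : S ∈ properIsometries c)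
    (hT : T ∈ properIsometries c) : affComp S T ∈ properIsometries c := by
  obtain ⟨s1, s2, s3, s4⟩ := hS
  obtain ⟨t1, t2, t3, t4⟩ := hT
  refine ⟨s1.mul t1, ?_, fun hc => ⟨?_, ?_⟩, fun hc => ?_⟩
  · simp only [affComp, det_mul]; positivity
  · simp only [affComp, ← mulVec_mulVec, (t3 hc).1, (s3 hc).1]
  · subst hc
    have := s1 T.2 (Pi.single 0 1)
    rw [(s3 rfl).1, scalarProd_zero_single, scalarProd_zero_single, (t3 rfl).2] at this
    simp only [affComp, Pi.add_apply, (s3 rfl).2]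
    linarith
  · simp only [affComp, s4 hc, t4 hc, mulVec_zero, add_zero]

theorem affInv_mem_properIsometries {c : SignType}
    {T : Matrix (Fin 4) (Fin 4) ℝ × (Fin 4 → ℝ)} (hT : T ∈ properIsometries c) :
    affInv T ∈ properIsometries c := by
  have hTi := properIsometries_subset c hT
  have hd := isUnit_det_of_mem_isometries hTi
  obtain ⟨t1, t2, t3, t4⟩ := hT
  have hinv : affInv T ∈ isometries c := affInv_mem_isometries hTi
  refine ⟨hinv.1, ?_, fun hc => ⟨?_, ?_⟩, fun hc => ?_⟩
  · simp only [affInv, det_nonsing_inv, Ring.inverse_eq_inv']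
    positivity
  · conv_lhs => rw [← (t3 hc).1]
    simp only [affInv, mulVec_mulVec, nonsing_inv_mul _ hd, one_mulVec]
  · subst hc
    exact (isometries_zero_normal hinv).1
  · simp only [affInv, t4 hc, mulVec_zero, neg_zero]

/-- The last column is orthogonal to the first three coordinate vectors, hence plus or minus the
last one; the determinant excludes the minus sign. -/
theorem eq_one_of_fixes {c : SignType} {A : Matrix (Fin 4) (Fin 4) ℝ} (hA : PreservesProd c A)
    (hd : 0 < A.det) (h0 : A *ᵥ Pi.single 0 1 = Pi.single 0 1)
    (h1 : A *ᵥ Pi.single 1 1 = Pi.single 1 1) (h2 : A *ᵥ Pi.single 2 1 = Pi.single 2 1) :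
    A = 1 := by
  have c0 : ∀ i, A i 0 = (Pi.single 0 1 : Fin 4 → ℝ) i := fun i => by rw [← h0]; simp
  have c1 : ∀ i, A i 1 = (Pi.single 1 1 : Fin 4 → ℝ) i := fun i => by rw [← h1]; simp
  have c2 : ∀ i, A i 2 = (Pi.single 2 1 : Fin 4 → ℝ) i := fun i => by rw [← h2]; simp
  have z0 : A 0 3 = 0 := by
    have := hA.scalarProd_col 0 3
    simpa [scalarProd, Fin.sum_univ_four, c0, signature_ne_zero] using this
  have z1 : A 1 3 = 0 := by
    have := hA.scalarProd_col 1 3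
    simpa [scalarProd, Fin.sum_univ_four, c1, signature_ne_zero] using this
  have z2 : A 2 3 = 0 := by
    have := hA.scalarProd_col 2 3
    simpa [scalarProd, Fin.sum_univ_four, c2, signature_ne_zero] using this
  have z3 := hA.scalarProd_col 3 3
  have hs3 : signature c 3 = 1 := by cases c <;> simp [signature]
  simp [scalarProd, Fin.sum_univ_four, z0, z1, z2, hs3] at z3
  have hA' : A = diagonal ![1, 1, 1, A 3 3] := by
    ext i j
    fin_cases j
    · fin_cases i <;> simp [c0]
    · fin_cases i <;> simp [c1]
    · fin_cases i <;> simp [c2]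
    · fin_cases i <;> simp [z0, z1, z2]
  have hdet : 0 < A 3 3 := by
    rw [hA', det_diagonal, Fin.prod_univ_four] at hd
    simpa using hd
  have h33 : A 3 3 = 1 := by nlinarith
  rw [hA', h33, ← diagonal_one]
  congr 1
  funext i
  fin_cases i <;> rfl

/-- For the inclusion that remains, left multiplication by elements of the identity component makes
the linear part fix the coordinate vectors `0`, `1`, `2` in turn, after which it is the identity.
The translation part `b` is joined to zero by `t • b`. -/
theorem mem_identityComponent_iff {c : SignType} {T : Matrix (Fin 4) (Fin 4) ℝ × (Fin 4 → ℝ)} :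
    T ∈ identityComponent c ↔ T ∈ properIsometries c ∧ 0 < negMinor c T.1 := by
  refine ⟨fun h => identityComponent_subset c h, ?_⟩
  have hleft : ∀ S ∈ identityComponent c, ∀ T : Matrix (Fin 4) (Fin 4) ℝ × (Fin 4 → ℝ),
      affComp S T ∈ identityComponent c → T ∈ identityComponent c := by
    intro S hS T h
    have h1 := affComp_mem_identityComponent (affInv_mem_identityComponent hS) h
    have hSi := connectedComponentIn_subset _ _ hS
    have h2 : affComp (affInv S) (affComp S T) = T := by
      have := affInv_affComp hSi
      simp only [affComp, Prod.mk.injEq] at this ⊢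
      obtain ⟨e1, e2⟩ := this
      refine Prod.ext ?_ ?_
      · simp only [← mul_assoc, e1, one_mul]
      · simp only [mulVec_add, mulVec_mulVec, e1, one_mulVec, add_assoc, e2, add_zero]
    rwa [h2] at h1
  -- As `S` runs through the identity component, the minor of the product with a fixed `T` never
  -- vanishes, so its sign is the one at `S = 1`.
  have hpos : ∀ S ∈ identityComponent c, ∀ T : Matrix (Fin 4) (Fin 4) ℝ × (Fin 4 → ℝ),
      T ∈ properIsometries c ∧ 0 < negMinor c T.1 →
      affComp S T ∈ properIsometries c ∧ 0 < negMinor c (affComp S T).1 := by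
    intro S hS T hT
    refine ⟨affComp_mem_properIsometries (identityComponent_subset c hS).1 hT.1, ?_⟩
    exact pos_of_mem_identityComponent (φ := fun S => negMinor c (S.1 * T.1))
      ((continuous_negMinor c).comp (by fun_prop))
      (fun R hR => PreservesProd.negMinor_ne_zero (PreservesProd.mul hR.1 hT.1.1))
      (by simpa using hT.2) hS
  have hstep : ∀ (S A : Matrix (Fin 4) (Fin 4) ℝ), (S, 0) ∈ identityComponent c →
      ((A, 0) ∈ properIsometries c ∧ 0 < negMinor c A) →
      ((S * A, 0) ∈ properIsometries c ∧ 0 < negMinor c (S * A)) ∧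
        ((S * A, 0) ∈ identityComponent c → (A, 0) ∈ identityComponent c) := by
    intro S A hS hA
    have h1 := hpos _ hS (A, 0) hA
    have h2 := hleft _ hS (A, 0)
    simp only [affComp, mulVec_zero, add_zero] at h1 h2
    exact ⟨h1, h2⟩
  have hlin : ∀ A : Matrix (Fin 4) (Fin 4) ℝ, ((A, 0) ∈ properIsometries c ∧ 0 < negMinor c A) →
      (A, 0) ∈ identityComponent c := by
    intro A hA
    obtain ⟨S, hS, hS0⟩ : ∃ S, (S, 0) ∈ identityComponent c ∧
        S *ᵥ (A *ᵥ Pi.single 0 1) = Pi.single 0 1 := by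
      by_cases hc : c = 0
      · exact ⟨1, mem_connectedComponentIn (one_mem_isometries c), by
          rw [(hA.1.2.2.1 hc).1, one_mulVec]⟩
      · obtain ⟨S, hS, -, h⟩ := exists_reachable_single_zero hc (x := A *ᵥ Pi.single 0 1)
          (by rw [hA.1.1, scalarProd_single_left]; simp)
          (by rintro rfl; simpa [negMinor] using hA.2)
        exact ⟨S, hS, h⟩
    obtain ⟨hB, hBA⟩ := hstep S A hS hA
    refine hBA ?_
    rw [mulVec_mulVec] at hS0
    clear hBA hA hS
    generalize S * A = B at hB hS0
    have b00 : ∀ i, B i 0 = (Pi.single 0 1 : Fin 4 → ℝ) i := fun i => by rw [← hS0]; simp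
    have b01 : B 0 1 = 0 := by
      have := hB.1.1.scalarProd_col 0 1
      simpa [scalarProd, Fin.sum_univ_four, b00, signature_ne_zero] using this
    -- With vector `0` fixed, the minor for `c ≠ 1` reduces to the entry `B 1 1`, which supplies the
    -- sign that is needed.
    obtain ⟨S₁, hS₁, hF₁, h₁⟩ := exists_reachable_single_one (c := c) (x := B *ᵥ Pi.single 1 1)
      (by rw [hB.1.1, scalarProd_single_left]; simp) (by simpa using b01) (by
        intro hc
        have := hB.2
        cases c
        · simpa [negMinor, b00, b01] using this
        · simpa [negMinor, b00, b01] using this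
        · exact absurd rfl hc)
    obtain ⟨hC, hCB⟩ := hstep S₁ B hS₁ hB
    refine hCB ?_
    rw [mulVec_mulVec] at h₁
    have hC0 : (S₁ * B) *ᵥ Pi.single 0 1 = Pi.single 0 1 := by
      rw [← mulVec_mulVec, hS0, hF₁ 0 (by simp)]
    clear hCB hB hS₁
    generalize S₁ * B = C at hC h₁ hC0
    have c0 : ∀ i, C i 0 = (Pi.single 0 1 : Fin 4 → ℝ) i := fun i => by rw [← hC0]; simp
    have c1 : ∀ i, C i 1 = (Pi.single 1 1 : Fin 4 → ℝ) i := fun i => by rw [← h₁]; simp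
    have c02 : C 0 2 = 0 := by
      have := hC.1.1.scalarProd_col 0 2
      simpa [scalarProd, Fin.sum_univ_four, c0, signature_ne_zero] using this
    have c12 : C 1 2 = 0 := by
      have := hC.1.1.scalarProd_col 1 2
      simpa [scalarProd, Fin.sum_univ_four, c1, signature_ne_zero] using this
    obtain ⟨S₂, hS₂, hF₂, h₂⟩ := exists_reachable_single_two (c := c) (x := C *ᵥ Pi.single 2 1)
      (by rw [hC.1.1, scalarProd_single_left]; simp) (by simpa using c02) (by simpa using c12)
    obtain ⟨hD, hDC⟩ := hstep S₂ C hS₂ hC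
    refine hDC ?_
    have hD1 : S₂ * C = 1 := by
      refine eq_one_of_fixes hD.1.1 hD.1.2.1 ?_ ?_ ?_
      · rw [← mulVec_mulVec, hC0, hF₂ 0 (by simp)]
      · rw [← mulVec_mulVec, h₁, hF₂ 1 (by simp)]
      · rw [← mulVec_mulVec, h₂]
    rw [hD1]
    exact mem_connectedComponentIn (one_mem_isometries c)
  rintro ⟨hT, hpT⟩
  obtain ⟨A, b⟩ := T
  have htr : ((1, b) : Matrix (Fin 4) (Fin 4) ℝ × (Fin 4 → ℝ)) ∈ identityComponent c := by
    have := mem_identityComponent_of_path (c := c)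
      (γ := fun t => ((1, t • b) : Matrix (Fin 4) (Fin 4) ℝ × (Fin 4 → ℝ))) (by fun_prop) (by simp)
      (fun t => mem_isometries_of_preservesProd (fun p q => by simp)
        (fun hc => ⟨one_mulVec _, by
          have : b 0 = 0 := (hT.2.2.1 hc).2
          simp [this]⟩) (fun hc => by
          have : b = 0 := hT.2.2.2 hc
          simp [this])) 1
    simpa using this
  have hA0 : ((A, 0) : Matrix (Fin 4) (Fin 4) ℝ × (Fin 4 → ℝ)) ∈ identityComponent c :=
    hlin A ⟨⟨hT.1, hT.2.1, fun hc => ⟨(hT.2.2.1 hc).1, rfl⟩, fun _ => rfl⟩, hpT⟩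
  have := affComp_mem_identityComponent htr hA0
  simpa [affComp] using this

/-- An isometry that preserves the orientations but lies outside the identity component. -/
def timeFlip : SignType → Matrix (Fin 4) (Fin 4) ℝ
  | 1 => diagonal ![-1, -1, 1, 1]
  | 0 => diagonal ![1, -1, -1, 1]
  | -1 => diagonal ![1, -1, -1, 1]

theorem timeFlip_mem_properIsometries (c : SignType) :
    ((timeFlip c, 0) : Matrix (Fin 4) (Fin 4) ℝ × (Fin 4 → ℝ)) ∈ properIsometries c := by
  refine ⟨?_, ?_, fun hc => ⟨?_, rfl⟩, fun _ => rfl⟩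
  · rw [preservesProd_iff]
    cases c
    all_goals
      simp only [timeFlip, diagonal_transpose, diagonal_mul_diagonal]
      congr 1
      funext i
      fin_cases i <;> simp [signature]
  · cases c <;> simp [timeFlip, det_diagonal, Fin.prod_univ_four]
  · subst hc
    funext i
    fin_cases i <;> simp [timeFlip, mulVec_diagonal]

theorem negMinor_mul_timeFlip (c : SignType) (A : Matrix (Fin 4) (Fin 4) ℝ) :
    negMinor c (A * timeFlip c) = -negMinor c A := by
  cases c <;> simp [negMinor, timeFlip, mul_diagonal] <;> ring

/-- Composition with the flip changes the sign of the minor, so the identity component has index at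
most two among the proper isometries. -/
theorem mem_identityComponent_or {c : SignType} {T : Matrix (Fin 4) (Fin 4) ℝ × (Fin 4 → ℝ)}
    (hT : T ∈ properIsometries c) :
    T ∈ identityComponent c ∨ affComp T (timeFlip c, 0) ∈ identityComponent c := by
  rcases lt_or_gt_of_ne (PreservesProd.negMinor_ne_zero hT.1) with h | h
  · right
    rw [mem_identityComponent_iff]
    refine ⟨affComp_mem_properIsometries hT (timeFlip_mem_properIsometries c), ?_⟩
    simp only [affComp, negMinor_mul_timeFlip]
    linarith
  · exact Or.inl (mem_identityComponent_iff.2 ⟨hT, h⟩)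

theorem timeFlip_not_mem_identityComponent (c : SignType) :
    ((timeFlip c, 0) : Matrix (Fin 4) (Fin 4) ℝ × (Fin 4 → ℝ)) ∉ identityComponent c := by
  rw [mem_identityComponent_iff]
  rintro ⟨-, h⟩
  have := negMinor_mul_timeFlip c 1
  simp only [one_mul, negMinor_one] at this
  simp only at h
  linarith

/-! ### Calculus of null derivatives -/

section NullDerivatives

variable {E : Type*} [NormedAddCommGroup E] [NormedSpace ℝ E] {p : ℝ × ℝ}

theorem dU_congr {G G' : ℝ × ℝ → E} (h : G =ᶠ[𝓝 p] G') : dU G p = dU G' p := by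
  simp only [dU, h.fderiv_eq]

theorem dV_congr {G G' : ℝ × ℝ → E} (h : G =ᶠ[𝓝 p] G') : dV G p = dV G' p := by
  simp only [dV, h.fderiv_eq]

theorem dU_const (x : E) : dU (fun _ => x) p = 0 := by simp [dU]

theorem dV_const (x : E) : dV (fun _ => x) p = 0 := by simp [dV]

theorem dU_add {G G' : ℝ × ℝ → E} (h : DifferentiableAt ℝ G p) (h' : DifferentiableAt ℝ G' p) :
    dU (fun q => G q + G' q) p = dU G p + dU G' p := by
  simp [dU, fderiv_fun_add h h']

theorem dV_add {G G' : ℝ × ℝ → E} (h : DifferentiableAt ℝ G p) (h' : DifferentiableAt ℝ G' p) :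
    dV (fun q => G q + G' q) p = dV G p + dV G' p := by
  simp [dV, fderiv_fun_add h h']

theorem dU_sub {G G' : ℝ × ℝ → E} (h : DifferentiableAt ℝ G p) (h' : DifferentiableAt ℝ G' p) :
    dU (fun q => G q - G' q) p = dU G p - dU G' p := by
  simp [dU, fderiv_fun_sub h h']

theorem dV_sub {G G' : ℝ × ℝ → E} (h : DifferentiableAt ℝ G p) (h' : DifferentiableAt ℝ G' p) :
    dV (fun q => G q - G' q) p = dV G p - dV G' p := by
  simp [dV, fderiv_fun_sub h h']

theorem dU_neg (G : ℝ × ℝ → E) : dU (fun q => -G q) p = -dU G p := by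
  simp [dU, fderiv_fun_neg]

theorem dV_neg (G : ℝ × ℝ → E) : dV (fun q => -G q) p = -dV G p := by
  simp [dV, fderiv_fun_neg]

theorem dU_smul {r : ℝ × ℝ → ℝ} {G : ℝ × ℝ → E} (h : DifferentiableAt ℝ r p)
    (h' : DifferentiableAt ℝ G p) :
    dU (fun q => r q • G q) p = dU r p • G p + r p • dU G p := by
  simp [dU, fderiv_fun_smul h h', add_comm]

theorem dV_smul {r : ℝ × ℝ → ℝ} {G : ℝ × ℝ → E} (h : DifferentiableAt ℝ r p)
    (h' : DifferentiableAt ℝ G p) :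
    dV (fun q => r q • G q) p = dV r p • G p + r p • dV G p := by
  simp [dV, fderiv_fun_smul h h', add_comm]

theorem dU_mul {r s : ℝ × ℝ → ℝ} (h : DifferentiableAt ℝ r p) (h' : DifferentiableAt ℝ s p) :
    dU (fun q => r q * s q) p = dU r p * s p + r p * dU s p := by
  simpa using dU_smul h h'

theorem dV_mul {r s : ℝ × ℝ → ℝ} (h : DifferentiableAt ℝ r p) (h' : DifferentiableAt ℝ s p) :
    dV (fun q => r q * s q) p = dV r p * s p + r p * dV s p := by
  simpa using dV_smul h h'

theorem dU_inv {r : ℝ × ℝ → ℝ} (h : DifferentiableAt ℝ r p) (h0 : r p ≠ 0) :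
    dU (fun q => (r q)⁻¹) p = -(dU r p / r p ^ 2) := by
  have := ((hasDerivAt_inv h0).comp_hasFDerivAt p h.hasFDerivAt).fderiv
  have e : (fun q => (r q)⁻¹) = Inv.inv ∘ r := rfl
  rw [dU, e, this]
  simp [dU]
  ring

theorem dV_inv {r : ℝ × ℝ → ℝ} (h : DifferentiableAt ℝ r p) (h0 : r p ≠ 0) :
    dV (fun q => (r q)⁻¹) p = -(dV r p / r p ^ 2) := by
  have := ((hasDerivAt_inv h0).comp_hasFDerivAt p h.hasFDerivAt).fderiv
  have e : (fun q => (r q)⁻¹) = Inv.inv ∘ r := rfl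
  rw [dV, e, this]
  simp [dV]
  ring

theorem dU_div {r s : ℝ × ℝ → ℝ} (h : DifferentiableAt ℝ r p) (h' : DifferentiableAt ℝ s p)
    (h0 : s p ≠ 0) : dU (fun q => r q / s q) p = (dU r p * s p - r p * dU s p) / s p ^ 2 := by
  simp only [div_eq_mul_inv]
  rw [dU_mul h (h'.fun_inv h0), dU_inv h' h0]
  field_simp
  ring

theorem dV_div {r s : ℝ × ℝ → ℝ} (h : DifferentiableAt ℝ r p) (h' : DifferentiableAt ℝ s p)
    (h0 : s p ≠ 0) : dV (fun q => r q / s q) p = (dV r p * s p - r p * dV s p) / s p ^ 2 := by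
  simp only [div_eq_mul_inv]
  rw [dV_mul h (h'.fun_inv h0), dV_inv h' h0]
  field_simp
  ring

theorem dU_clm {W : Type*} [NormedAddCommGroup W] [NormedSpace ℝ W] (L : E →L[ℝ] W)
    {G : ℝ × ℝ → E} (h : DifferentiableAt ℝ G p) : dU (fun q => L (G q)) p = L (dU G p) := by
  have e : (fun q => L (G q)) = L ∘ G := rfl
  rw [dU, e, (L.hasFDerivAt.comp p h.hasFDerivAt).fderiv]
  rfl

theorem dV_clm {W : Type*} [NormedAddCommGroup W] [NormedSpace ℝ W] (L : E →L[ℝ] W)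
    {G : ℝ × ℝ → E} (h : DifferentiableAt ℝ G p) : dV (fun q => L (G q)) p = L (dV G p) := by
  have e : (fun q => L (G q)) = L ∘ G := rfl
  rw [dV, e, (L.hasFDerivAt.comp p h.hasFDerivAt).fderiv]
  rfl

theorem dU_pi {ι : Type*} [Fintype ι] {W : ι → Type*} [∀ i, NormedAddCommGroup (W i)]
    [∀ i, NormedSpace ℝ (W i)] {G : ℝ × ℝ → ∀ i, W i}
    (h : DifferentiableAt ℝ G p) (i : ι) : dU G p i = dU (fun q => G q i) p := by
  exact (dU_clm (ContinuousLinearMap.proj (R := ℝ) i) h).symm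

theorem dV_pi {ι : Type*} [Fintype ι] {W : ι → Type*} [∀ i, NormedAddCommGroup (W i)]
    [∀ i, NormedSpace ℝ (W i)] {G : ℝ × ℝ → ∀ i, W i}
    (h : DifferentiableAt ℝ G p) (i : ι) : dV G p i = dV (fun q => G q i) p := by
  exact (dV_clm (ContinuousLinearMap.proj (R := ℝ) i) h).symm

theorem contDiffAt_dU {G : ℝ × ℝ → E} (h : ContDiffAt ℝ ∞ G p) : ContDiffAt ℝ ∞ (dU G) p :=
  (h.fderiv_right (m := ∞) (by simp)).clm_apply contDiffAt_const

theorem contDiffAt_dV {G : ℝ × ℝ → E} (h : ContDiffAt ℝ ∞ G p) : ContDiffAt ℝ ∞ (dV G) p :=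
  (h.fderiv_right (m := ∞) (by simp)).clm_apply contDiffAt_const

theorem ContDiffAt.diff {G : ℝ × ℝ → E} (h : ContDiffAt ℝ ∞ G p) : DifferentiableAt ℝ G p :=
  h.differentiableAt (by simp)

/-- Mixed partial derivatives commute. -/
theorem dV_dU_comm {G : ℝ × ℝ → E} (h : ContDiffAt ℝ ∞ G p) : dV (dU G) p = dU (dV G) p := by
  have h2 := (h.fderiv_right (m := ∞) (by simp)).differentiableAt (by simp)
  have hs : IsSymmSndFDerivAt ℝ G p := h.isSymmSndFDerivAt (by
    simp only [minSmoothness_of_isRCLikeNormedField]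
    exact WithTop.coe_le_coe.2 (le_top : (2 : ℕ∞) ≤ ⊤))
  have e1 : dV (dU G) p = fderiv ℝ (fderiv ℝ G) p (0, 1) (1, 0) :=
    dV_clm (ContinuousLinearMap.apply ℝ E ((1, 0) : ℝ × ℝ)) h2
  have e2 : dU (dV G) p = fderiv ℝ (fderiv ℝ G) p (1, 0) (0, 1) :=
    dU_clm (ContinuousLinearMap.apply ℝ E ((0, 1) : ℝ × ℝ)) h2
  rw [e1, e2]
  exact hs.eq _ _

end NullDerivatives

/-! ### Systems of linear total differential equations -/

section Systems

variable {W : Type*} [NormedAddCommGroup W] [NormedSpace ℝ W] {n : ℕ}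

/-- The action of a square matrix on tuples of vectors. -/
noncomputable def tupleAction (n : ℕ) (W : Type*) [NormedAddCommGroup W] [NormedSpace ℝ W] :
    (Fin n → Fin n → ℝ) →L[ℝ] ((Fin n → W) →L[ℝ] (Fin n → W)) :=
  LinearMap.toContinuousLinearMap
    { toFun := fun A => ContinuousLinearMap.pi fun i =>
        ∑ k, A i k • ContinuousLinearMap.proj (R := ℝ) (φ := fun _ : Fin n => W) k
      map_add' := fun A B => by
        ext x i
        simp [add_smul, Finset.sum_add_distrib]
      map_smul' := fun r A => by
        ext x i
        simp [mul_smul, Finset.smul_sum] }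

theorem tupleAction_apply (A : Fin n → Fin n → ℝ) (x : Fin n → W) (i : Fin n) :
    tupleAction n W A x i = ∑ k, A i k • x k := by
  simp [tupleAction]

theorem exists_solution_system [CompleteSpace W] {A B : ℝ × ℝ → Fin n → Fin n → ℝ} {p : ℝ × ℝ}
    (hA : ∀ᶠ q in 𝓝 p, ContDiffAt ℝ ∞ A q) (hB : ∀ᶠ q in 𝓝 p, ContDiffAt ℝ ∞ B q)
    (hflat : ∀ᶠ q in 𝓝 p, ∀ i j, dV (fun q => A q i j) q + ∑ k, A q i k * B q k j =
      dU (fun q => B q i j) q + ∑ k, B q i k * A q k j) (x₀ : Fin n → W) :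
    ∃ x : Fin n → ℝ × ℝ → W, (∀ i, x i p = x₀ i) ∧ ∀ᶠ q in 𝓝 p, ∀ i, ContDiffAt ℝ ∞ (x i) q ∧
      dU (x i) q = ∑ k, A q i k • x k q ∧ dV (x i) q = ∑ k, B q i k • x k q := by
  obtain ⟨z, hz0, hz⟩ := exists_solution_linear_system
    (A := fun q => tupleAction n W (A q)) (B := fun q => tupleAction n W (B q)) (p := p)
    (by filter_upwards [hA] with q hq using (tupleAction n W).contDiff.contDiffAt.comp q hq)
    (by filter_upwards [hB] with q hq using (tupleAction n W).contDiff.contDiffAt.comp q hq) (by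
      filter_upwards [hA, hB, hflat] with q hAq hBq hq x
      rw [dV_clm _ hAq.diff, dU_clm _ hBq.diff]
      ext i
      simp only [Pi.add_apply, tupleAction_apply, Finset.smul_sum, smul_smul]
      rw [Finset.sum_comm, Finset.sum_comm (γ := Fin n) (f := fun k l => (B q i k * A q k l) • x l)]
      simp only [← Finset.sum_smul, ← Finset.sum_add_distrib, ← add_smul]
      refine Finset.sum_congr rfl fun j _ => ?_
      congr 1
      have hAi : DifferentiableAt ℝ (fun q => A q i) q := differentiableAt_pi.1 hAq.diff i
      have hBi : DifferentiableAt ℝ (fun q => B q i) q := differentiableAt_pi.1 hBq.diff i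
      rw [dV_pi hAq.diff, dU_pi hBq.diff, dV_pi hAi, dU_pi hBi]
      exact hq i j) x₀
  refine ⟨fun i q => z q i, fun i => congrFun hz0 i, ?_⟩
  filter_upwards [hz] with q hq i
  refine ⟨contDiffAt_pi.1 hq.1 i, ?_, ?_⟩
  · rw [← dU_pi hq.1.diff, hq.2.1, tupleAction_apply]
  · rw [← dV_pi hq.1.diff, hq.2.2, tupleAction_apply]

theorem eventually_eq_zero_of_system {A B : ℝ × ℝ → Fin n → Fin n → ℝ} {p : ℝ × ℝ}
    (hA : ContinuousAt A p) (hB : ContinuousAt B p) {x : Fin n → ℝ × ℝ → W}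
    (hx : ∀ᶠ q in 𝓝 p, ∀ i, DifferentiableAt ℝ (x i) q ∧
      dU (x i) q = ∑ k, A q i k • x k q ∧ dV (x i) q = ∑ k, B q i k • x k q)
    (h0 : ∀ i, x i p = 0) : ∀ᶠ q in 𝓝 p, ∀ i, x i q = 0 := by
  have bA : ∀ᶠ q in 𝓝 p, ‖tupleAction n W (A q)‖ < ‖tupleAction n W (A p)‖ + 1 :=
    (((tupleAction n W).continuous.continuousAt.comp hA).norm).eventually_lt continuousAt_const
      (lt_add_one _)
  have bB : ∀ᶠ q in 𝓝 p, ‖tupleAction n W (B q)‖ < ‖tupleAction n W (B p)‖ + 1 :=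
    (((tupleAction n W).continuous.continuousAt.comp hB).norm).eventually_lt continuousAt_const
      (lt_add_one _)
  have key := eventually_eq_zero_of_norm_partial_le (z := fun q i => x i q) (p := p)
    (C := max (‖tupleAction n W (A p)‖ + 1) (‖tupleAction n W (B p)‖ + 1)) (by
      filter_upwards [hx, bA, bB] with q hq hAq hBq
      have hd : DifferentiableAt ℝ (fun q i => x i q) q := differentiableAt_pi.2 fun i => (hq i).1
      have eU : dU (fun q i => x i q) q = tupleAction n W (A q) (fun i => x i q) := by
        ext i
        rw [dU_pi hd, tupleAction_apply, (hq i).2.1]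
      have eV : dV (fun q i => x i q) q = tupleAction n W (B q) (fun i => x i q) := by
        ext i
        rw [dV_pi hd, tupleAction_apply, (hq i).2.2]
      refine ⟨hd, ?_, ?_⟩
      · rw [eU]
        exact ((tupleAction n W (A q)).le_opNorm _).trans (mul_le_mul_of_nonneg_right
          (hAq.le.trans (le_max_left _ _)) (norm_nonneg _))
      · rw [eV]
        exact ((tupleAction n W (B q)).le_opNorm _).trans (mul_le_mul_of_nonneg_right
          (hBq.le.trans (le_max_right _ _)) (norm_nonneg _)))
    (funext h0)
  filter_upwards [key] with q hq i
  exact congrFun hq i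

end Systems

/-! ### Adapted frames of timelike immersions in null coordinates -/

/-- The first order conditions at a point of the plane for a conformal timelike immersion `F` with
unit normal `N`, where `E = ⟨F_u, F_v⟩`, `H` is the mean curvature, and `Q`, `R` are the
coefficients of the Hopf differentials. -/
structure FrameAt (c : SignType) (E H Q R : ℝ) (F N : ℝ × ℝ → Fin 4 → ℝ) (p : ℝ × ℝ) : Prop where
  smooth_F : ContDiffAt ℝ ∞ F p
  smooth_N : ContDiffAt ℝ ∞ N p
  mem : F p ∈ spaceForm c
  uu : scalarProd c (dU F p) (dU F p) = 0
  vv : scalarProd c (dV F p) (dV F p) = 0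
  uv : scalarProd c (dU F p) (dV F p) = E
  pos : 0 < E
  NN : scalarProd c (N p) (N p) = 1
  Nn : scalarProd c (N p) (ambientNormal c (F p)) = 0
  uN : scalarProd c (dU F p) (N p) = 0
  vN : scalarProd c (dV F p) (N p) = 0
  det : 0 < (Matrix.of ![ambientNormal c (F p), dU F p, dV F p, N p]).det
  uNu : scalarProd c (dU F p) (dU N p) = -Q
  uNv : scalarProd c (dU F p) (dV N p) = -(H * E)
  vNu : scalarProd c (dV F p) (dU N p) = -(H * E)
  vNv : scalarProd c (dV F p) (dV N p) = -R

/-- The scalar square of the ambient normal. -/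
def normalSq : SignType → ℝ
  | 1 => 1
  | 0 => -1
  | -1 => -1

/-- For `c = 0` the ambient normal has square `-1`, but it enters the structure equations with the
factor `c` only. Identities like this one treat the three space forms at once. -/
theorem mul_normalSq (c : SignType) : (c : ℝ) * normalSq c = (c : ℝ) ^ 2 := by
  cases c <;> simp [normalSq]

theorem cast_pow_three (c : SignType) : (c : ℝ) ^ 3 = c := by
  cases c <;> norm_num

theorem ambientNormal_zero (p : Fin 4 → ℝ) : ambientNormal 0 p = Pi.single 0 1 := by
  funext i
  fin_cases i <;> simp [ambientNormal]

theorem ambientNormal_of_ne_zero {c : SignType} (hc : c ≠ 0) (p : Fin 4 → ℝ) :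
    ambientNormal c p = p := by
  cases c
  · exact absurd rfl hc
  · rfl
  · rfl

theorem cast_sq_of_ne_zero {c : SignType} (hc : c ≠ 0) : (c : ℝ) ^ 2 = 1 := by
  cases c
  · exact absurd rfl hc
  · simp
  · simp

theorem scalarProd_ambientNormal {c : SignType} {p : Fin 4 → ℝ} (hp : p ∈ spaceForm c) :
    scalarProd c (ambientNormal c p) (ambientNormal c p) = normalSq c := by
  by_cases hc : c = 0
  · subst hc
    rw [ambientNormal_zero, scalarProd_zero_single]
    simp [normalSq]
  · rw [ambientNormal_of_ne_zero hc]
    rw [spaceForm_of_ne_zero hc] at hp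
    refine Eq.trans hp ?_
    cases c
    · exact absurd rfl hc
    · simp [normalSq]
    · simp [normalSq]

section ScalarProdCalculus

variable {c : SignType} {p : ℝ × ℝ} {X Y : ℝ × ℝ → Fin 4 → ℝ}

theorem hasFDerivAt_scalarProd (hX : DifferentiableAt ℝ X p) (hY : DifferentiableAt ℝ Y p)
    (w : ℝ × ℝ) : DifferentiableAt ℝ (fun q => scalarProd c (X q) (Y q)) p ∧
      fderiv ℝ (fun q => scalarProd c (X q) (Y q)) p w =
        scalarProd c (fderiv ℝ X p w) (Y p) + scalarProd c (X p) (fderiv ℝ Y p w) := by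
  have hXi := fun i => (hasFDerivAt_pi'.1 hX.hasFDerivAt) i
  have hYi := fun i => (hasFDerivAt_pi'.1 hY.hasFDerivAt) i
  have h := HasFDerivAt.fun_sum (u := Finset.univ) fun i _ =>
    ((hXi i).const_mul (signature c i)).fun_mul (hYi i)
  refine ⟨h.differentiableAt, ?_⟩
  have e : (fun q => scalarProd c (X q) (Y q)) =
      fun q => ∑ i, signature c i * X q i * Y q i := rfl
  rw [e, h.fderiv]
  simp [scalarProd, ← Finset.sum_add_distrib]
  refine Finset.sum_congr rfl fun i _ => by ring

theorem dU_scalarProd (hX : DifferentiableAt ℝ X p) (hY : DifferentiableAt ℝ Y p) :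
    dU (fun q => scalarProd c (X q) (Y q)) p =
      scalarProd c (dU X p) (Y p) + scalarProd c (X p) (dU Y p) :=
  (hasFDerivAt_scalarProd hX hY _).2

theorem dV_scalarProd (hX : DifferentiableAt ℝ X p) (hY : DifferentiableAt ℝ Y p) :
    dV (fun q => scalarProd c (X q) (Y q)) p =
      scalarProd c (dV X p) (Y p) + scalarProd c (X p) (dV Y p) :=
  (hasFDerivAt_scalarProd hX hY _).2

theorem contDiffAt_scalarProd (hX : ContDiffAt ℝ ∞ X p) (hY : ContDiffAt ℝ ∞ Y p) :
    ContDiffAt ℝ ∞ (fun q => scalarProd c (X q) (Y q)) p := by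
  simp only [scalarProd]
  exact ContDiffAt.sum fun i _ =>
    (contDiffAt_const.mul (contDiffAt_pi.1 hX i)).mul (contDiffAt_pi.1 hY i)

theorem dU_of_scalarProd_eq (hX : DifferentiableAt ℝ X p) (hY : DifferentiableAt ℝ Y p)
    {φ : ℝ × ℝ → ℝ} (h : ∀ᶠ q in 𝓝 p, scalarProd c (X q) (Y q) = φ q) :
    scalarProd c (dU X p) (Y p) + scalarProd c (X p) (dU Y p) = dU φ p := by
  rw [← dU_scalarProd hX hY, dU_congr h]

theorem dV_of_scalarProd_eq (hX : DifferentiableAt ℝ X p) (hY : DifferentiableAt ℝ Y p)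
    {φ : ℝ × ℝ → ℝ} (h : ∀ᶠ q in 𝓝 p, scalarProd c (X q) (Y q) = φ q) :
    scalarProd c (dV X p) (Y p) + scalarProd c (X p) (dV Y p) = dV φ p := by
  rw [← dV_scalarProd hX hY, dV_congr h]

end ScalarProdCalculus

theorem contDiffAt_ambientNormal {c : SignType} {F : ℝ × ℝ → Fin 4 → ℝ} {p : ℝ × ℝ}
    (hF : ContDiffAt ℝ ∞ F p) : ContDiffAt ℝ ∞ (fun q => ambientNormal c (F q)) p := by
  by_cases hc : c = 0
  · subst hc
    simp only [ambientNormal_zero]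
    exact contDiffAt_const
  · simpa only [ambientNormal_of_ne_zero hc] using hF

/-- The factor `c²` is a switch: the ambient normal is constant for the hyperplane and is the
position vector for the two quadrics. -/
theorem dU_ambientNormal {c : SignType} (F : ℝ × ℝ → Fin 4 → ℝ) (p : ℝ × ℝ) :
    dU (fun q => ambientNormal c (F q)) p = (c : ℝ) ^ 2 • dU F p := by
  by_cases hc : c = 0
  · subst hc
    simp [ambientNormal_zero, dU_const]
  · simp only [ambientNormal_of_ne_zero hc, cast_sq_of_ne_zero hc, one_smul]

theorem dV_ambientNormal {c : SignType} (F : ℝ × ℝ → Fin 4 → ℝ) (p : ℝ × ℝ) :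
    dV (fun q => ambientNormal c (F q)) p = (c : ℝ) ^ 2 • dV F p := by
  by_cases hc : c = 0
  · subst hc
    simp [ambientNormal_zero, dV_const]
  · simp only [ambientNormal_of_ne_zero hc, cast_sq_of_ne_zero hc, one_smul]

/-- The scalar product is nondegenerate and the frame is a basis, so vectors can be compared through
their scalar products with the frame. -/
theorem eq_of_scalarProd_frame_eq {c : SignType} {n a b m : Fin 4 → ℝ}
    (hdet : (Matrix.of ![n, a, b, m]).det ≠ 0) {x y : Fin 4 → ℝ}
    (h0 : scalarProd c x n = scalarProd c y n) (h1 : scalarProd c x a = scalarProd c y a)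
    (h2 : scalarProd c x b = scalarProd c y b) (h3 : scalarProd c x m = scalarProd c y m) :
    x = y := by
  have key : Matrix.of ![n, a, b, m] *ᵥ (diagonal (signature c) *ᵥ (x - y)) = 0 := by
    have e : ∀ z : Fin 4 → ℝ, scalarProd c x z = scalarProd c y z →
        z ⬝ᵥ (diagonal (signature c) *ᵥ (x - y)) = 0 := by
      intro z hz
      rw [← scalarProd_eq_dotProduct, sub_eq_add_neg, scalarProd_add_right, scalarProd_neg_right,
        scalarProd_comm c z x, scalarProd_comm c z y, hz, add_neg_cancel]
    funext i
    fin_cases i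
    · exact e n h0
    · exact e a h1
    · exact e b h2
    · exact e m h3
  have h := Matrix.eq_zero_of_mulVec_eq_zero hdet key
  funext i
  have := congrFun h i
  simp only [mulVec_diagonal, Pi.zero_apply, mul_eq_zero, signature_ne_zero, false_or,
    Pi.sub_apply] at this
  linarith

/-- The coefficients of the derivatives with respect to `u` of the tuple `(n, F_u, F_v, N, F)`. -/
noncomputable def coefU (c : SignType) (E Eu H Q : ℝ) : Fin 5 → Fin 5 → ℝ :=
  ![![0, (c : ℝ) ^ 2, 0, 0, 0], ![0, Eu / E, 0, Q, 0], ![-(c * E), 0, 0, H * E, 0],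
    ![0, -H, -(Q / E), 0, 0], ![0, 1, 0, 0, 0]]

/-- The coefficients of the derivatives with respect to `v` of the tuple `(n, F_u, F_v, N, F)`. -/
noncomputable def coefV (c : SignType) (E Ev H R : ℝ) : Fin 5 → Fin 5 → ℝ :=
  ![![0, 0, (c : ℝ) ^ 2, 0, 0], ![-(c * E), 0, 0, H * E, 0], ![0, 0, Ev / E, R, 0],
    ![0, -(R / E), -H, 0, 0], ![0, 0, 1, 0, 0]]

/-- The tuple `(n, F_u, F_v, N, F)`. -/
noncomputable def frameTuple (c : SignType) (F N : ℝ × ℝ → Fin 4 → ℝ) :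
    Fin 5 → ℝ × ℝ → Fin 4 → ℝ :=
  ![fun q => ambientNormal c (F q), dU F, dV F, N, F]

section StructureEquations

variable {c : SignType} {E H Q R : ℝ × ℝ → ℝ} {F N : ℝ × ℝ → Fin 4 → ℝ} {p : ℝ × ℝ}

theorem FrameAt.nn {E H Q R : ℝ} (h : FrameAt c E H Q R F N p) :
    scalarProd c (ambientNormal c (F p)) (ambientNormal c (F p)) = normalSq c :=
  scalarProd_ambientNormal h.mem

theorem scalarProd_fderiv_ambientNormal (hF : DifferentiableAt ℝ F p)
    (hm : ∀ᶠ q in 𝓝 p, F q ∈ spaceForm c) (w : ℝ × ℝ) :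
    scalarProd c (fderiv ℝ F p w) (ambientNormal c (F p)) = 0 := by
  by_cases hc : c = 0
  · subst hc
    rw [ambientNormal_zero, scalarProd_zero_single]
    have h0 : (fun q => F q 0) =ᶠ[𝓝 p] fun _ => 0 := hm
    have h1 : fderiv ℝ (fun q => F q 0) p w = fderiv ℝ F p w 0 := by
      have := (hasFDerivAt_pi'.1 hF.hasFDerivAt 0).fderiv
      rw [this]; rfl
    rw [← h1, h0.fderiv_eq]
    simp
  · rw [ambientNormal_of_ne_zero hc]
    rw [spaceForm_of_ne_zero hc] at hm
    have h0 : (fun q => scalarProd c (F q) (F q)) =ᶠ[𝓝 p] fun _ => (c : ℝ) := hm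
    have h1 := (hasFDerivAt_scalarProd (c := c) hF hF w).2
    rw [h0.fderiv_eq, scalarProd_comm c (F p)] at h1
    simp at h1
    linarith

/-- The data in `FrameAt` are values without any regularity of their own; near `p` they equal scalar
products of derivatives of the smooth maps `F` and `N`, which makes them smooth. -/
theorem contDiffAt_E (h : ∀ᶠ q in 𝓝 p, FrameAt c (E q) (H q) (Q q) (R q) F N q) :
    ContDiffAt ℝ ∞ E p :=
  (contDiffAt_scalarProd (contDiffAt_dU h.self_of_nhds.smooth_F)
    (contDiffAt_dV h.self_of_nhds.smooth_F)).congr_of_eventuallyEq (by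
      filter_upwards [h] with q hq using hq.uv.symm)

theorem contDiffAt_Q (h : ∀ᶠ q in 𝓝 p, FrameAt c (E q) (H q) (Q q) (R q) F N q) :
    ContDiffAt ℝ ∞ Q p :=
  (contDiffAt_scalarProd (contDiffAt_dU h.self_of_nhds.smooth_F)
    (contDiffAt_dU h.self_of_nhds.smooth_N)).neg.congr_of_eventuallyEq (by
      filter_upwards [h] with q hq
      exact (neg_eq_iff_eq_neg.2 hq.uNu).symm)

theorem contDiffAt_R (h : ∀ᶠ q in 𝓝 p, FrameAt c (E q) (H q) (Q q) (R q) F N q) :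
    ContDiffAt ℝ ∞ R p :=
  (contDiffAt_scalarProd (contDiffAt_dV h.self_of_nhds.smooth_F)
    (contDiffAt_dV h.self_of_nhds.smooth_N)).neg.congr_of_eventuallyEq (by
      filter_upwards [h] with q hq
      exact (neg_eq_iff_eq_neg.2 hq.vNv).symm)

theorem contDiffAt_H (h : ∀ᶠ q in 𝓝 p, FrameAt c (E q) (H q) (Q q) (R q) F N q) :
    ContDiffAt ℝ ∞ H p :=
  ((contDiffAt_scalarProd (contDiffAt_dU h.self_of_nhds.smooth_F)
    (contDiffAt_dV h.self_of_nhds.smooth_N)).neg.div (contDiffAt_E h)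
      h.self_of_nhds.pos.ne').congr_of_eventuallyEq (by
      filter_upwards [h] with q hq
      change H q = -scalarProd c (dU F q) (dV N q) / E q
      rw [hq.uNv, neg_neg, mul_div_cancel_right₀ _ hq.pos.ne'])

/-- The structure equations of a conformal timelike immersion. -/
theorem structure_equations (h : ∀ᶠ q in 𝓝 p, FrameAt c (E q) (H q) (Q q) (R q) F N q) (i : Fin 5) :
    dU (frameTuple c F N i) p =
        ∑ k, coefU c (E p) (dU E p) (H p) (Q p) i k • frameTuple c F N k p ∧
      dV (frameTuple c F N i) p =
        ∑ k, coefV c (E p) (dV E p) (H p) (R p) i k • frameTuple c F N k p := by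
  have h0 := h.self_of_nhds
  have hF := h0.smooth_F
  have dF := hF.diff
  have da := (contDiffAt_dU hF).diff
  have db := (contDiffAt_dV hF).diff
  have dN := h0.smooth_N.diff
  have dn := (contDiffAt_ambientNormal (c := c) hF).diff
  have hm : ∀ᶠ q in 𝓝 p, ∀ᶠ r in 𝓝 q, F r ∈ spaceForm c := by
    filter_upwards [h.eventually_nhds] with q hq using hq.mono fun r hr => hr.mem
  have an : ∀ᶠ q in 𝓝 p, scalarProd c (dU F q) (ambientNormal c (F q)) = 0 := by
    filter_upwards [h, hm] with q hq hmq using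
      scalarProd_fderiv_ambientNormal hq.smooth_F.diff hmq _
  have bn : ∀ᶠ q in 𝓝 p, scalarProd c (dV F q) (ambientNormal c (F q)) = 0 := by
    filter_upwards [h, hm] with q hq hmq using
      scalarProd_fderiv_ambientNormal hq.smooth_F.diff hmq _
  have hab := dV_dU_comm hF
  have hE := h0.pos.ne'
  have an0 := an.self_of_nhds
  have bn0 := bn.self_of_nhds
  have nn0 := h0.nn
  have na0 := scalarProd_comm c _ _ ▸ an0
  have nb0 := scalarProd_comm c _ _ ▸ bn0
  have ba0 := scalarProd_comm c _ _ ▸ h0.uv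
  have Na0 := scalarProd_comm c _ _ ▸ h0.uN
  have Nb0 := scalarProd_comm c _ _ ▸ h0.vN
  have nN0 := scalarProd_comm c _ _ ▸ h0.Nn
  have hcn := mul_normalSq c
  -- derivatives of the scalar products
  have U1 := dU_of_scalarProd_eq da dn an
  have V1 := dV_of_scalarProd_eq da dn an
  have V2 := dV_of_scalarProd_eq db dn bn
  have U3 := dU_of_scalarProd_eq da da (h.mono fun q hq => hq.uu)
  have V3 := dV_of_scalarProd_eq da da (h.mono fun q hq => hq.uu)
  have U4 := dU_of_scalarProd_eq db db (h.mono fun q hq => hq.vv)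
  have V4 := dV_of_scalarProd_eq db db (h.mono fun q hq => hq.vv)
  have U5 := dU_of_scalarProd_eq da db (h.mono fun q hq => hq.uv)
  have V5 := dV_of_scalarProd_eq da db (h.mono fun q hq => hq.uv)
  have U6 := dU_of_scalarProd_eq da dN (h.mono fun q hq => hq.uN)
  have V6 := dV_of_scalarProd_eq da dN (h.mono fun q hq => hq.uN)
  have V7 := dV_of_scalarProd_eq db dN (h.mono fun q hq => hq.vN)
  have U8 := dU_of_scalarProd_eq dN dN (h.mono fun q hq => hq.NN)
  have V8 := dV_of_scalarProd_eq dN dN (h.mono fun q hq => hq.NN)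
  have U9 := dU_of_scalarProd_eq dN dn (h.mono fun q hq => hq.Nn)
  have V9 := dV_of_scalarProd_eq dN dn (h.mono fun q hq => hq.Nn)
  rw [dU_ambientNormal, scalarProd_smul_right] at U1 U9
  rw [dV_ambientNormal, scalarProd_smul_right] at V1 V2 V9
  rw [hab] at V1 V3 V5 V6
  simp only [scalarProd_comm c (dU F p) (dU (dU F) p), scalarProd_comm c (dU F p) (dU (dV F) p),
    scalarProd_comm c (dV F p) (dU (dV F) p), scalarProd_comm c (dV F p) (dV (dV F) p),
    scalarProd_comm c (dU F p) (dV (dV F) p),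
    scalarProd_comm c (N p) (dU N p), scalarProd_comm c (N p) (dV N p), dU_const, dV_const,
    h0.uu, h0.vv, h0.uv, Na0, Nb0, h0.uNu, h0.uNv, h0.vNv, mul_zero, add_zero]
    at U1 V1 V2 U3 V3 U4 V4 U5 V5 U6 V6 V7 U8 V8 U9 V9
  have uNu' := scalarProd_comm c _ _ ▸ h0.uNu
  have uNv' := scalarProd_comm c _ _ ▸ h0.uNv
  have vNu' := scalarProd_comm c _ _ ▸ h0.vNu
  have vNv' := scalarProd_comm c _ _ ▸ h0.vNv
  -- The mixed derivative has no tangential part, because `⟨F_u, F_u⟩` and `⟨F_v, F_v⟩` vanish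
  -- identically. Its normal part is the mean curvature, and its part along `n` comes from
  -- differentiating `⟨F_u, n⟩ = 0`.
  have huv : dU (dV F) p = (H p * E p) • N p + (-(c * E p)) • ambientNormal c (F p) := by
    refine eq_of_scalarProd_frame_eq (c := c) h0.det.ne' ?_ ?_ ?_ ?_ <;>
    simp only [scalarProd_add_left, scalarProd_smul_left, h0.Nn, Na0, Nb0, h0.NN, nn0, na0, nb0,
      nN0]
    · linear_combination V1 + E p * hcn
    · linarith
    · linarith
    · linarith
  refine ⟨?_, ?_⟩
  · fin_cases i
    · simp [frameTuple, coefU, Fin.sum_univ_five, dU_ambientNormal]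
    · simp only [frameTuple, coefU, Fin.sum_univ_five]
      simp
      refine eq_of_scalarProd_frame_eq (c := c) h0.det.ne' ?_ ?_ ?_ ?_ <;>
      simp only [scalarProd_add_left, scalarProd_smul_left, h0.Nn, Na0, Nb0, h0.NN, an0, h0.uu,
        h0.uv, h0.uN] <;>
      simp only [div_mul_cancel₀ _ hE, mul_zero, add_zero, zero_add, mul_one] <;>
      linarith
    · simp only [frameTuple, coefU, Fin.sum_univ_five]
      simp
      rw [huv]; simp [add_comm]
    · simp only [frameTuple, coefU, Fin.sum_univ_five]
      simp only [Fin.reduceFinMk, cons_val]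
      simp only [zero_smul, zero_add, add_zero]
      refine eq_of_scalarProd_frame_eq (c := c) h0.det.ne' ?_ ?_ ?_ ?_ <;>
      simp only [scalarProd_add_left, scalarProd_smul_left, bn0, ba0, h0.vv, h0.vN, an0, h0.uu,
        h0.uv, h0.uN, uNu', vNu'] <;>
      simp only [neg_mul, div_mul_cancel₀ _ hE, mul_zero, add_zero, zero_add] <;>
      linarith
    · simp [frameTuple, coefU, Fin.sum_univ_five]
  · fin_cases i
    · simp [frameTuple, coefV, Fin.sum_univ_five, dV_ambientNormal]
    · simp only [frameTuple, coefV, Fin.sum_univ_five]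
      simp
      rw [hab, huv]; simp [add_comm]
    · simp only [frameTuple, coefV, Fin.sum_univ_five]
      simp
      refine eq_of_scalarProd_frame_eq (c := c) h0.det.ne' ?_ ?_ ?_ ?_ <;>
      simp only [scalarProd_add_left, scalarProd_smul_left, h0.Nn, Na0, Nb0, h0.NN, bn0, h0.vv,
        ba0, h0.vN] <;>
      simp only [div_mul_cancel₀ _ hE, mul_zero, add_zero, zero_add, mul_one] <;>
      linarith
    · simp only [frameTuple, coefV, Fin.sum_univ_five]
      simp only [Fin.reduceFinMk, cons_val]
      simp only [zero_smul, zero_add, add_zero]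
      refine eq_of_scalarProd_frame_eq (c := c) h0.det.ne' ?_ ?_ ?_ ?_ <;>
      simp only [scalarProd_add_left, scalarProd_smul_left, bn0, ba0, h0.vv, h0.vN, an0, h0.uu,
        h0.uv, h0.uN, uNv', vNv'] <;>
      simp only [neg_mul, div_mul_cancel₀ _ hE, mul_zero, add_zero, zero_add] <;>
      linarith
    · simp [frameTuple, coefV, Fin.sum_univ_five]

end StructureEquations

/-- The Gauss and Codazzi equations in null coordinates, for the induced metric `2 E du dv`, the mean
curvature `H` and the Hopf differentials `Q du²`, `R dv²`. -/
structure GaussCodazziAt (c : SignType) (E H Q R : ℝ × ℝ → ℝ) (p : ℝ × ℝ) : Prop where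
  gauss : dV (fun q => dU E q / E q) p = Q p * R p / E p - (H p ^ 2 + c) * E p
  codazziQ : dV Q p = E p * dU H p
  codazziR : dU R p = E p * dV H p

/-! ### Necessity of the Gauss and Codazzi equations -/

section FrameDerivatives

variable {c : SignType} {E H Q R : ℝ × ℝ → ℝ} {F N : ℝ × ℝ → Fin 4 → ℝ} {p : ℝ × ℝ}

theorem dU_dU_of_frame (h : ∀ᶠ q in 𝓝 p, FrameAt c (E q) (H q) (Q q) (R q) F N q) :
    dU (dU F) p = (dU E p / E p) • dU F p + Q p • N p := by
  simpa [frameTuple, coefU, Fin.sum_univ_five] using (structure_equations h 1).1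

theorem dV_dU_of_frame (h : ∀ᶠ q in 𝓝 p, FrameAt c (E q) (H q) (Q q) (R q) F N q) :
    dV (dU F) p = -(c * E p) • ambientNormal c (F p) + (H p * E p) • N p := by
  simpa [frameTuple, coefV, Fin.sum_univ_five] using (structure_equations h 1).2

theorem dV_dV_of_frame (h : ∀ᶠ q in 𝓝 p, FrameAt c (E q) (H q) (Q q) (R q) F N q) :
    dV (dV F) p = (dV E p / E p) • dV F p + R p • N p := by
  simpa [frameTuple, coefV, Fin.sum_univ_five] using (structure_equations h 2).2

theorem dU_dV_of_frame (h : ∀ᶠ q in 𝓝 p, FrameAt c (E q) (H q) (Q q) (R q) F N q) :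
    dU (dV F) p = -(c * E p) • ambientNormal c (F p) + (H p * E p) • N p := by
  simpa [frameTuple, coefU, Fin.sum_univ_five] using (structure_equations h 2).1

theorem dU_normal_of_frame (h : ∀ᶠ q in 𝓝 p, FrameAt c (E q) (H q) (Q q) (R q) F N q) :
    dU N p = -H p • dU F p + -(Q p / E p) • dV F p := by
  have := (structure_equations h 3).1
  simp only [frameTuple, coefU, Fin.sum_univ_five] at this
  simpa using this

theorem dV_normal_of_frame (h : ∀ᶠ q in 𝓝 p, FrameAt c (E q) (H q) (Q q) (R q) F N q) :
    dV N p = -(R p / E p) • dU F p + -H p • dV F p := by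
  have := (structure_equations h 3).2
  simp only [frameTuple, coefV, Fin.sum_univ_five] at this
  simpa using this

theorem scalarProd_dV_ambientNormal_of_frame
    (h : ∀ᶠ q in 𝓝 p, FrameAt c (E q) (H q) (Q q) (R q) F N q) :
    scalarProd c (dV F p) (ambientNormal c (F p)) = 0 :=
  scalarProd_fderiv_ambientNormal h.self_of_nhds.smooth_F.diff (h.mono fun _ hq => hq.mem) _

theorem contDiffAt_dU_div {E : ℝ × ℝ → ℝ} (hE : ContDiffAt ℝ ∞ E p) (h0 : E p ≠ 0) :
    ContDiffAt ℝ ∞ (fun q => dU E q / E q) p :=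
  (contDiffAt_dU hE).div hE h0

theorem contDiffAt_dV_div {E : ℝ × ℝ → ℝ} (hE : ContDiffAt ℝ ∞ E p) (h0 : E p ≠ 0) :
    ContDiffAt ℝ ∞ (fun q => dV E q / E q) p :=
  (contDiffAt_dV hE).div hE h0

/-- Every conformal timelike immersion satisfies the Gauss and Codazzi equations. -/
theorem gaussCodazziAt_of_frame (h : ∀ᶠ q in 𝓝 p, FrameAt c (E q) (H q) (Q q) (R q) F N q) :
    GaussCodazziAt c E H Q R p := by
  have h0 := h.self_of_nhds
  have hF := h0.smooth_F
  have hE0 := h0.pos.ne'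
  have cE := contDiffAt_E h
  have cH := contDiffAt_H h
  have cQ := contDiffAt_Q h
  have cR := contDiffAt_R h
  have dn := (contDiffAt_ambientNormal (c := c) hF).diff
  have da := (contDiffAt_dU hF).diff
  have db := (contDiffAt_dV hF).diff
  have dN := h0.smooth_N.diff
  have ha := dV_dU_comm (contDiffAt_dU hF)
  have hb := dV_dU_comm (contDiffAt_dV hF)
  have hh := h.eventually_nhds
  have dE : DifferentiableAt ℝ (fun q => -((c : ℝ) * E q)) p := (contDiffAt_const.mul cE).neg.diff
  have dHE : DifferentiableAt ℝ (fun q => H q * E q) p := (cH.mul cE).diff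
  have duE := (contDiffAt_dU_div cE hE0).diff
  have dvE := (contDiffAt_dV_div cE hE0).diff
  have eUE : dU (fun q => -((c : ℝ) * E q)) p = -(c * dU E p) := by
    rw [dU_neg, dU_mul contDiffAt_const.diff cE.diff, dU_const]; simp
  have eVE : dV (fun q => -((c : ℝ) * E q)) p = -(c * dV E p) := by
    rw [dV_neg, dV_mul contDiffAt_const.diff cE.diff, dV_const]; simp
  have eUHE := dU_mul cH.diff cE.diff
  have eVHE := dV_mul cH.diff cE.diff
  rw [dV_congr (hh.mono fun q hq => dU_dU_of_frame hq),
    dU_congr (hh.mono fun q hq => dV_dU_of_frame hq),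
    dV_add (duE.fun_smul da) (cQ.diff.fun_smul dN), dV_smul duE da, dV_smul cQ.diff dN,
    dU_add (dE.fun_smul dn) (dHE.fun_smul dN), dU_smul dE dn, dU_smul dHE dN, eUE, eUHE,
    dV_dU_of_frame h, dU_ambientNormal, dU_normal_of_frame h, dV_normal_of_frame h] at ha
  rw [dV_congr (hh.mono fun q hq => dU_dV_of_frame hq),
    dU_congr (hh.mono fun q hq => dV_dV_of_frame hq),
    dU_add (dvE.fun_smul db) (cR.diff.fun_smul dN), dU_smul dvE db, dU_smul cR.diff dN,
    dV_add (dE.fun_smul dn) (dHE.fun_smul dN), dV_smul dE dn, dV_smul dHE dN, eVE, eVHE,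
    dU_dV_of_frame h, dV_ambientNormal, dU_normal_of_frame h, dV_normal_of_frame h] at hb
  have nb : scalarProd c (ambientNormal c (F p)) (dV F p) = 0 := by
    rw [scalarProd_comm]; exact scalarProd_dV_ambientNormal_of_frame h
  have nN : scalarProd c (ambientNormal c (F p)) (N p) = 0 := by
    rw [scalarProd_comm]; exact h0.Nn
  have Nb : scalarProd c (N p) (dV F p) = 0 := by rw [scalarProd_comm]; exact h0.vN
  -- The product of `F_uuv = F_uvu` with `F_v` is `E` times the Gauss equation, and its product with
  -- `N` is the equation for `Q`. The product of `F_vuv = F_vvu` with `N` is the equation for `R`.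
  have ha1 := congrArg (fun x => scalarProd c x (dV F p)) ha
  have ha2 := congrArg (fun x => scalarProd c x (N p)) ha
  have hb2 := congrArg (fun x => scalarProd c x (N p)) hb
  simp only [scalarProd_add_left, scalarProd_smul_left, nb, nN, Nb, h0.uN, h0.vN, h0.NN,
    h0.uv, h0.vv] at ha1 ha2 hb2
  have c3 := cast_pow_three c
  refine ⟨?_, ?_, ?_⟩
  · have : (dV (fun q => dU E q / E q) p - (Q p * R p / E p - (H p ^ 2 + c) * E p)) * E p = 0 := by
      linear_combination ha1 - E p ^ 2 * c3
    exact sub_eq_zero.1 ((mul_eq_zero.1 this).resolve_right hE0)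
  · have e1 := div_mul_cancel₀ (dU E p) hE0
    linear_combination ha2 - H p * e1
  · have e1 := div_mul_cancel₀ (dV E p) hE0
    linear_combination -hb2 - H p * e1

end FrameDerivatives

/-! ### Integrability of the structure equations -/

section Flatness

variable {c : SignType} {E H Q R : ℝ × ℝ → ℝ} {p : ℝ × ℝ}

theorem dU_dV_div_eq {E : ℝ × ℝ → ℝ} (hE : ContDiffAt ℝ ∞ E p) (h0 : E p ≠ 0) :
    dU (fun q => dV E q / E q) p = dV (fun q => dU E q / E q) p := by
  rw [dU_div (contDiffAt_dV hE).diff hE.diff h0, dV_div (contDiffAt_dU hE).diff hE.diff h0,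
    dV_dU_comm hE]
  ring

/-- The Gauss and Codazzi equations are the integrability conditions of the structure equations. -/
theorem coef_flat (h : GaussCodazziAt c E H Q R p) (hE : ContDiffAt ℝ ∞ E p) (h0 : E p ≠ 0)
    (hH : ContDiffAt ℝ ∞ H p) (hQ : ContDiffAt ℝ ∞ Q p) (hR : ContDiffAt ℝ ∞ R p) (i j : Fin 5) :
    dV (fun q => coefU c (E q) (dU E q) (H q) (Q q) i j) p +
        ∑ k, coefU c (E p) (dU E p) (H p) (Q p) i k * coefV c (E p) (dV E p) (H p) (R p) k j =
      dU (fun q => coefV c (E q) (dV E q) (H q) (R q) i j) p +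
        ∑ k, coefV c (E p) (dV E p) (H p) (R p) i k * coefU c (E p) (dU E p) (H p) (Q p) k j := by
  have eUE : dU (fun q => ((c : ℝ) * E q)) p = c * dU E p := by
    rw [dU_mul contDiffAt_const.diff hE.diff, dU_const]; simp
  have eVE : dV (fun q => ((c : ℝ) * E q)) p = c * dV E p := by
    rw [dV_mul contDiffAt_const.diff hE.diff, dV_const]; simp
  have eUHE := dU_mul hH.diff hE.diff
  have eVHE := dV_mul hH.diff hE.diff
  have eQ := dV_div hQ.diff hE.diff h0
  have eR := dU_div hR.diff hE.diff h0
  have hg := h.gauss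
  have hg' := (dU_dV_div_eq hE h0).trans hg
  have hQv := h.codazziQ
  have hRu := h.codazziR
  have c3 := cast_pow_three c
  -- The entries that are not formal identities express the Gauss equation or a Codazzi equation.
  -- Terms that pass through the ambient normal carry `c · c²`, which is reduced by `c³ = c`.
  fin_cases i <;> fin_cases j <;>
    simp [coefU, coefV, Fin.sum_univ_five, dU_const, dV_const, dU_neg, dV_neg, eUE, eVE, eUHE,
      eVHE, eQ, eR, hg, hg', hQv, hRu]
  all_goals first
    | linear_combination E p * c3
    | linear_combination -E p * c3
    | (field_simp; done)
    | (field_simp; ring)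

end Flatness

/-! ### The prescribed mean curvature and the normalised data -/

section Normalization

variable {f g : ℝ × ℝ → ℝ} {p : ℝ × ℝ} {c : SignType}

theorem ContDiffAt.eventually_diff {Z : Type*} [NormedAddCommGroup Z] [NormedSpace ℝ Z]
    {z : ℝ × ℝ → Z} (h : ContDiffAt ℝ ∞ z p) : ∀ᶠ q in 𝓝 p, DifferentiableAt ℝ z q := by
  have h1 : ContDiffAt ℝ 1 z p := h.of_le (by exact_mod_cast le_top)
  filter_upwards [h1.eventually (by simp)] with q hq using hq.differentiableAt (by simp)

theorem contDiffAt_one_add (c : SignType) (hf : ContDiffAt ℝ ∞ f p) :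
    ContDiffAt ℝ ∞ (fun q => 1 + (c : ℝ) * f q ^ 2) p :=
  contDiffAt_const.add (contDiffAt_const.mul (hf.pow 2))

theorem dU_one_add (c : SignType) (hf : DifferentiableAt ℝ f p) :
    dU (fun q => 1 + (c : ℝ) * f q ^ 2) p = 2 * c * f p * dU f p := by
  simp only [pow_two]
  have hm : DifferentiableAt ℝ (fun q => f q * f q) p := hf.fun_mul hf
  rw [dU_add (differentiableAt_const _) (hm.const_mul _), dU_const,
    dU_mul (differentiableAt_const _) hm, dU_const, dU_mul hf hf]
  ring

theorem dV_one_add (c : SignType) (hf : DifferentiableAt ℝ f p) :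
    dV (fun q => 1 + (c : ℝ) * f q ^ 2) p = 2 * c * f p * dV f p := by
  simp only [pow_two]
  have hm : DifferentiableAt ℝ (fun q => f q * f q) p := hf.fun_mul hf
  rw [dV_add (differentiableAt_const _) (hm.const_mul _), dV_const,
    dV_mul (differentiableAt_const _) hm, dV_const, dV_mul hf hf]
  ring

theorem contDiffAt_lawsonH (c : SignType) (hf : ContDiffAt ℝ ∞ f p) (hg : ContDiffAt ℝ ∞ g p)
    (hfg : f p + g p ≠ 0) : ContDiffAt ℝ ∞ (lawsonH f g c) p :=
  (contDiffAt_const.sub ((contDiffAt_const.mul hf).mul hg)).div (hf.add hg) hfg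

/-- With `g_u = 0` the numerator of the quotient rule is `-c g f_u (f + g) - (1 - c f g) f_u`, where
the terms in `f g f_u` cancel. -/
theorem dU_lawsonH (c : SignType) (hf : DifferentiableAt ℝ f p) (hg : DifferentiableAt ℝ g p)
    (hgu : dU g p = 0) (hfg : f p + g p ≠ 0) :
    dU (lawsonH f g c) p = -(dU f p * (1 + c * g p ^ 2)) / (f p + g p) ^ 2 := by
  have h1 : DifferentiableAt ℝ (fun q => (c : ℝ) * f q) p := hf.const_mul _
  have e : lawsonH f g c = fun q => (1 - (c : ℝ) * f q * g q) / (f q + g q) := rfl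
  rw [e, dU_div ((differentiableAt_const _).fun_sub (h1.fun_mul hg)) (hf.fun_add hg) hfg,
    dU_sub (differentiableAt_const _) (h1.fun_mul hg), dU_const, dU_mul h1 hg,
    dU_mul (differentiableAt_const _) hf, dU_const, dU_add hf hg, hgu]
  congr 1
  ring

theorem dV_lawsonH (c : SignType) (hf : DifferentiableAt ℝ f p) (hg : DifferentiableAt ℝ g p)
    (hfv : dV f p = 0) (hfg : f p + g p ≠ 0) :
    dV (lawsonH f g c) p = -(dV g p * (1 + c * f p ^ 2)) / (f p + g p) ^ 2 := by
  have h1 : DifferentiableAt ℝ (fun q => (c : ℝ) * f q) p := hf.const_mul _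
  have e : lawsonH f g c = fun q => (1 - (c : ℝ) * f q * g q) / (f q + g q) := rfl
  rw [e, dV_div ((differentiableAt_const _).fun_sub (h1.fun_mul hg)) (hf.fun_add hg) hfg,
    dV_sub (differentiableAt_const _) (h1.fun_mul hg), dV_const, dV_mul h1 hg,
    dV_mul (differentiableAt_const _) hf, dV_const, dV_add hf hg, hfv]
  congr 1
  ring

/-- The identity `(1 - c f g)² + c (f + g)² = (1 + c f²)(1 + c g²)`, the multiplicativity of the
form `x² + c y²`. -/
theorem lawsonH_sq_add (c : SignType) (hfg : f p + g p ≠ 0) :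
    lawsonH f g c p ^ 2 + c = (1 + c * f p ^ 2) * (1 + c * g p ^ 2) / (f p + g p) ^ 2 := by
  simp only [lawsonH]
  field_simp
  ring

/-- A factor `a(u) b(v)` does not change the Gauss curvature term. -/
theorem dV_dU_div_mul {a b E : ℝ × ℝ → ℝ} (ha : ContDiffAt ℝ ∞ a p) (hb : ContDiffAt ℝ ∞ b p)
    (hE : ContDiffAt ℝ ∞ E p) (hav : ∀ᶠ q in 𝓝 p, dV a q = 0) (hbu : ∀ᶠ q in 𝓝 p, dU b q = 0)
    (ha0 : a p ≠ 0) (hb0 : b p ≠ 0) (hE0 : E p ≠ 0) :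
    dV (fun q => dU (fun r => a r * b r * E r) q / (a q * b q * E q)) p =
      dV (fun q => dU E q / E q) p := by
  have dab : DifferentiableAt ℝ (fun q => a q * b q) p := ha.diff.fun_mul hb.diff
  -- The logarithmic derivative in `u` does not see `b`, and its term `a_u / a` does not depend on
  -- `v`.
  have key : (fun q => dU (fun r => a r * b r * E r) q / (a q * b q * E q)) =ᶠ[𝓝 p]
      fun q => dU a q / a q + dU E q / E q := by
    filter_upwards [ha.eventually_diff, hb.eventually_diff, hE.eventually_diff, hbu,
      ha.continuousAt.eventually_ne ha0, hb.continuousAt.eventually_ne hb0,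
      hE.continuousAt.eventually_ne hE0] with q h1 h2 h3 h4 h5 h6 h7
    rw [dU_mul (h1.fun_mul h2) h3, dU_mul h1 h2, h4]
    field_simp
    ring
  have hz : dV (dU a) p = 0 := by
    have e : dV a =ᶠ[𝓝 p] fun _ => (0 : ℝ) := hav
    rw [dV_dU_comm ha, dU_congr e, dU_const]
  rw [dV_congr key, dV_add (contDiffAt_dU_div ha ha0).diff (contDiffAt_dU_div hE hE0).diff,
    dV_div (contDiffAt_dU ha).diff ha.diff ha0, hz, hav.self_of_nhds]
  simp

/-- After multiplication of the data by the factors `1 + c f²` and `1 + c g²`, the Gauss and Codazzi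
equations for the mean curvature `H_c` do not depend on the curvature `c`. -/
theorem gaussCodazziAt_lawsonH_iff {E Q R : ℝ × ℝ → ℝ} (c : SignType)
    (hf : ContDiffAt ℝ ∞ f p) (hg : ContDiffAt ℝ ∞ g p)
    (hfv : ∀ᶠ q in 𝓝 p, dV f q = 0) (hgu : ∀ᶠ q in 𝓝 p, dU g q = 0) (hfg : f p + g p ≠ 0)
    (hA : 1 + (c : ℝ) * f p ^ 2 ≠ 0) (hB : 1 + (c : ℝ) * g p ^ 2 ≠ 0)
    (hE : ContDiffAt ℝ ∞ E p) (hE0 : E p ≠ 0) (hQ : ContDiffAt ℝ ∞ Q p)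
    (hR : ContDiffAt ℝ ∞ R p) :
    GaussCodazziAt c E (lawsonH f g c) Q R p ↔
      GaussCodazziAt 0 (fun q => (1 + (c : ℝ) * f q ^ 2) * (1 + (c : ℝ) * g q ^ 2) * E q)
        (lawsonH f g 0) (fun q => (1 + (c : ℝ) * f q ^ 2) * Q q)
        (fun q => (1 + (c : ℝ) * g q ^ 2) * R q) p := by
  have cA := contDiffAt_one_add c hf
  have cB := contDiffAt_one_add c hg
  have hAv : ∀ᶠ q in 𝓝 p, dV (fun q => 1 + (c : ℝ) * f q ^ 2) q = 0 := by
    filter_upwards [hf.eventually_diff, hfv] with q h1 h2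
    rw [dV_one_add c h1, h2, mul_zero]
  have hBu : ∀ᶠ q in 𝓝 p, dU (fun q => 1 + (c : ℝ) * g q ^ 2) q = 0 := by
    filter_upwards [hg.eventually_diff, hgu] with q h1 h2
    rw [dU_one_add c h1, h2, mul_zero]
  have hgauss := dV_dU_div_mul cA cB hE hAv hBu hA hB hE0
  have hq := dV_mul cA.diff hQ.diff
  have hr := dU_mul cB.diff hR.diff
  rw [hAv.self_of_nhds, zero_mul, zero_add] at hq
  rw [hBu.self_of_nhds, zero_mul, zero_add] at hr
  have u := fun c => dU_lawsonH c hf.diff hg.diff hgu.self_of_nhds hfg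
  have v := fun c => dV_lawsonH c hf.diff hg.diff hfv.self_of_nhds hfg
  have s := fun c => lawsonH_sq_add (p := p) c hfg
  have z : (((0 : SignType) : ℝ)) = 0 := by simp
  -- Write `A`, `B` for the two factors. The quotient `Q R / E` is unchanged by the scaling, and
  -- `(H_c² + c) E = A B E / (f + g)²` is the curvature term for `c = 0`. Likewise `A E (H_c)_u = A
  -- B E (H_0)_u`, and `B E (H_c)_v = A B E (H_0)_v`.
  constructor
  · rintro ⟨h1, h2, h3⟩
    refine ⟨?_, ?_, ?_⟩
    · rw [hgauss, h1, s, s, z]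
      field_simp
      ring
    · rw [hq, h2, u, u, z]
      field_simp
      ring
    · rw [hr, h3, v, v, z]
      field_simp
      ring
  · rintro ⟨h1, h2, h3⟩
    refine ⟨?_, ?_, ?_⟩
    · rw [hgauss, s, z] at h1
      rw [h1, s]
      field_simp
      ring
    · rw [hq, u, z] at h2
      refine mul_left_cancel₀ hA ?_
      rw [h2, u]
      field_simp
      ring
    · rw [hr, v, z] at h3
      refine mul_left_cancel₀ hB ?_
      rw [h3, v]
      field_simp
      ring

end Normalization

/-! ### Existence of local immersions with given data -/

section Existence

/-- The Gram matrix of the frame `(n, F_u, F_v, N)`. -/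
def frameGram (c : SignType) (E : ℝ) : Matrix (Fin 4) (Fin 4) ℝ :=
  Matrix.of ![![normalSq c, 0, 0, 0], ![0, 0, E, 0], ![0, E, 0, 0], ![0, 0, 0, 1]]

noncomputable def frameGramInv (c : SignType) (E : ℝ) : Matrix (Fin 4) (Fin 4) ℝ :=
  Matrix.of ![![normalSq c, 0, 0, 0], ![0, 0, 1 / E, 0], ![0, 1 / E, 0, 0], ![0, 0, 0, 1]]

theorem normalSq_mul_self (c : SignType) : normalSq c * normalSq c = 1 := by
  cases c <;> simp [normalSq]

theorem frameGram_mul_inv (c : SignType) {E : ℝ} (hE : E ≠ 0) :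
    frameGram c E * frameGramInv c E = 1 := by
  ext i j
  fin_cases i <;> fin_cases j <;>
    simp [frameGram, frameGramInv, Matrix.mul_apply, Fin.sum_univ_four, normalSq_mul_self, hE]

/-- If the rows of `P` have Gram matrix `G`, then `Pᵀ G⁻¹ P` is the inverse of `D`, that is `D`
itself. In this second form the right-hand side is constant even when `G` varies from point to
point. -/
theorem gram_iff_cogram {P G M D : Matrix (Fin 4) (Fin 4) ℝ} (hD : D * D = 1) (hG : G * M = 1) :
    P * D * Pᵀ = G ↔ Pᵀ * M * P = D := by
  constructor
  · intro h
    have h1 : P * (D * Pᵀ * M) = 1 := by rw [← hG, ← h]; simp only [Matrix.mul_assoc]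
    have h2 := mul_eq_one_comm.1 h1
    calc Pᵀ * M * P = D * D * (Pᵀ * M * P) := by rw [hD, one_mul]
      _ = D * (D * Pᵀ * M * P) := by simp only [Matrix.mul_assoc]
      _ = D := by rw [h2, mul_one]
  · intro h
    have h1 : (D * Pᵀ * M) * P = 1 := by rw [← hD, ← h]; simp only [Matrix.mul_assoc]
    have h2 := mul_eq_one_comm.1 h1
    have h3 := mul_eq_one_comm.1 hG
    calc P * D * Pᵀ = P * D * Pᵀ * (M * G) := by rw [h3, mul_one]
      _ = P * (D * Pᵀ * M) * G := by simp only [Matrix.mul_assoc]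
      _ = G := by rw [h2, one_mul]

theorem scalarProd_gram (c : SignType) (P : Matrix (Fin 4) (Fin 4) ℝ) (i j : Fin 4) :
    (P * diagonal (signature c) * Pᵀ) i j = scalarProd c (P i) (P j) := by
  rw [Matrix.mul_apply]
  simp only [mul_diagonal, transpose_apply, scalarProd]
  exact Finset.sum_congr rfl fun k _ => by ring

theorem cogram_apply (c : SignType) (E : ℝ) (n a b m : Fin 4 → ℝ) (k l : Fin 4) :
    ((Matrix.of ![n, a, b, m])ᵀ * frameGramInv c E * Matrix.of ![n, a, b, m]) k l =
      normalSq c * n k * n l + (a k * b l + b k * a l) / E + m k * m l := by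
  simp [frameGramInv, Matrix.mul_apply, Fin.sum_univ_four]
  ring

/-- The null vectors are sums and differences of a negative and a positive coordinate vector, scaled
by `μ` with `2 μ² = E`; order and signs are chosen to make the determinant positive. The fifth
vector is the initial point of the surface, equal to its own normal when `c ≠ 0`. -/
theorem exists_initial_frame (c : SignType) {E : ℝ} (hE : 0 < E) :
    ∃ n a b m Y : Fin 4 → ℝ, 0 < (Matrix.of ![n, a, b, m]).det ∧
      Matrix.of ![n, a, b, m] * diagonal (signature c) * (Matrix.of ![n, a, b, m])ᵀ =
        frameGram c E ∧ (c ≠ 0 → Y = n) ∧ (c = 0 → n = Pi.single 0 1 ∧ Y 0 = 0) := by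
  obtain ⟨μ, hμ, hμE⟩ : ∃ μ : ℝ, 0 < μ ∧ μ * μ = E / 2 :=
    ⟨√(E / 2), Real.sqrt_pos.2 (by linarith), Real.mul_self_sqrt (by linarith)⟩
  have hμ2 : 0 < μ * μ := mul_pos hμ hμ
  by_cases hc : c = 1
  · subst hc
    refine ⟨![0, 1, 0, 0], ![μ, 0, μ, 0], ![-μ, 0, μ, 0], ![0, 0, 0, -1], ![0, 1, 0, 0], ?_, ?_,
      fun _ => rfl, fun h => absurd h (by decide)⟩
    · simp [Matrix.det_succ_row_zero, Fin.sum_univ_succ, Fin.succAbove]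
      linarith
    · ext i j
      rw [scalarProd_gram]
      fin_cases i <;> fin_cases j <;>
        simp [frameGram, scalarProd, Fin.sum_univ_four, signature, normalSq] <;>
        linarith
  · refine ⟨![1, 0, 0, 0], ![0, μ, μ, 0], ![0, -μ, μ, 0], ![0, 0, 0, 1],
      if c = 0 then 0 else ![1, 0, 0, 0], ?_, ?_, fun h => by simp [h], fun h => ⟨?_, by simp [h]⟩⟩
    · simp [Matrix.det_succ_row_zero, Fin.sum_univ_succ, Fin.succAbove]
      linarith
    · have hs : signature c = ![-1, -1, 1, 1] ∧ normalSq c = -1 := by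
        cases c
        · exact ⟨rfl, rfl⟩
        · exact ⟨rfl, rfl⟩
        · exact absurd rfl hc
      ext i j
      rw [scalarProd_gram]
      fin_cases i <;> fin_cases j <;>
        simp [frameGram, scalarProd, Fin.sum_univ_four, hs] <;> linarith
    · funext i
      fin_cases i <;> simp

variable {c : SignType} {E H Q R : ℝ × ℝ → ℝ} {p : ℝ × ℝ}

theorem contDiffAt_coefU (hE : ContDiffAt ℝ ∞ E p) (h0 : E p ≠ 0) (hH : ContDiffAt ℝ ∞ H p)
    (hQ : ContDiffAt ℝ ∞ Q p) :
    ContDiffAt ℝ ∞ (fun q => coefU c (E q) (dU E q) (H q) (Q q)) p := by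
  have h1 := contDiffAt_dU_div hE h0
  have h2 := hQ.div hE h0
  refine contDiffAt_pi.2 fun i => contDiffAt_pi.2 fun j => ?_
  fin_cases i <;> fin_cases j <;> simp [coefU] <;> first
    | exact contDiffAt_const | exact h1 | exact hQ | exact (contDiffAt_const.mul hE).neg
    | exact hH.mul hE | exact hH.neg | exact h2.neg

theorem contDiffAt_coefV (hE : ContDiffAt ℝ ∞ E p) (h0 : E p ≠ 0) (hH : ContDiffAt ℝ ∞ H p)
    (hR : ContDiffAt ℝ ∞ R p) :
    ContDiffAt ℝ ∞ (fun q => coefV c (E q) (dV E q) (H q) (R q)) p := by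
  have h1 := contDiffAt_dV_div hE h0
  have h2 := hR.div hE h0
  refine contDiffAt_pi.2 fun i => contDiffAt_pi.2 fun j => ?_
  fin_cases i <;> fin_cases j <;> simp [coefV] <;> first
    | exact contDiffAt_const | exact h1 | exact hR | exact (contDiffAt_const.mul hE).neg
    | exact hH.mul hE | exact hH.neg | exact h2.neg

theorem eventually_eq_of_partial_eq_zero {Z : Type*} [NormedAddCommGroup Z] [NormedSpace ℝ Z]
    {z : ℝ × ℝ → Z} {p : ℝ × ℝ}
    (h : ∀ᶠ q in 𝓝 p, DifferentiableAt ℝ z q ∧ dU z q = 0 ∧ dV z q = 0) :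
    ∀ᶠ q in 𝓝 p, z q = z p := by
  have := eventually_eq_zero_of_norm_partial_le (z := fun q => z q - z p) (p := p) (C := 0) (by
    filter_upwards [h] with q hq
    refine ⟨hq.1.sub_const _, ?_, ?_⟩
    · rw [dU_sub hq.1 (differentiableAt_const _), dU_const, hq.2.1]; simp
    · rw [dV_sub hq.1 (differentiableAt_const _), dV_const, hq.2.2]; simp) (sub_self _)
  filter_upwards [this] with q hq using sub_eq_zero.1 hq

end Existence

section Existence

variable {c : SignType} {E H Q R : ℝ × ℝ → ℝ} {p : ℝ × ℝ}

theorem normalSq_mul_cast_sq (c : SignType) : normalSq c * (c : ℝ) ^ 2 = c := by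
  cases c <;> simp [normalSq]

theorem gram_entries {c : SignType} {E : ℝ} {n a b m : Fin 4 → ℝ}
    (h : Matrix.of ![n, a, b, m] * diagonal (signature c) * (Matrix.of ![n, a, b, m])ᵀ =
      frameGram c E) (i j : Fin 4) :
    scalarProd c (![n, a, b, m] i) (![n, a, b, m] j) = frameGram c E i j := by
  rw [← h, scalarProd_gram]
  rfl

/-- Solutions of the structure equations keep the scalar products of the frame. -/
theorem eventually_gram_of_structure {x : Fin 5 → ℝ × ℝ → Fin 4 → ℝ}
    (hE : ContDiffAt ℝ ∞ E p) (hpos : ∀ᶠ q in 𝓝 p, 0 < E q)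
    (hx : ∀ᶠ q in 𝓝 p, ∀ i, ContDiffAt ℝ ∞ (x i) q ∧
      dU (x i) q = ∑ k, coefU c (E q) (dU E q) (H q) (Q q) i k • x k q ∧
      dV (x i) q = ∑ k, coefV c (E q) (dV E q) (H q) (R q) i k • x k q)
    (h0 : Matrix.of ![x 0 p, x 1 p, x 2 p, x 3 p] * diagonal (signature c) *
      (Matrix.of ![x 0 p, x 1 p, x 2 p, x 3 p])ᵀ = frameGram c (E p)) :
    ∀ᶠ q in 𝓝 p, Matrix.of ![x 0 q, x 1 q, x 2 q, x 3 q] * diagonal (signature c) *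
      (Matrix.of ![x 0 q, x 1 q, x 2 q, x 3 q])ᵀ = frameGram c (E q) := by
  have hD := diagonal_signature_mul_self c
  -- The entries of `Pᵀ G⁻¹ P` are first integrals of the system: both derivatives vanish.
  have key : ∀ k l : Fin 4, ∀ᶠ q in 𝓝 p,
      normalSq c * x 0 q k * x 0 q l + (x 1 q k * x 2 q l + x 2 q k * x 1 q l) / E q +
        x 3 q k * x 3 q l =
      normalSq c * x 0 p k * x 0 p l + (x 1 p k * x 2 p l + x 2 p k * x 1 p l) / E p +
        x 3 p k * x 3 p l := by
    intro k l
    refine eventually_eq_of_partial_eq_zero (z := fun q =>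
      normalSq c * x 0 q k * x 0 q l + (x 1 q k * x 2 q l + x 2 q k * x 1 q l) / E q +
        x 3 q k * x 3 q l) ?_
    filter_upwards [hx, hE.eventually_diff, hpos] with q hq dE hp
    have d : ∀ i j, DifferentiableAt ℝ (fun r => x i r j) q := fun i j =>
      differentiableAt_pi.1 (hq i).1.diff j
    have eU : ∀ i j, dU (fun r => x i r j) q =
        ∑ k, coefU c (E q) (dU E q) (H q) (Q q) i k * x k q j := fun i j => by
      rw [← dU_pi (hq i).1.diff, (hq i).2.1]; simp
    have eV : ∀ i j, dV (fun r => x i r j) q =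
        ∑ k, coefV c (E q) (dV E q) (H q) (R q) i k * x k q j := fun i j => by
      rw [← dV_pi (hq i).1.diff, (hq i).2.2]; simp
    have d1 : DifferentiableAt ℝ (fun r => x 1 r k * x 2 r l) q := (d 1 k).fun_mul (d 2 l)
    have d2 : DifferentiableAt ℝ (fun r => x 2 r k * x 1 r l) q := (d 2 k).fun_mul (d 1 l)
    have d3 : DifferentiableAt ℝ (fun r => (x 1 r k * x 2 r l + x 2 r k * x 1 r l) / E r) q :=
      by simpa only [div_eq_mul_inv] using (d1.fun_add d2).fun_mul (dE.fun_inv hp.ne')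
    have d4 : DifferentiableAt ℝ (fun r => normalSq c * x 0 r k) q := (d 0 k).const_mul _
    have d5 : DifferentiableAt ℝ (fun r => normalSq c * x 0 r k * x 0 r l) q := d4.fun_mul (d 0 l)
    have d6 : DifferentiableAt ℝ (fun r => x 3 r k * x 3 r l) q := (d 3 k).fun_mul (d 3 l)
    have hn := normalSq_mul_cast_sq c
    have hp' := hp.ne'
    refine ⟨(d5.fun_add d3).fun_add d6, ?_, ?_⟩
    · rw [dU_add (d5.fun_add d3) d6, dU_add d5 d3, dU_mul d4 (d 0 l),
        dU_mul (differentiableAt_const _) (d 0 k), dU_const, dU_div (d1.fun_add d2) dE hp',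
        dU_add d1 d2, dU_mul (d 1 k) (d 2 l), dU_mul (d 2 k) (d 1 l), dU_mul (d 3 k) (d 3 l)]
      simp only [eU, Fin.sum_univ_five]
      simp [coefU]
      field_simp
      linear_combination E q ^ 2 * (x 0 q l * x 1 q k + x 0 q k * x 1 q l) * hn
    · rw [dV_add (d5.fun_add d3) d6, dV_add d5 d3, dV_mul d4 (d 0 l),
        dV_mul (differentiableAt_const _) (d 0 k), dV_const, dV_div (d1.fun_add d2) dE hp',
        dV_add d1 d2, dV_mul (d 1 k) (d 2 l), dV_mul (d 2 k) (d 1 l), dV_mul (d 3 k) (d 3 l)]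
      simp only [eV, Fin.sum_univ_five]
      simp [coefV]
      field_simp
      linear_combination E q ^ 2 * (x 0 q l * x 2 q k + x 0 q k * x 2 q l) * hn
  have key' := Filter.eventually_all.2 fun k => Filter.eventually_all.2 (key k)
  have hc0 := (gram_iff_cogram hD (frameGram_mul_inv c hpos.self_of_nhds.ne')).1 h0
  filter_upwards [key', hpos] with q hq hp
  refine (gram_iff_cogram hD (frameGram_mul_inv c hp.ne')).2 ?_
  rw [← hc0]
  ext k l
  rw [cogram_apply, cogram_apply, hq]

/-- The fundamental theorem of surface theory, local form: existence. -/
theorem exists_local_frame (hE : ∀ᶠ q in 𝓝 p, ContDiffAt ℝ ∞ E q) (hpos : 0 < E p)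
    (hH : ∀ᶠ q in 𝓝 p, ContDiffAt ℝ ∞ H q) (hQ : ∀ᶠ q in 𝓝 p, ContDiffAt ℝ ∞ Q q)
    (hR : ∀ᶠ q in 𝓝 p, ContDiffAt ℝ ∞ R q)
    (hGC : ∀ᶠ q in 𝓝 p, GaussCodazziAt c E H Q R q) :
    ∃ F N : ℝ × ℝ → Fin 4 → ℝ, ∀ᶠ q in 𝓝 p, FrameAt c (E q) (H q) (Q q) (R q) F N q := by
  have hpos' : ∀ᶠ q in 𝓝 p, 0 < E q :=
    hE.self_of_nhds.continuousAt.eventually (lt_mem_nhds hpos)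
  obtain ⟨n, a, b, m, Y, hdet, hgram, hY, hn⟩ := exists_initial_frame c hpos
  obtain ⟨x, hx0, hx⟩ := exists_solution_system (p := p) (W := Fin 4 → ℝ)
    (A := fun q => coefU c (E q) (dU E q) (H q) (Q q))
    (B := fun q => coefV c (E q) (dV E q) (H q) (R q))
    (by filter_upwards [hE, hpos', hH, hQ] with q h1 h2 h3 h4 using
          contDiffAt_coefU h1 h2.ne' h3 h4)
    (by filter_upwards [hE, hpos', hH, hR] with q h1 h2 h3 h4 using
          contDiffAt_coefV h1 h2.ne' h3 h4)
    (by filter_upwards [hE, hpos', hH, hQ, hR, hGC] with q h1 h2 h3 h4 h5 h6 using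
          coef_flat h6 h1 h2.ne' h3 h4 h5) ![n, a, b, m, Y]
  have i0 : x 0 p = n := hx0 0
  have i1 : x 1 p = a := hx0 1
  have i2 : x 2 p = b := hx0 2
  have i3 : x 3 p = m := hx0 3
  have i4 : x 4 p = Y := hx0 4
  have hgram' := eventually_gram_of_structure hE.self_of_nhds hpos' hx
    (by rw [i0, i1, i2, i3]; exact hgram)
  have hdet' : ∀ᶠ q in 𝓝 p, 0 < (Matrix.of ![x 0 q, x 1 q, x 2 q, x 3 q]).det := by
    have hc := fun i => (hx.self_of_nhds i).1.continuousAt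
    have : ContinuousAt (fun q => (Matrix.of ![x 0 q, x 1 q, x 2 q, x 3 q]).det) p := by
      refine (Continuous.matrix_det continuous_id).continuousAt.comp (x := p)
        (f := fun q => Matrix.of ![x 0 q, x 1 q, x 2 q, x 3 q]) ?_
      refine continuousAt_pi.2 fun i => ?_
      fin_cases i
      exacts [hc 0, hc 1, hc 2, hc 3]
    refine this.eventually (lt_mem_nhds ?_)
    simpa only [i0, i1, i2, i3] using hdet
  have eU : ∀ᶠ q in 𝓝 p, dU (x 0) q = (c : ℝ) ^ 2 • x 1 q ∧ dU (x 4) q = x 1 q ∧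
      dU (x 3) q = -H q • x 1 q + -(Q q / E q) • x 2 q := by
    filter_upwards [hx] with q hq
    have h0 := (hq 0).2.1
    have h3 := (hq 3).2.1
    have h4 := (hq 4).2.1
    simp only [coefU, Fin.sum_univ_five] at h0 h3 h4
    exact ⟨by simpa using h0, by simpa using h4, by simpa using h3⟩
  have eV : ∀ᶠ q in 𝓝 p, dV (x 0) q = (c : ℝ) ^ 2 • x 2 q ∧ dV (x 4) q = x 2 q ∧
      dV (x 3) q = -(R q / E q) • x 1 q + -H q • x 2 q := by
    filter_upwards [hx] with q hq
    have h0 := (hq 0).2.2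
    have h3 := (hq 3).2.2
    have h4 := (hq 4).2.2
    simp only [coefV, Fin.sum_univ_five] at h0 h3 h4
    exact ⟨by simpa using h0, by simpa using h4, by simpa using h3⟩
  have hd : ∀ᶠ q in 𝓝 p, ∀ i, DifferentiableAt ℝ (x i) q := hx.mono fun q hq i => (hq i).1.diff
  -- The linear system treats `n` and `F` as independent unknowns. For `c = 0` the solution `n` is
  -- constant, and for `c ≠ 0` the difference `F - n` is constant, so the relation between them
  -- persists from the initial point.
  have hnF : ∀ᶠ q in 𝓝 p, ambientNormal c (x 4 q) = x 0 q := by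
    by_cases hc : c = 0
    · subst hc
      have := eventually_eq_of_partial_eq_zero (z := x 0) (p := p) (by
        filter_upwards [hd, eU, eV] with q h1 h2 h3
        exact ⟨h1 0, by simp [h2.1], by simp [h3.1]⟩)
      filter_upwards [this] with q hq
      rw [ambientNormal_zero, hq, i0, (hn rfl).1]
    · have := eventually_eq_of_partial_eq_zero (z := fun q => x 4 q - x 0 q) (p := p) (by
        filter_upwards [hd, eU, eV] with q h1 h2 h3
        refine ⟨(h1 4).fun_sub (h1 0), ?_, ?_⟩
        · rw [dU_sub (h1 4) (h1 0), h2.1, h2.2.1, cast_sq_of_ne_zero hc]; simp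
        · rw [dV_sub (h1 4) (h1 0), h3.1, h3.2.1, cast_sq_of_ne_zero hc]; simp)
      filter_upwards [this] with q hq
      rw [i4, i0, hY hc, sub_self] at hq
      rw [ambientNormal_of_ne_zero hc, sub_eq_zero.1 hq]
  -- For `c = 0` the coordinate `0` of `F` is constant because `F_u` and `F_v` are orthogonal to
  -- `n`; for `c ≠ 0` the value of `⟨n, n⟩` is the equation of the quadric.
  have hmem : ∀ᶠ q in 𝓝 p, x 4 q ∈ spaceForm c := by
    by_cases hc : c = 0
    · subst hc
      have := eventually_eq_of_partial_eq_zero (z := fun q => x 4 q 0) (p := p) (by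
        filter_upwards [hd, eU, eV, hgram', hnF] with q h1 h2 h3 h4 h5
        have g1 := gram_entries h4 1 0
        have g2 := gram_entries h4 2 0
        simp only [cons_val_one, cons_val_zero, cons_val, ← h5, ambientNormal_zero,
          scalarProd_zero_single] at g1 g2
        refine ⟨differentiableAt_pi.1 (h1 4) 0, ?_, ?_⟩
        · rw [← dU_pi (h1 4), h2.2.1]
          simpa [frameGram] using g1
        · rw [← dV_pi (h1 4), h3.2.1]
          simpa [frameGram] using g2)
      filter_upwards [this] with q hq
      rw [i4, (hn rfl).2] at hq
      exact hq
    · filter_upwards [hgram', hnF] with q h4 h5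
      have g0 := gram_entries h4 0 0
      simp only [cons_val_zero, ← h5, ambientNormal_of_ne_zero hc] at g0
      rw [spaceForm_of_ne_zero hc]
      refine g0.trans ?_
      have := normalSq_mul_cast_sq c
      rw [cast_sq_of_ne_zero hc, mul_one] at this
      simpa [frameGram] using this
  refine ⟨x 4, x 3, ?_⟩
  filter_upwards [hx, hgram', hdet', eU, eV, hnF, hmem, hpos'] with q h1 h2 h3 h4 h5 h6 h7 h8
  have g := gram_entries h2
  have g10 := g 1 0
  have g11 := g 1 1
  have g12 := g 1 2
  have g13 := g 1 3
  have g21 := g 2 1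
  have g22 := g 2 2
  have g23 := g 2 3
  have g33 := g 3 3
  have g30 := g 3 0
  simp [frameGram] at g10 g11 g12 g13 g21 g22 g23 g33 g30
  have hE0 := h8.ne'
  exact
    { smooth_F := (h1 4).1
      smooth_N := (h1 3).1
      mem := h7
      uu := by rw [h4.2.1, g11]
      vv := by rw [h5.2.1, g22]
      uv := by rw [h4.2.1, h5.2.1, g12]
      pos := h8
      NN := g33
      Nn := by rw [h6, g30]
      uN := by rw [h4.2.1, g13]
      vN := by rw [h5.2.1, g23]
      det := by rw [h6, h4.2.1, h5.2.1]; exact h3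
      uNu := by
        rw [h4.2.1, h4.2.2, scalarProd_add_right, scalarProd_smul_right, scalarProd_smul_right,
          g11, g12]
        field_simp
        ring
      uNv := by
        rw [h4.2.1, h5.2.2, scalarProd_add_right, scalarProd_smul_right, scalarProd_smul_right,
          g11, g12]
        ring
      vNu := by
        rw [h5.2.1, h4.2.2, scalarProd_add_right, scalarProd_smul_right, scalarProd_smul_right,
          g21, g22]
        ring
      vNv := by
        rw [h5.2.1, h5.2.2, scalarProd_add_right, scalarProd_smul_right, scalarProd_smul_right,
          g21, g22]
        field_simp
        ring }

end Existence

/-! ### Uniqueness of immersions up to proper isometries -/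

section Uniqueness

variable {c : SignType} {F N : ℝ × ℝ → Fin 4 → ℝ} {p : ℝ × ℝ}

theorem FrameAt.gram {E H Q R : ℝ} (h : FrameAt c E H Q R F N p)
    (hm : ∀ᶠ q in 𝓝 p, F q ∈ spaceForm c) :
    Matrix.of ![ambientNormal c (F p), dU F p, dV F p, N p] * diagonal (signature c) *
      (Matrix.of ![ambientNormal c (F p), dU F p, dV F p, N p])ᵀ = frameGram c E := by
  have an : scalarProd c (dU F p) (ambientNormal c (F p)) = 0 :=
    scalarProd_fderiv_ambientNormal h.smooth_F.diff hm _
  have bn : scalarProd c (dV F p) (ambientNormal c (F p)) = 0 :=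
    scalarProd_fderiv_ambientNormal h.smooth_F.diff hm _
  have na := scalarProd_comm c _ _ ▸ an
  have nb := scalarProd_comm c _ _ ▸ bn
  have ba := scalarProd_comm c _ _ ▸ h.uv
  have Na := scalarProd_comm c _ _ ▸ h.uN
  have Nb := scalarProd_comm c _ _ ▸ h.vN
  have nN := scalarProd_comm c _ _ ▸ h.Nn
  ext i j
  rw [scalarProd_gram]
  fin_cases i <;> fin_cases j
  exacts [h.nn, na, nb, nN, an, h.uu, h.uv, h.uN, bn, ba, h.vv, h.vN, h.Nn, Na, Nb, h.NN]

theorem mulVec_row_of_mul_transpose {A P P' : Matrix (Fin 4) (Fin 4) ℝ} (h : A * Pᵀ = P'ᵀ)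
    (i : Fin 4) : A *ᵥ P i = P' i := by
  have := congrArg (fun M => Mᵀ i) h
  simp only [transpose_transpose] at this
  rw [← this]
  funext k
  simp [Matrix.mul_apply, mulVec, dotProduct]

/-- The linear map that carries one frame to the other preserves the scalar product because the Gram
matrices agree, and the orientation because both determinants are positive. -/
theorem exists_preservesProd_of_gram_eq {P P' G : Matrix (Fin 4) (Fin 4) ℝ} (hP : 0 < P.det)
    (hP' : 0 < P'.det) (h : P * diagonal (signature c) * Pᵀ = G)
    (h' : P' * diagonal (signature c) * P'ᵀ = G) :
    ∃ A, PreservesProd c A ∧ 0 < A.det ∧ ∀ i, A *ᵥ P i = P' i := by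
  have hu : IsUnit Pᵀ.det := by rw [det_transpose]; exact hP.ne'.isUnit
  have hu' : IsUnit P.det := hP.ne'.isUnit
  set A := P'ᵀ * (Pᵀ)⁻¹ with hA
  have hAP : A * Pᵀ = P'ᵀ := by rw [hA, Matrix.mul_assoc, nonsing_inv_mul _ hu, Matrix.mul_one]
  have hP'e : P' = P * Aᵀ := by
    have := congrArg transpose hAP
    rw [transpose_mul, transpose_transpose, transpose_transpose] at this
    exact this.symm
  clear_value A
  refine ⟨A, ?_, ?_, mulVec_row_of_mul_transpose hAP⟩
  · rw [preservesProd_iff]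
    have e : P * (Aᵀ * diagonal (signature c) * A) * Pᵀ = P * diagonal (signature c) * Pᵀ := by
      rw [h, ← h', hP'e, transpose_mul, transpose_transpose]
      simp only [Matrix.mul_assoc]
    have e1 := congrArg (fun M => P⁻¹ * M * (Pᵀ)⁻¹) e
    simpa only [Matrix.mul_assoc, nonsing_inv_mul_cancel_left _ _ hu', mul_nonsing_inv _ hu,
      Matrix.mul_one] using e1
  · have := congrArg det hAP
    rw [det_mul, det_transpose, det_transpose] at this
    by_contra hneg
    nlinarith [mul_nonneg (sub_nonneg.2 (not_lt.1 hneg)) hP.le]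

theorem dU_affine (A : Matrix (Fin 4) (Fin 4) ℝ) (b : Fin 4 → ℝ) (hF : DifferentiableAt ℝ F p) :
    dU (fun q => A *ᵥ F q + b) p = A *ᵥ dU F p := by
  have h : DifferentiableAt ℝ (fun q => A *ᵥ F q) p :=
    (LinearMap.toContinuousLinearMap A.mulVecLin).differentiableAt.comp p hF
  rw [dU_add h (differentiableAt_const _), dU_const, add_zero]
  exact dU_clm (LinearMap.toContinuousLinearMap A.mulVecLin) hF

theorem dV_affine (A : Matrix (Fin 4) (Fin 4) ℝ) (b : Fin 4 → ℝ) (hF : DifferentiableAt ℝ F p) :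
    dV (fun q => A *ᵥ F q + b) p = A *ᵥ dV F p := by
  have h : DifferentiableAt ℝ (fun q => A *ᵥ F q) p :=
    (LinearMap.toContinuousLinearMap A.mulVecLin).differentiableAt.comp p hF
  rw [dV_add h (differentiableAt_const _), dV_const, add_zero]
  exact dV_clm (LinearMap.toContinuousLinearMap A.mulVecLin) hF

theorem dU_mulVec (A : Matrix (Fin 4) (Fin 4) ℝ) (hF : DifferentiableAt ℝ F p) :
    dU (fun q => A *ᵥ F q) p = A *ᵥ dU F p :=
  dU_clm (LinearMap.toContinuousLinearMap A.mulVecLin) hF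

theorem dV_mulVec (A : Matrix (Fin 4) (Fin 4) ℝ) (hF : DifferentiableAt ℝ F p) :
    dV (fun q => A *ᵥ F q) p = A *ᵥ dV F p :=
  dV_clm (LinearMap.toContinuousLinearMap A.mulVecLin) hF

theorem contDiffAt_mulVec (A : Matrix (Fin 4) (Fin 4) ℝ) (hF : ContDiffAt ℝ ∞ F p) :
    ContDiffAt ℝ ∞ (fun q => A *ᵥ F q) p :=
  (LinearMap.toContinuousLinearMap A.mulVecLin).contDiff.contDiffAt.comp p hF

theorem ambientNormal_affine {T : Matrix (Fin 4) (Fin 4) ℝ × (Fin 4 → ℝ)}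
    (hT : T ∈ properIsometries c) (x : Fin 4 → ℝ) :
    ambientNormal c (T.1 *ᵥ x + T.2) = T.1 *ᵥ ambientNormal c x := by
  by_cases hc : c = 0
  · subst hc
    rw [ambientNormal_zero, ambientNormal_zero, (hT.2.2.1 rfl).1]
  · rw [ambientNormal_of_ne_zero hc, ambientNormal_of_ne_zero hc, hT.2.2.2 hc, add_zero]

theorem of_mulVec_rows (A : Matrix (Fin 4) (Fin 4) ℝ) (n a b m : Fin 4 → ℝ) :
    Matrix.of ![A *ᵥ n, A *ᵥ a, A *ᵥ b, A *ᵥ m] = Matrix.of ![n, a, b, m] * Aᵀ := by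
  ext i j
  fin_cases i <;> simp [Matrix.mul_apply, mulVec, dotProduct, mul_comm]

/-- Proper isometries preserve the conditions on conformal timelike immersions. -/
theorem FrameAt.affine {E H Q R : ℝ} (h : FrameAt c E H Q R F N p)
    {T : Matrix (Fin 4) (Fin 4) ℝ × (Fin 4 → ℝ)} (hT : T ∈ properIsometries c) :
    FrameAt c E H Q R (fun q => T.1 *ᵥ F q + T.2) (fun q => T.1 *ᵥ N q) p := by
  have dF := h.smooth_F.diff
  have dN := h.smooth_N.diff
  have hp := hT.1
  have u1 := dU_affine T.1 T.2 dF
  have v1 := dV_affine T.1 T.2 dF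
  have u2 := dU_mulVec T.1 dN
  have v2 := dV_mulVec T.1 dN
  have hn := ambientNormal_affine hT (F p)
  exact
    { smooth_F := (contDiffAt_mulVec T.1 h.smooth_F).add contDiffAt_const
      smooth_N := contDiffAt_mulVec T.1 h.smooth_N
      mem := ((properIsometries_subset c hT).2 _).2 h.mem
      uu := by rw [u1, hp, h.uu]
      vv := by rw [v1, hp, h.vv]
      uv := by rw [u1, v1, hp, h.uv]
      pos := h.pos
      NN := by rw [hp, h.NN]
      Nn := by rw [hn, hp, h.Nn]
      uN := by rw [u1, hp, h.uN]
      vN := by rw [v1, hp, h.vN]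
      det := by
        rw [hn, u1, v1, of_mulVec_rows, det_mul, det_transpose]
        exact mul_pos h.det hT.2.1
      uNu := by rw [u1, u2, hp, h.uNu]
      uNv := by rw [u1, v2, hp, h.uNv]
      vNu := by rw [v1, u2, hp, h.vNu]
      vNv := by rw [v1, v2, hp, h.vNv] }

variable {E H Q R : ℝ × ℝ → ℝ} {F' N' : ℝ × ℝ → Fin 4 → ℝ}

/-- The fundamental theorem of surface theory, local form: uniqueness. -/
theorem exists_isometry_of_frame (h : ∀ᶠ q in 𝓝 p, FrameAt c (E q) (H q) (Q q) (R q) F N q)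
    (h' : ∀ᶠ q in 𝓝 p, FrameAt c (E q) (H q) (Q q) (R q) F' N' q) :
    ∃ T ∈ properIsometries c, ∀ᶠ q in 𝓝 p, F' q = T.1 *ᵥ F q + T.2 ∧ N' q = T.1 *ᵥ N q := by
  have h0 := h.self_of_nhds
  have h0' := h'.self_of_nhds
  obtain ⟨A, hA, hAdet, hAP⟩ := exists_preservesProd_of_gram_eq h0.det h0'.det
    (h0.gram (h.mono fun q hq => hq.mem)) (h0'.gram (h'.mono fun q hq => hq.mem))
  have hA0 : A *ᵥ ambientNormal c (F p) = ambientNormal c (F' p) := hAP 0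
  have hA1 : A *ᵥ dU F p = dU F' p := hAP 1
  have hA2 : A *ᵥ dV F p = dV F' p := hAP 2
  have hA3 : A *ᵥ N p = N' p := hAP 3
  -- The translation that matches the base points is parallel to the hyperplane for `c = 0`. For `c
  -- ≠ 0` it vanishes, since the base points are themselves frame vectors.
  have hT : (A, F' p - A *ᵥ F p) ∈ properIsometries c := by
    refine ⟨hA, hAdet, fun hc => ?_, fun hc => ?_⟩
    · subst hc
      rw [ambientNormal_zero, ambientNormal_zero] at hA0
      refine ⟨hA0, ?_⟩
      have h1 : F p 0 = 0 := h0.mem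
      have h2 : F' p 0 = 0 := h0'.mem
      have h3 := hA (F p) (Pi.single 0 1)
      rw [hA0, scalarProd_zero_single, scalarProd_zero_single, h1] at h3
      simp only [Pi.sub_apply, h2]
      linarith
    · rw [ambientNormal_of_ne_zero hc, ambientNormal_of_ne_zero hc] at hA0
      simp [hA0]
  refine ⟨_, hT, ?_⟩
  have hh := (h.mono fun q hq => hq.affine hT)
  -- The tuples of `F'` and of the moved `F` solve the same linear system; their difference solves
  -- it too and vanishes at `p`.
  have hz := eventually_eq_zero_of_system (p := p)
    (A := fun q => coefU c (E q) (dU E q) (H q) (Q q))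
    (B := fun q => coefV c (E q) (dV E q) (H q) (R q))
    (x := fun i q => frameTuple c F' N' i q -
      frameTuple c (fun q => A *ᵥ F q + (F' p - A *ᵥ F p)) (fun q => A *ᵥ N q) i q)
    (contDiffAt_coefU (contDiffAt_E h) h0.pos.ne' (contDiffAt_H h) (contDiffAt_Q h)).continuousAt
    (contDiffAt_coefV (contDiffAt_E h) h0.pos.ne' (contDiffAt_H h) (contDiffAt_R h)).continuousAt
    (by
      have hd : ∀ {F N : ℝ × ℝ → Fin 4 → ℝ} {q}, FrameAt c (E q) (H q) (Q q) (R q) F N q →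
          ∀ i, DifferentiableAt ℝ (frameTuple c F N i) q := by
        intro F N q hq i
        fin_cases i
        exacts [(contDiffAt_ambientNormal hq.smooth_F).diff, (contDiffAt_dU hq.smooth_F).diff,
          (contDiffAt_dV hq.smooth_F).diff, hq.smooth_N.diff, hq.smooth_F.diff]
      filter_upwards [hh.eventually_nhds, h'.eventually_nhds] with q h1 h2 i
      have d1 := hd h1.self_of_nhds i
      have d2 := hd h2.self_of_nhds i
      refine ⟨d2.fun_sub d1, ?_, ?_⟩
      · rw [dU_sub d2 d1, (structure_equations h1 i).1, (structure_equations h2 i).1,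
          ← Finset.sum_sub_distrib]
        simp only [smul_sub]
      · rw [dV_sub d2 d1, (structure_equations h1 i).2, (structure_equations h2 i).2,
          ← Finset.sum_sub_distrib]
        simp only [smul_sub])
    (by
      intro i
      rw [sub_eq_zero]
      fin_cases i
      · exact hA0.symm.trans (ambientNormal_affine hT (F p)).symm
      · exact hA1.symm.trans (dU_affine A _ h0.smooth_F.diff).symm
      · exact hA2.symm.trans (dV_affine A _ h0.smooth_F.diff).symm
      · exact hA3.symm
      · exact (add_sub_cancel (A *ᵥ F p) (F' p)).symm)
  filter_upwards [hz] with q hq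
  exact ⟨sub_eq_zero.1 (hq 4), sub_eq_zero.1 (hq 3)⟩

/-- A proper isometry is determined by its action on a germ of an immersion. -/
theorem isometry_eq_of_frame {E H Q R : ℝ} (h : FrameAt c E H Q R F N p)
    {T T' : Matrix (Fin 4) (Fin 4) ℝ × (Fin 4 → ℝ)} (hT : T ∈ properIsometries c)
    (hT' : T' ∈ properIsometries c)
    (he : ∀ᶠ q in 𝓝 p, T.1 *ᵥ F q + T.2 = T'.1 *ᵥ F q + T'.2 ∧ T.1 *ᵥ N q = T'.1 *ᵥ N q) :
    T = T' := by
  have dF := h.smooth_F.diff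
  have e0 := he.self_of_nhds
  have e1 : (fun q => T.1 *ᵥ F q + T.2) =ᶠ[𝓝 p] fun q => T'.1 *ᵥ F q + T'.2 :=
    he.mono fun q hq => hq.1
  have ea := dU_congr e1
  have eb := dV_congr e1
  rw [dU_affine T.1 T.2 dF, dU_affine T'.1 T'.2 dF] at ea
  rw [dV_affine T.1 T.2 dF, dV_affine T'.1 T'.2 dF] at eb
  have en : T.1 *ᵥ ambientNormal c (F p) = T'.1 *ᵥ ambientNormal c (F p) := by
    rw [← ambientNormal_affine hT, ← ambientNormal_affine hT', e0.1]
  have hP : Matrix.of ![ambientNormal c (F p), dU F p, dV F p, N p] * T.1ᵀ =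
      Matrix.of ![ambientNormal c (F p), dU F p, dV F p, N p] * T'.1ᵀ := by
    rw [← of_mulVec_rows, ← of_mulVec_rows, en, ea, eb, e0.2]
  have h1 : T.1 = T'.1 := by
    have hu := h.det.ne'.isUnit
    have := congrArg (fun M => (Matrix.of ![ambientNormal c (F p), dU F p, dV F p, N p])⁻¹ * M) hP
    simp only [nonsing_inv_mul_cancel_left _ _ hu] at this
    exact transpose_injective this
  refine Prod.ext h1 ?_
  have := e0.1
  rw [h1] at this
  exact add_left_cancel this

end Uniqueness

/-! ### Change of null coordinates -/

section ChartChange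

variable {c : SignType} {F N F' N' : ℝ × ℝ → Fin 4 → ℝ} {p : ℝ × ℝ} {E H Q R : ℝ}

theorem FrameAt.congr (h : FrameAt c E H Q R F N p) (hF : F' =ᶠ[𝓝 p] F) (hN : N' =ᶠ[𝓝 p] N) :
    FrameAt c E H Q R F' N' p := by
  obtain ⟨h1, h2, h3, h4, h5, h6, h7, h8, h9, h10, h11, h12, h13, h14, h15, h16⟩ := h
  rw [← dU_congr hF] at h4 h6 h10 h12 h13 h14
  rw [← dV_congr hF] at h5 h6 h11 h12 h15 h16
  rw [← dU_congr hN] at h13 h15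
  rw [← dV_congr hN] at h14 h16
  rw [← hF.eq_of_nhds] at h3 h9 h12
  rw [← hN.eq_of_nhds] at h8 h9 h10 h11 h12
  exact ⟨h1.congr_of_eventuallyEq hF, h2.congr_of_eventuallyEq hN, h3, h4, h5, h6, h7, h8, h9, h10,
    h11, h12, h13, h14, h15, h16⟩

theorem dU_comp_nullMap {Z : Type*} [NormedAddCommGroup Z] [NormedSpace ℝ Z] {z : ℝ × ℝ → Z}
    {h : ℝ × ℝ → ℝ × ℝ} (hh : DifferentiableAt ℝ h p) (hz : DifferentiableAt ℝ z (h p))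
    (h0 : (dU h p).2 = 0) : dU (z ∘ h) p = (dU h p).1 • dU z (h p) := by
  have e : dU (z ∘ h) p = fderiv ℝ z (h p) (dU h p) := by
    simp only [dU, fderiv_comp p hz hh]; rfl
  rw [e, fderiv_apply_eq, h0, zero_smul, add_zero]

theorem dV_comp_nullMap {Z : Type*} [NormedAddCommGroup Z] [NormedSpace ℝ Z] {z : ℝ × ℝ → Z}
    {h : ℝ × ℝ → ℝ × ℝ} (hh : DifferentiableAt ℝ h p) (hz : DifferentiableAt ℝ z (h p))
    (h0 : (dV h p).1 = 0) : dV (z ∘ h) p = (dV h p).2 • dV z (h p) := by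
  have e : dV (z ∘ h) p = fderiv ℝ z (h p) (dV h p) := by
    simp only [dV, fderiv_comp p hz hh]; rfl
  rw [e, fderiv_apply_eq, h0, zero_smul, zero_add]

theorem of_smul_rows (n a b m : Fin 4 → ℝ) (r s : ℝ) :
    Matrix.of ![n, r • a, s • b, m] = diagonal ![1, r, s, 1] * Matrix.of ![n, a, b, m] := by
  ext i j
  rw [diagonal_mul]
  fin_cases i <;> simp

/-- The data of a conformal timelike immersion in another null coordinate system. -/
theorem FrameAt.comp_nullMap {h : ℝ × ℝ → ℝ × ℝ} (hh : ContDiffAt ℝ ∞ h p) (hu : (dU h p).2 = 0)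
    (hv : (dV h p).1 = 0) (hpos : 0 < (dU h p).1 * (dV h p).2)
    (hF : FrameAt c E H Q R F N (h p)) :
    FrameAt c ((dU h p).1 * (dV h p).2 * E) H ((dU h p).1 ^ 2 * Q) ((dV h p).2 ^ 2 * R)
      (F ∘ h) (N ∘ h) p := by
  have u1 := dU_comp_nullMap hh.diff hF.smooth_F.diff hu
  have u2 := dU_comp_nullMap hh.diff hF.smooth_N.diff hu
  have v1 := dV_comp_nullMap hh.diff hF.smooth_F.diff hv
  have v2 := dV_comp_nullMap hh.diff hF.smooth_N.diff hv
  constructor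
  case smooth_F => exact hF.smooth_F.comp p hh
  case smooth_N => exact hF.smooth_N.comp p hh
  case mem => exact hF.mem
  case pos => exact mul_pos hpos hF.pos
  case NN => exact hF.NN
  case Nn => exact hF.Nn
  case det =>
    rw [u1, v1, Function.comp_apply, Function.comp_apply, of_smul_rows, det_mul, det_diagonal]
    refine mul_pos ?_ hF.det
    simpa [Fin.prod_univ_four] using hpos
  all_goals
    simp only [u1, u2, v1, v2, Function.comp_apply, scalarProd_smul_left, scalarProd_smul_right,
      hF.uu, hF.vv, hF.uv, hF.uN, hF.vN, hF.uNu, hF.uNv, hF.vNu, hF.vNv]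
    ring

end ChartChange

/-! ### Null charts and smoothness on the surface -/

section Atlas

variable {M : Type*} [TopologicalSpace M] [ChartedSpace (ℝ × ℝ) M]

theorem nullGroupoid_le : nullGroupoid ≤ contDiffGroupoid ∞ 𝓘(ℝ, ℝ × ℝ) := by
  intro e he
  have he' := (mem_groupoid_of_pregroupoid).1 he
  refine (mem_groupoid_of_pregroupoid).2 ⟨?_, ?_⟩
  · simpa [contDiffPregroupoid] using he'.1.1
  · simpa [contDiffPregroupoid] using he'.2.1

theorem nullCharts_subset : nullCharts M ⊆ IsManifold.maximalAtlas 𝓘(ℝ, ℝ × ℝ) ∞ M :=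
  StructureGroupoid.maximalAtlas_mono nullGroupoid_le

theorem isNullMap_transition [LorentzSurface M] {e e' : OpenPartialHomeomorph M (ℝ × ℝ)}
    (he : e ∈ nullCharts M) (he' : e' ∈ nullCharts M) :
    IsNullMap (e ∘ e'.symm) (e'.symm ≫ₕ e).source := by
  have := LorentzSurface.hasGroupoid (M := M)
  exact ((mem_groupoid_of_pregroupoid).1
    (nullGroupoid.compatible_of_mem_maximalAtlas he' he)).1

theorem chartAt_mem_nullCharts [LorentzSurface M] (m : M) : chartAt (ℝ × ℝ) m ∈ nullCharts M :=
  haveI := LorentzSurface.hasGroupoid (M := M)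
  nullGroupoid.chart_mem_maximalAtlas m

/-- Smooth maps are smooth in null coordinates. -/
theorem contDiffAt_comp_symm [LorentzSurface M] {Z : Type*} [NormedAddCommGroup Z]
    [NormedSpace ℝ Z] {z : M → Z}
    (hz : ContMDiff 𝓘(ℝ, ℝ × ℝ) 𝓘(ℝ, Z) ∞ z) {e : OpenPartialHomeomorph M (ℝ × ℝ)}
    (he : e ∈ nullCharts M) {p : ℝ × ℝ} (hp : p ∈ e.target) : ContDiffAt ℝ ∞ (z ∘ e.symm) p := by
  rw [← contMDiffAt_iff_contDiffAt]
  exact (hz _).comp p (contMDiffAt_symm_of_mem_maximalAtlas (nullCharts_subset he) hp)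

theorem contMDiff_of_contDiffAt [LorentzSurface M] {Z : Type*} [NormedAddCommGroup Z]
    [NormedSpace ℝ Z] {z : M → Z}
    (hz : ∀ e ∈ nullCharts M, ∀ p ∈ e.target, ContDiffAt ℝ ∞ (z ∘ e.symm) p) :
    ContMDiff 𝓘(ℝ, ℝ × ℝ) 𝓘(ℝ, Z) ∞ z := by
  intro m
  set e := chartAt (ℝ × ℝ) m
  have hm : m ∈ e.source := mem_chart_source _ m
  have h1 := contMDiffAt_iff_contDiffAt.2
    (hz e (chartAt_mem_nullCharts m) (e m) (e.map_source hm))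
  refine (h1.comp m (contMDiffAt_of_mem_maximalAtlas
    (nullCharts_subset (chartAt_mem_nullCharts m)) hm)).congr_of_eventuallyEq ?_
  filter_upwards [e.open_source.mem_nhds hm] with q hq
  simp [e.left_inv hq]

/-- The conditions on conformal timelike immersions in two null coordinate systems. -/
theorem FrameAt.change_chart [LorentzSurface M] {c : SignType} {E H Q R : ℝ} {F N : M → Fin 4 → ℝ}
    {e e' : OpenPartialHomeomorph M (ℝ × ℝ)} (he : e ∈ nullCharts M) (he' : e' ∈ nullCharts M)
    {m : M} (hm : m ∈ e.source) (hm' : m ∈ e'.source)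
    (h : FrameAt c E H Q R (F ∘ e.symm) (N ∘ e.symm) (e m)) :
    FrameAt c ((dU (e ∘ e'.symm) (e' m)).1 * (dV (e ∘ e'.symm) (e' m)).2 * E) H
      ((dU (e ∘ e'.symm) (e' m)).1 ^ 2 * Q) ((dV (e ∘ e'.symm) (e' m)).2 ^ 2 * R)
      (F ∘ e'.symm) (N ∘ e'.symm) (e' m) := by
  have hnull := isNullMap_transition he he'
  have hmem : e' m ∈ (e'.symm ≫ₕ e).source := by simp [hm, hm', e'.left_inv hm']
  have hpos := (e'.symm ≫ₕ e).open_source.mem_nhds hmem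
  have hh := hnull.1.contDiffAt hpos
  obtain ⟨h1, h2, h3⟩ := hnull.2 _ hmem
  have key := FrameAt.comp_nullMap (h := e ∘ e'.symm) hh h1 h2 h3
    (F := F ∘ e.symm) (N := N ∘ e.symm) (by simpa [e'.left_inv hm'] using h)
  have hsrc : ∀ᶠ q in 𝓝 (e' m), e'.symm q ∈ e.source := by
    filter_upwards [hpos] with q hq
    simp at hq
    exact hq.2
  refine key.congr ?_ ?_
  · filter_upwards [hsrc] with q hq
    simp [e.left_inv hq]
  · filter_upwards [hsrc] with q hq
    simp [e.left_inv hq]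

end Atlas

/-! ### Immersions and the pointwise frame conditions -/

section Immersions

variable {M : Type*} [TopologicalSpace M] [ChartedSpace (ℝ × ℝ) M] {c : SignType} {H : M → ℝ}

theorem trace_prod_apply (S : (ℝ × ℝ) →ₗ[ℝ] (ℝ × ℝ)) :
    LinearMap.trace ℝ (ℝ × ℝ) S = (S (1, 0)).1 + (S (0, 1)).2 := by
  rw [LinearMap.trace_eq_matrix_trace ℝ (Module.Basis.finTwoProd ℝ)]
  simp [Matrix.trace, Fin.sum_univ_two, LinearMap.toMatrix_apply]

/-- A conformal timelike immersion satisfies the pointwise conditions, with the data read off from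
it. -/
theorem TimelikeImmersion.frameAt [LorentzSurface M] (X : TimelikeImmersion M c H)
    {e : OpenPartialHomeomorph M (ℝ × ℝ)} (he : e ∈ nullCharts M) {p : ℝ × ℝ} (hp : p ∈ e.target) :
    FrameAt c (X.expOmega e p / 2) (H (e.symm p)) (X.hopfQ e p) (X.hopfR e p) (X.F ∘ e.symm)
      (X.N ∘ e.symm) p := by
  have hF := contDiffAt_comp_symm X.smooth_F he hp
  have hN := contDiffAt_comp_symm X.smooth_N he hp
  have da := (contDiffAt_dU hF).diff
  have db := (contDiffAt_dV hF).diff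
  have dN := hN.diff
  have hE : scalarProd c (dU (X.F ∘ e.symm) p) (dV (X.F ∘ e.symm) p) = X.expOmega e p / 2 := by
    simp [TimelikeImmersion.expOmega]
  obtain ⟨huu, hvv, hpos⟩ := X.conformal e he p hp
  have ht : ∀ᶠ q in 𝓝 p, q ∈ e.target := e.open_target.mem_nhds hp
  have uN : ∀ᶠ q in 𝓝 p, scalarProd c (dU (X.F ∘ e.symm) q) ((X.N ∘ e.symm) q) = 0 := by
    filter_upwards [ht] with q hq using X.normal_orthogonal e he q hq _
  have vN : ∀ᶠ q in 𝓝 p, scalarProd c (dV (X.F ∘ e.symm) q) ((X.N ∘ e.symm) q) = 0 := by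
    filter_upwards [ht] with q hq using X.normal_orthogonal e he q hq _
  have U1 := dU_of_scalarProd_eq da dN uN
  have V1 := dV_of_scalarProd_eq da dN uN
  have U2 := dU_of_scalarProd_eq db dN vN
  have V2 := dV_of_scalarProd_eq db dN vN
  rw [dU_const] at U1 U2
  rw [dV_const] at V1 V2
  rw [dV_dU_comm hF] at V1
  obtain ⟨S, hS, hH⟩ := X.mean_curvature e he p hp
  rw [trace_prod_apply] at hH
  have hSu := hS (1, 0)
  have hSv := hS (0, 1)
  rw [fderiv_apply_eq] at hSu hSv
  have eu : dU (X.N ∘ e.symm) p =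
      -((S (1, 0)).1 • dU (X.F ∘ e.symm) p + (S (1, 0)).2 • dV (X.F ∘ e.symm) p) := by
    rw [hSu, neg_neg]; rfl
  have ev : dV (X.N ∘ e.symm) p =
      -((S (0, 1)).1 • dU (X.F ∘ e.symm) p + (S (0, 1)).2 • dV (X.F ∘ e.symm) p) := by
    rw [hSv, neg_neg]; rfl
  have hba : scalarProd c (dV (X.F ∘ e.symm) p) (dU (X.F ∘ e.symm) p) = X.expOmega e p / 2 := by
    rw [scalarProd_comm, hE]
  have hab' : scalarProd c (dU (X.F ∘ e.symm) p) (dV (X.N ∘ e.symm) p) =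
      -((S (0, 1)).2 * (X.expOmega e p / 2)) := by
    rw [ev, scalarProd_neg_right, scalarProd_add_right, scalarProd_smul_right,
      scalarProd_smul_right, huu, hE]
    ring
  have hba' : scalarProd c (dV (X.F ∘ e.symm) p) (dU (X.N ∘ e.symm) p) =
      -((S (1, 0)).1 * (X.expOmega e p / 2)) := by
    rw [eu, scalarProd_neg_right, scalarProd_add_right, scalarProd_smul_right,
      scalarProd_smul_right, hvv, hba]
    ring
  -- Both sides equal `-⟨F_uv, N⟩`: the shape operator is self-adjoint. So its two diagonal entries
  -- agree, and each of them is half the trace, the mean curvature.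
  have hsum : scalarProd c (dU (X.F ∘ e.symm) p) (dV (X.N ∘ e.symm) p) =
      scalarProd c (dV (X.F ∘ e.symm) p) (dU (X.N ∘ e.symm) p) := by linarith
  have hH' : H (e.symm p) * (X.expOmega e p / 2) =
      ((S (1, 0)).1 + (S (0, 1)).2) / 2 * (X.expOmega e p / 2) := by rw [hH]
  exact
    { smooth_F := hF
      smooth_N := hN
      mem := X.mem_spaceForm _
      uu := huu
      vv := hvv
      uv := hE
      pos := hE ▸ hpos
      NN := X.unit_normal _
      Nn := X.normal_tangent _
      uN := uN.self_of_nhds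
      vN := vN.self_of_nhds
      det := X.normal_oriented e he p hp
      uNu := by
        have : X.hopfQ e p = scalarProd c (dU (dU (X.F ∘ e.symm)) p) ((X.N ∘ e.symm) p) := rfl
        rw [this]
        linarith
      uNv := by rw [hH']; linarith
      vNu := by rw [hH']; linarith
      vNv := by
        have : X.hopfR e p = scalarProd c (dV (dV (X.F ∘ e.symm)) p) ((X.N ∘ e.symm) p) := rfl
        rw [this]
        linarith }

/-- Maps that satisfy the pointwise conditions in all null coordinates are conformal timelike
immersions. -/
def TimelikeImmersion.ofFrame [LorentzSurface M] (F N : M → Fin 4 → ℝ)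
    (E Q R : OpenPartialHomeomorph M (ℝ × ℝ) → ℝ × ℝ → ℝ)
    (h : ∀ e ∈ nullCharts M, ∀ p ∈ e.target,
      FrameAt c (E e p) (H (e.symm p)) (Q e p) (R e p) (F ∘ e.symm) (N ∘ e.symm) p) :
    TimelikeImmersion M c H where
  F := F
  N := N
  smooth_F := contMDiff_of_contDiffAt fun e he p hp => (h e he p hp).smooth_F
  smooth_N := contMDiff_of_contDiffAt fun e he p hp => (h e he p hp).smooth_N
  mem_spaceForm m := by
    have := (h _ (chartAt_mem_nullCharts m) _ (mem_chart_target (ℝ × ℝ) m)).mem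
    simpa using this
  conformal e he p hp := by
    have := h e he p hp
    exact ⟨this.uu, this.vv, this.uv ▸ this.pos⟩
  unit_normal m := by
    have := (h _ (chartAt_mem_nullCharts m) _ (mem_chart_target (ℝ × ℝ) m)).NN
    simpa using this
  normal_tangent m := by
    have := (h _ (chartAt_mem_nullCharts m) _ (mem_chart_target (ℝ × ℝ) m)).Nn
    simpa using this
  normal_orthogonal e he p hp w := by
    have := h e he p hp
    have h1 : scalarProd c (dU (F ∘ e.symm) p) (N (e.symm p)) = 0 := this.uN
    have h2 : scalarProd c (dV (F ∘ e.symm) p) (N (e.symm p)) = 0 := this.vN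
    rw [fderiv_apply_eq, scalarProd_add_left, scalarProd_smul_left, scalarProd_smul_left, h1, h2]
    ring
  normal_oriented e he p hp := (h e he p hp).det
  mean_curvature e he p hp := by
    have h' : ∀ᶠ q in 𝓝 p, FrameAt c (E e q) (H (e.symm q)) (Q e q) (R e q) (F ∘ e.symm)
        (N ∘ e.symm) q := by
      filter_upwards [e.open_target.mem_nhds hp] with q hq using h e he q hq
    have hu := dU_normal_of_frame (H := H ∘ e.symm) h'
    have hv := dV_normal_of_frame (H := H ∘ e.symm) h'
    -- The columns of this matrix are the coefficients of `-N_u` and `-N_v` in the basis `F_u`,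
    -- `F_v`.
    refine ⟨Matrix.toLin (Module.Basis.finTwoProd ℝ) (Module.Basis.finTwoProd ℝ)
      !![H (e.symm p), R e p / E e p; Q e p / E e p, H (e.symm p)], fun w => ?_, ?_⟩
    · rw [Matrix.toLin_finTwoProd_apply, fderiv_apply_eq, fderiv_apply_eq, hu, hv]
      simp only [Function.comp_apply]
      module
    · rw [trace_prod_apply, Matrix.toLin_finTwoProd_apply, Matrix.toLin_finTwoProd_apply]
      simp

/-- The frame conditions express `E`, `Q`, `R` through `F` and `N`, so the data read off from the
constructed immersion are the prescribed ones. -/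
theorem TimelikeImmersion.data_ofFrame [LorentzSurface M] {F N : M → Fin 4 → ℝ}
    {E Q R : OpenPartialHomeomorph M (ℝ × ℝ) → ℝ × ℝ → ℝ}
    (h : ∀ e ∈ nullCharts M, ∀ p ∈ e.target,
      FrameAt c (E e p) (H (e.symm p)) (Q e p) (R e p) (F ∘ e.symm) (N ∘ e.symm) p)
    {e : OpenPartialHomeomorph M (ℝ × ℝ)} (he : e ∈ nullCharts M) {p : ℝ × ℝ} (hp : p ∈ e.target) :
    (ofFrame F N E Q R h).expOmega e p = 2 * E e p ∧ (ofFrame F N E Q R h).hopfQ e p = Q e p ∧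
      (ofFrame F N E Q R h).hopfR e p = R e p := by
  have h1 := (ofFrame F N E Q R h).frameAt he hp
  have h2 := h e he p hp
  refine ⟨?_, ?_, ?_⟩
  · have := h1.uv.symm.trans h2.uv
    linarith
  · have := h1.uNu.symm.trans h2.uNu
    linarith
  · have := h1.vNv.symm.trans h2.vNv
    linarith

end Immersions

/-! ### The group of proper isometries -/

section IsometryGroup

/-- The group of orientation preserving isometries, as a type. -/
def ProperIsometry (c : SignType) : Type := {T // T ∈ properIsometries c}

noncomputable instance (c : SignType) : Group (ProperIsometry c) :=
  letI : Mul (ProperIsometry c) :=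
    ⟨fun T S => ⟨affComp T.1 S.1, affComp_mem_properIsometries T.2 S.2⟩⟩
  letI : Inv (ProperIsometry c) := ⟨fun T => ⟨affInv T.1, affInv_mem_properIsometries T.2⟩⟩
  letI : One (ProperIsometry c) := ⟨⟨(1, 0), by
    refine ⟨fun p q => by simp, by simp, fun _ => ⟨Matrix.one_mulVec _, rfl⟩, fun _ => rfl⟩⟩⟩
  Group.ofLeftAxioms
    (fun T S U => Subtype.ext (by
      change affComp (affComp T.1 S.1) U.1 = affComp T.1 (affComp S.1 U.1)
      simp [affComp, Matrix.mul_assoc, mulVec_add, add_assoc]))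
    (fun T => Subtype.ext (by
      change affComp (1, 0) T.1 = T.1
      simp [affComp]))
    (fun T => Subtype.ext (affInv_affComp (properIsometries_subset c T.2)))

/-- The action on pairs (point, normal vector): affine on points, linear on normal vectors. -/
noncomputable instance (c : SignType) :
    MulAction (ProperIsometry c) ((Fin 4 → ℝ) × (Fin 4 → ℝ)) where
  smul T x := (T.1.1 *ᵥ x.1 + T.1.2, T.1.1 *ᵥ x.2)
  one_smul x := by
    change ((1 : Matrix (Fin 4) (Fin 4) ℝ) *ᵥ x.1 + 0, (1 : Matrix (Fin 4) (Fin 4) ℝ) *ᵥ x.2) = x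
    simp
  mul_smul T S x := by
    change ((affComp T.1 S.1).1 *ᵥ x.1 + (affComp T.1 S.1).2, (affComp T.1 S.1).1 *ᵥ x.2) =
      (T.1.1 *ᵥ (S.1.1 *ᵥ x.1 + S.1.2) + T.1.2, T.1.1 *ᵥ (S.1.1 *ᵥ x.2))
    rw [affComp_apply, mulVec_mulVec]
    rfl

end IsometryGroup

/-! ### From local to global immersions -/

section Globalization

variable {M : Type*} [TopologicalSpace M] [ChartedSpace (ℝ × ℝ) M] {c : SignType} {H : M → ℝ}
  {E Q R : OpenPartialHomeomorph M (ℝ × ℝ) → ℝ × ℝ → ℝ}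

/-- The pair `Y = (F, N)` satisfies at `m` the conditions on a conformal timelike immersion with its
normal field, with given data in all null coordinates around `m`. -/
def FrameOn (c : SignType) (H : M → ℝ) (E Q R : OpenPartialHomeomorph M (ℝ × ℝ) → ℝ × ℝ → ℝ)
    (Y : M → (Fin 4 → ℝ) × (Fin 4 → ℝ)) (m : M) : Prop :=
  ∀ e ∈ nullCharts M, m ∈ e.source → FrameAt c (E e (e m)) (H m) (Q e (e m)) (R e (e m))
    ((fun q => (Y q).1) ∘ e.symm) ((fun q => (Y q).2) ∘ e.symm) (e m)

theorem FrameOn.eventually {Y : M → (Fin 4 → ℝ) × (Fin 4 → ℝ)} {m : M}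
    (h : ∀ᶠ q in 𝓝 m, FrameOn c H E Q R Y q) {e : OpenPartialHomeomorph M (ℝ × ℝ)}
    (he : e ∈ nullCharts M) (hm : m ∈ e.source) :
    ∀ᶠ q in 𝓝 (e m), FrameAt c (E e q) ((H ∘ e.symm) q) (Q e q) (R e q)
      ((fun q => (Y q).1) ∘ e.symm) ((fun q => (Y q).2) ∘ e.symm) q := by
  have h1 := (e.eventually_nhds' _ hm).2 h
  filter_upwards [h1, e.open_target.mem_nhds (e.map_source hm)] with q h2 h3
  have := h2 e he (e.map_target h3)
  rwa [e.right_inv h3] at this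

theorem FrameOn.congr {Y Y' : M → (Fin 4 → ℝ) × (Fin 4 → ℝ)} {m : M}
    (hY : ∀ᶠ q in 𝓝 m, Y q = Y' q) (h : FrameOn c H E Q R Y m) : FrameOn c H E Q R Y' m := by
  intro e he hm
  have h1 := (e.eventually_nhds' _ hm).2 hY
  refine (h e he hm).congr ?_ ?_
  · filter_upwards [h1] with q hq using congrArg Prod.fst hq.symm
  · filter_upwards [h1] with q hq using congrArg Prod.snd hq.symm

theorem FrameOn.smul {Y : M → (Fin 4 → ℝ) × (Fin 4 → ℝ)} {m : M} (h : FrameOn c H E Q R Y m)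
    (T : ProperIsometry c) : FrameOn c H E Q R (fun q => T • Y q) m :=
  fun e he hm => (h e he hm).affine T.2

theorem FrameOn.exists_smul_eq [LorentzSurface M] {Y Y' : M → (Fin 4 → ℝ) × (Fin 4 → ℝ)} {m : M}
    (h : ∀ᶠ q in 𝓝 m, FrameOn c H E Q R Y q) (h' : ∀ᶠ q in 𝓝 m, FrameOn c H E Q R Y' q) :
    ∃ T : ProperIsometry c, ∀ᶠ q in 𝓝 m, Y' q = T • Y q := by
  have hm := mem_chart_source (ℝ × ℝ) m
  obtain ⟨T, hT, hq⟩ := exists_isometry_of_frame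
    (FrameOn.eventually h (chartAt_mem_nullCharts m) hm)
    (FrameOn.eventually h' (chartAt_mem_nullCharts m) hm)
  refine ⟨⟨T, hT⟩, ((chartAt (ℝ × ℝ) m).eventually_nhds' _ hm).1 ?_⟩
  filter_upwards [hq] with q h2 using Prod.ext h2.1 h2.2

theorem FrameOn.smul_injective [LorentzSurface M] {Y : M → (Fin 4 → ℝ) × (Fin 4 → ℝ)} {m : M}
    (h : FrameOn c H E Q R Y m) {T T' : ProperIsometry c}
    (hT : ∀ᶠ q in 𝓝 m, T • Y q = T' • Y q) : T = T' := by
  have hm := mem_chart_source (ℝ × ℝ) m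
  have h1 := ((chartAt (ℝ × ℝ) m).eventually_nhds' _ hm).2 hT
  refine Subtype.ext (isometry_eq_of_frame (h _ (chartAt_mem_nullCharts m) hm) T.2 T'.2 ?_)
  filter_upwards [h1] with q hq using ⟨congrArg Prod.fst hq, congrArg Prod.snd hq⟩

theorem TimelikeImmersion.frameOn [LorentzSurface M] (X : TimelikeImmersion M c H) (m : M) :
    FrameOn c H (fun e p => X.expOmega e p / 2) X.hopfQ X.hopfR (fun q => (X.F q, X.N q)) m := by
  intro e he hm
  have := X.frameAt he (e.map_source hm)
  rwa [e.left_inv hm] at this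

/-- Conformal timelike immersions with the same mean curvature, induced metric and Hopf
differentials differ by an isometry. -/
theorem TimelikeImmersion.exists_isometry [LorentzSurface M] [PreconnectedSpace M] [Nonempty M]
    (X Y : TimelikeImmersion M c H)
    (h : ∀ e ∈ nullCharts M, ∀ p ∈ e.target, Y.expOmega e p = X.expOmega e p ∧
      Y.hopfQ e p = X.hopfQ e p ∧ Y.hopfR e p = X.hopfR e p) :
    ∃ T ∈ properIsometries c, ∀ m, Y.F m = T.1 *ᵥ X.F m + T.2 ∧ Y.N m = T.1 *ᵥ X.N m := by
  obtain ⟨T, hT⟩ := exists_smul_eq_of_local (G := ProperIsometry c)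
    (Sol := FrameOn c H (fun e p => X.expOmega e p / 2) X.hopfQ X.hopfR)
    (fun _ _ _ => FrameOn.exists_smul_eq)
    (fun _ _ _ _ h => FrameOn.smul_injective h.self_of_nhds) X.frameOn
    (Y' := fun q => (Y.F q, Y.N q)) (fun m e he hm => by
      obtain ⟨h1, h2, h3⟩ := h e he (e m) (e.map_source hm)
      have := Y.frameOn m e he hm
      simp only [h1, h2, h3] at this
      exact this)
  exact ⟨T.1, T.2, fun m => ⟨congrArg Prod.fst (hT m), congrArg Prod.snd (hT m)⟩⟩

theorem TimelikeImmersion.isometry_unique [LorentzSurface M] [Nonempty M]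
    (X : TimelikeImmersion M c H) {T T' : Matrix (Fin 4) (Fin 4) ℝ × (Fin 4 → ℝ)}
    (hT : T ∈ properIsometries c) (hT' : T' ∈ properIsometries c)
    (h : ∀ m, T.1 *ᵥ X.F m + T.2 = T'.1 *ᵥ X.F m + T'.2 ∧ T.1 *ᵥ X.N m = T'.1 *ᵥ X.N m) :
    T = T' := by
  obtain ⟨m⟩ := ‹Nonempty M›
  have := FrameOn.smul_injective (X.frameOn m) (T := ⟨T, hT⟩) (T' := ⟨T', hT'⟩)
    (Filter.Eventually.of_forall fun q => Prod.ext (h q).1 (h q).2)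
  exact congrArg Subtype.val this

/-- The image of an immersion under a proper isometry. -/
noncomputable def TimelikeImmersion.map [LorentzSurface M] (X : TimelikeImmersion M c H)
    {T : Matrix (Fin 4) (Fin 4) ℝ × (Fin 4 → ℝ)} (hT : T ∈ properIsometries c) :
    TimelikeImmersion M c H :=
  ofFrame (fun m => T.1 *ᵥ X.F m + T.2) (fun m => T.1 *ᵥ X.N m)
    (fun e p => X.expOmega e p / 2) X.hopfQ X.hopfR
    fun _ he _ hp => (X.frameAt he hp).affine hT

/-- The normal vector is determined by the immersion. -/
theorem FrameAt.normal_eq {F N N' : ℝ × ℝ → Fin 4 → ℝ} {p : ℝ × ℝ} {E H Q R E' H' Q' R' : ℝ}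
    (h : FrameAt c E H Q R F N p) (h' : FrameAt c E' H' Q' R' F N' p) : N' p = N p := by
  -- Both normals are orthogonal to `n`, `F_u`, `F_v`, hence proportional. Unit length leaves a
  -- sign, which the orientation fixes.
  have key : N' p = scalarProd c (N' p) (N p) • N p := by
    refine eq_of_scalarProd_frame_eq (c := c) h.det.ne' ?_ ?_ ?_ ?_ <;>
      rw [scalarProd_smul_left]
    · rw [h'.Nn, h.Nn, mul_zero]
    · rw [scalarProd_comm, h'.uN, scalarProd_comm c (N p) (dU F p), h.uN, mul_zero]
    · rw [scalarProd_comm, h'.vN, scalarProd_comm c (N p) (dV F p), h.vN, mul_zero]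
    · rw [h.NN, mul_one]
  set r := scalarProd c (N' p) (N p) with hr
  have h1 := h'.NN
  have h2 := h'.det
  rw [key, scalarProd_smul_left, scalarProd_smul_right, h.NN] at h1
  have h3 : (Matrix.of ![ambientNormal c (F p), dU F p, dV F p, N' p]).det =
      r * (Matrix.of ![ambientNormal c (F p), dU F p, dV F p, N p]).det := by
    rw [key]
    have e : Matrix.of ![ambientNormal c (F p), dU F p, dV F p, r • N p] =
        diagonal ![1, 1, 1, r] * Matrix.of ![ambientNormal c (F p), dU F p, dV F p, N p] := by
      ext i j
      rw [diagonal_mul]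
      fin_cases i <;> simp
    rw [e, det_mul, det_diagonal]
    simp [Fin.prod_univ_four]
  have h4 : 0 < r := by
    rw [h3] at h2
    exact (mul_pos_iff_of_pos_right h.det).1 h2
  have h5 : r = 1 := by nlinarith
  rw [key, h5, one_smul]

/-- Congruent immersions have congruent normal fields and the same data. -/
theorem TimelikeImmersion.eq_of_isometry [LorentzSurface M] {X Y : TimelikeImmersion M c H}
    {T : Matrix (Fin 4) (Fin 4) ℝ × (Fin 4 → ℝ)} (hT : T ∈ properIsometries c)
    (h : ∀ m, Y.F m = T.1 *ᵥ X.F m + T.2) :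
    (∀ m, Y.N m = T.1 *ᵥ X.N m) ∧ ∀ e ∈ nullCharts M, ∀ p ∈ e.target,
      Y.expOmega e p = X.expOmega e p ∧ Y.hopfQ e p = X.hopfQ e p ∧
        Y.hopfR e p = X.hopfR e p := by
  have hF : ∀ e : OpenPartialHomeomorph M (ℝ × ℝ),
      Y.F ∘ e.symm = fun q => T.1 *ᵥ (X.F ∘ e.symm) q + T.2 := fun e => funext fun q => h _
  have hN : ∀ m, Y.N m = T.1 *ᵥ X.N m := by
    intro m
    have hm := mem_chart_target (ℝ × ℝ) m
    have h1 := (X.frameAt (chartAt_mem_nullCharts m) hm).affine hT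
    have h2 := Y.frameAt (chartAt_mem_nullCharts m) hm
    rw [hF] at h2
    simpa using h1.normal_eq h2
  refine ⟨hN, fun e he p hp => ?_⟩
  have h1 := (X.frameAt he hp).affine hT
  have h2 := Y.frameAt he hp
  have hN' : Y.N ∘ e.symm = fun q => T.1 *ᵥ (X.N ∘ e.symm) q := funext fun q => hN _
  rw [hF, hN'] at h2
  have e1 := h2.uv.symm.trans h1.uv
  have e2 := h2.uNu.symm.trans h1.uNu
  have e3 := h2.vNv.symm.trans h1.vNv
  exact ⟨by linarith, by linarith, by linarith⟩

end Globalization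

/-! ### The correspondence of the moduli spaces -/

theorem lawson_factors_pos {M : Type*} {f g : M → ℝ} {c : SignType} (hfg : ∀ m, f m + g m ≠ 0)
    (hc : c = -1 → ∀ m, 1 < lawsonH f g c m ^ 2) (m : M) :
    0 < (1 + (c : ℝ) * f m ^ 2) * (1 + (c : ℝ) * g m ^ 2) := by
  have hpos := sq_pos_of_ne_zero (hfg m)
  cases c
  · simp
  · have h := hc rfl m
    -- For `c = -1` the product of the factors is `H² - 1` times a square, so `H² > 1` is what makes
    -- it positive. For the other curvatures no condition is needed.
    have e : lawsonH f g (-1) m ^ 2 + (((-1 : SignType) : ℝ)) =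
        (1 + (((-1 : SignType) : ℝ)) * f m ^ 2) * (1 + (((-1 : SignType) : ℝ)) * g m ^ 2) /
          (f m + g m) ^ 2 := by
      have := hfg m
      simp only [lawsonH]
      field_simp
      ring
    have h1 : 0 < lawsonH f g (-1) m ^ 2 + (((-1 : SignType) : ℝ)) := by
      have h2 : (((-1 : SignType) : ℝ)) = -1 := by simp
      rw [h2]
      linarith [show (1 : ℝ) < lawsonH f g (-1) m ^ 2 from h]
    rw [e] at h1
    exact (div_pos_iff_of_pos_right hpos).1 h1
  · change 0 < (1 + (((1 : SignType) : ℝ)) * f m ^ 2) * (1 + (((1 : SignType) : ℝ)) * g m ^ 2)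
    rw [SignType.coe_one]
    positivity

theorem timeFlip_mul_self (c : SignType) : timeFlip c * timeFlip c = 1 := by
  cases c
  all_goals
    simp only [timeFlip, diagonal_mul_diagonal]
    rw [← diagonal_one]
    congr 1
    funext i
    fin_cases i <;> simp

section Lawson

variable {M : Type*} [TopologicalSpace M] [ChartedSpace (ℝ × ℝ) M] {f g : M → ℝ}

/-- The data of an immersion with mean curvature `H_c`, multiplied by the factors that make the
Gauss and Codazzi equations independent of `c`. -/
noncomputable def lawsonData (f g : M → ℝ) {c : SignType}
    (X : TimelikeImmersion M c (lawsonH f g c))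
    (x : {x : OpenPartialHomeomorph M (ℝ × ℝ) × (ℝ × ℝ) // x.1 ∈ nullCharts M ∧ x.2 ∈ x.1.target}) :
    ℝ × ℝ × ℝ :=
  ((1 + (c : ℝ) * f (x.1.1.symm x.1.2) ^ 2) * (1 + (c : ℝ) * g (x.1.1.symm x.1.2) ^ 2) *
      X.expOmega x.1.1 x.1.2,
    (1 + (c : ℝ) * f (x.1.1.symm x.1.2) ^ 2) * X.hopfQ x.1.1 x.1.2,
    (1 + (c : ℝ) * g (x.1.1.symm x.1.2) ^ 2) * X.hopfR x.1.1 x.1.2)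

variable [LorentzSurface M]

theorem contDiffAt_data {c : SignType} {H : M → ℝ} (X : TimelikeImmersion M c H)
    {e : OpenPartialHomeomorph M (ℝ × ℝ)} (he : e ∈ nullCharts M) {p : ℝ × ℝ} (hp : p ∈ e.target) :
    ContDiffAt ℝ ∞ (fun q => X.expOmega e q / 2) p ∧ ContDiffAt ℝ ∞ (X.hopfQ e) p ∧
      ContDiffAt ℝ ∞ (X.hopfR e) p := by
  have h : ∀ᶠ q in 𝓝 p, FrameAt c (X.expOmega e q / 2) ((H ∘ e.symm) q) (X.hopfQ e q)
      (X.hopfR e q) (X.F ∘ e.symm) (X.N ∘ e.symm) q := by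
    filter_upwards [e.open_target.mem_nhds hp] with q hq using X.frameAt he hq
  exact ⟨contDiffAt_E (E := fun q => X.expOmega e q / 2) (H := H ∘ e.symm) h,
    contDiffAt_Q (E := fun q => X.expOmega e q / 2) (H := H ∘ e.symm) h,
    contDiffAt_R (E := fun q => X.expOmega e q / 2) (H := H ∘ e.symm) h⟩

/-- The data of an immersion that would correspond to `X` satisfy the Gauss and Codazzi
equations. -/
theorem gaussCodazziAt_correspondent (hf : LorentzHolomorphic f) (hg : LorentzAntiholomorphic g)
    (hfg : ∀ m, f m + g m ≠ 0) {c c' : SignType}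
    (hA : ∀ m, 0 < (1 + (c : ℝ) * f m ^ 2) * (1 + (c : ℝ) * g m ^ 2))
    (hA' : ∀ m, 0 < (1 + (c' : ℝ) * f m ^ 2) * (1 + (c' : ℝ) * g m ^ 2))
    (X : TimelikeImmersion M c (lawsonH f g c)) {e : OpenPartialHomeomorph M (ℝ × ℝ)}
    (he : e ∈ nullCharts M) {p : ℝ × ℝ} (hp : p ∈ e.target) {E Q R : ℝ × ℝ → ℝ}
    (hE : ∀ q, (1 + (c' : ℝ) * f (e.symm q) ^ 2) * (1 + (c' : ℝ) * g (e.symm q) ^ 2) * E q =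
      (1 + (c : ℝ) * f (e.symm q) ^ 2) * (1 + (c : ℝ) * g (e.symm q) ^ 2) * (X.expOmega e q / 2))
    (hQ : ∀ q, (1 + (c' : ℝ) * f (e.symm q) ^ 2) * Q q =
      (1 + (c : ℝ) * f (e.symm q) ^ 2) * X.hopfQ e q)
    (hR : ∀ q, (1 + (c' : ℝ) * g (e.symm q) ^ 2) * R q =
      (1 + (c : ℝ) * g (e.symm q) ^ 2) * X.hopfR e q) :
    0 < E p ∧ ContDiffAt ℝ ∞ E p ∧ ContDiffAt ℝ ∞ Q p ∧ ContDiffAt ℝ ∞ R p ∧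
      GaussCodazziAt c' E (lawsonH f g c' ∘ e.symm) Q R p := by
  have ht : ∀ᶠ q in 𝓝 p, q ∈ e.target := e.open_target.mem_nhds hp
  have hX : ∀ᶠ q in 𝓝 p, FrameAt c (X.expOmega e q / 2) ((lawsonH f g c ∘ e.symm) q)
      (X.hopfQ e q) (X.hopfR e q) (X.F ∘ e.symm) (X.N ∘ e.symm) q := by
    filter_upwards [ht] with q hq using X.frameAt he hq
  have hGC := gaussCodazziAt_of_frame (E := fun q => X.expOmega e q / 2)
    (H := lawsonH (f ∘ e.symm) (g ∘ e.symm) c) hX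
  obtain ⟨sE, sQ, sR⟩ := contDiffAt_data X he hp
  have sf := contDiffAt_comp_symm hf.1 he hp
  have sg := contDiffAt_comp_symm hg.1 he hp
  have hfv : ∀ᶠ q in 𝓝 p, dV (f ∘ e.symm) q = 0 := ht.mono (hf.2 e he)
  have hgu : ∀ᶠ q in 𝓝 p, dU (g ∘ e.symm) q = 0 := ht.mono (hg.2 e he)
  have a0 := fun m => left_ne_zero_of_mul (hA m).ne'
  have b0 := fun m => right_ne_zero_of_mul (hA m).ne'
  have a0' := fun m => left_ne_zero_of_mul (hA' m).ne'
  have b0' := fun m => right_ne_zero_of_mul (hA' m).ne'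
  have ca := contDiffAt_one_add c sf
  have cb := contDiffAt_one_add c sg
  have ca' := contDiffAt_one_add c' sf
  have cb' := contDiffAt_one_add c' sg
  have sE' : ContDiffAt ℝ ∞ E p := by
    refine (((ca.mul cb).mul sE).div (ca'.mul cb') (hA' _).ne').congr_of_eventuallyEq
      (Filter.Eventually.of_forall fun q => ?_)
    exact (eq_div_iff (hA' _).ne').2 (by rw [mul_comm]; exact hE q)
  have sQ' : ContDiffAt ℝ ∞ Q p := by
    refine ((ca.mul sQ).div ca' (a0' _)).congr_of_eventuallyEq
      (Filter.Eventually.of_forall fun q => ?_)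
    exact (eq_div_iff (a0' _)).2 (by rw [mul_comm]; exact hQ q)
  have sR' : ContDiffAt ℝ ∞ R p := by
    refine ((cb.mul sR).div cb' (b0' _)).congr_of_eventuallyEq
      (Filter.Eventually.of_forall fun q => ?_)
    exact (eq_div_iff (b0' _)).2 (by rw [mul_comm]; exact hR q)
  have hpos : 0 < E p := by
    have h1 := mul_pos (hA (e.symm p)) hX.self_of_nhds.pos
    rw [← hE] at h1
    exact (mul_pos_iff_of_pos_left (hA' _)).1 h1
  refine ⟨hpos, sE', sQ', sR', ?_⟩
  -- The passage from `c` to `c'` goes through the normalised equations, where both sets of data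
  -- coincide up to rewriting.
  have h1 := (gaussCodazziAt_lawsonH_iff c sf sg hfv hgu (hfg _) (a0 _) (b0 _) sE
    hX.self_of_nhds.pos.ne' sQ sR).1 hGC
  refine (gaussCodazziAt_lawsonH_iff c' sf sg hfv hgu (hfg _) (a0' _) (b0' _) sE' hpos.ne'
    sQ' sR').2 ?_
  simp only [Function.comp_apply, hE, hQ, hR]
  exact h1

/-- The data of an immersion in two null coordinate systems. -/
theorem TimelikeImmersion.data_change {c : SignType} {H : M → ℝ} (X : TimelikeImmersion M c H)
    {e e' : OpenPartialHomeomorph M (ℝ × ℝ)} (he : e ∈ nullCharts M) (he' : e' ∈ nullCharts M)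
    {m : M} (hm : m ∈ e.source) (hm' : m ∈ e'.source) :
    X.expOmega e' (e' m) / 2 =
        (dU (e ∘ e'.symm) (e' m)).1 * (dV (e ∘ e'.symm) (e' m)).2 * (X.expOmega e (e m) / 2) ∧
      X.hopfQ e' (e' m) = (dU (e ∘ e'.symm) (e' m)).1 ^ 2 * X.hopfQ e (e m) ∧
      X.hopfR e' (e' m) = (dV (e ∘ e'.symm) (e' m)).2 ^ 2 * X.hopfR e (e m) := by
  have h1 := (X.frameAt he (e.map_source hm)).change_chart he he' hm hm'
  have h2 := X.frameAt he' (e'.map_source hm')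
  exact ⟨h2.uv.symm.trans h1.uv, neg_injective (h2.uNu.symm.trans h1.uNu),
    neg_injective (h2.vNv.symm.trans h1.vNv)⟩

/-- Every immersion with mean curvature `H_c` has a corresponding immersion with mean curvature
`H_{c'}`. -/
theorem exists_correspondent [SimplyConnectedSpace M] (hf : LorentzHolomorphic f)
    (hg : LorentzAntiholomorphic g) (hfg : ∀ m, f m + g m ≠ 0) {c c' : SignType}
    (hA : ∀ m, 0 < (1 + (c : ℝ) * f m ^ 2) * (1 + (c : ℝ) * g m ^ 2))
    (hA' : ∀ m, 0 < (1 + (c' : ℝ) * f m ^ 2) * (1 + (c' : ℝ) * g m ^ 2))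
    (X : TimelikeImmersion M c (lawsonH f g c)) :
    ∃ Y : TimelikeImmersion M c' (lawsonH f g c'), lawsonData f g Y = lawsonData f g X := by
  have a0' := fun m => left_ne_zero_of_mul (hA' m).ne'
  have b0' := fun m => right_ne_zero_of_mul (hA' m).ne'
  -- The data forced by the correspondence: those of `X`, rescaled by quotients of the factors.
  let E : OpenPartialHomeomorph M (ℝ × ℝ) → ℝ × ℝ → ℝ := fun e q =>
    (1 + (c : ℝ) * f (e.symm q) ^ 2) * (1 + (c : ℝ) * g (e.symm q) ^ 2) /
      ((1 + (c' : ℝ) * f (e.symm q) ^ 2) * (1 + (c' : ℝ) * g (e.symm q) ^ 2)) *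
        (X.expOmega e q / 2)
  let Q : OpenPartialHomeomorph M (ℝ × ℝ) → ℝ × ℝ → ℝ := fun e q =>
    (1 + (c : ℝ) * f (e.symm q) ^ 2) / (1 + (c' : ℝ) * f (e.symm q) ^ 2) * X.hopfQ e q
  let R : OpenPartialHomeomorph M (ℝ × ℝ) → ℝ × ℝ → ℝ := fun e q =>
    (1 + (c : ℝ) * g (e.symm q) ^ 2) / (1 + (c' : ℝ) * g (e.symm q) ^ 2) * X.hopfR e q
  have hE : ∀ e q, (1 + (c' : ℝ) * f (e.symm q) ^ 2) * (1 + (c' : ℝ) * g (e.symm q) ^ 2) * E e q =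
      (1 + (c : ℝ) * f (e.symm q) ^ 2) * (1 + (c : ℝ) * g (e.symm q) ^ 2) *
        (X.expOmega e q / 2) := fun e q => by
    simp only [E]
    rw [← mul_assoc, mul_div_cancel₀ _ (hA' _).ne']
  have hQ : ∀ e q, (1 + (c' : ℝ) * f (e.symm q) ^ 2) * Q e q =
      (1 + (c : ℝ) * f (e.symm q) ^ 2) * X.hopfQ e q := fun e q => by
    simp only [Q]
    rw [← mul_assoc, mul_div_cancel₀ _ (a0' _)]
  have hR : ∀ e q, (1 + (c' : ℝ) * g (e.symm q) ^ 2) * R e q =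
      (1 + (c : ℝ) * g (e.symm q) ^ 2) * X.hopfR e q := fun e q => by
    simp only [R]
    rw [← mul_assoc, mul_div_cancel₀ _ (b0' _)]
  have loc : ∀ m : M, ∃ Y : M → (Fin 4 → ℝ) × (Fin 4 → ℝ),
      ∀ᶠ q in 𝓝 m, FrameOn c' (lawsonH f g c') E Q R Y q := by
    intro m
    set e := chartAt (ℝ × ℝ) m
    have he : e ∈ nullCharts M := chartAt_mem_nullCharts m
    have hm : m ∈ e.source := mem_chart_source _ m
    have ht : ∀ᶠ q in 𝓝 (e m), q ∈ e.target := e.open_target.mem_nhds (e.map_source hm)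
    have key := fun q (hq : q ∈ e.target) =>
      gaussCodazziAt_correspondent hf hg hfg hA hA' X he hq (hE e) (hQ e) (hR e)
    obtain ⟨F, N, hFN⟩ := exists_local_frame (c := c') (p := e m) (E := E e)
      (H := lawsonH f g c' ∘ e.symm) (Q := Q e) (R := R e)
      (ht.mono fun q hq => (key q hq).2.1) (key _ (e.map_source hm)).1
      (ht.mono fun q hq => contDiffAt_lawsonH c' (contDiffAt_comp_symm hf.1 he hq)
        (contDiffAt_comp_symm hg.1 he hq) (hfg _))
      (ht.mono fun q hq => (key q hq).2.2.1) (ht.mono fun q hq => (key q hq).2.2.2.1)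
      (ht.mono fun q hq => (key q hq).2.2.2.2)
    refine ⟨fun q => (F (e q), N (e q)), ?_⟩
    filter_upwards [(e.eventually_nhds _ hm).1 hFN, e.open_source.mem_nhds hm] with m' h1 hm'
      e' he' hm''
    have ht' : ∀ᶠ q in 𝓝 (e m'), q ∈ e.target := e.open_target.mem_nhds (e.map_source hm')
    have h2 : FrameAt c' (E e (e m')) (lawsonH f g c' m') (Q e (e m')) (R e (e m'))
        ((F ∘ e) ∘ e.symm) ((N ∘ e) ∘ e.symm) (e m') := by
      have h3 := h1.congr (F' := (F ∘ e) ∘ e.symm) (N' := (N ∘ e) ∘ e.symm)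
        (ht'.mono fun q hq => by simp [e.right_inv hq])
        (ht'.mono fun q hq => by simp [e.right_inv hq])
      simpa only [Function.comp_apply, e.left_inv hm'] using h3
    have h3 := h2.change_chart he he' hm' hm''
    -- The rescaling factors are functions on the surface, so the new data change between charts
    -- just as those of `X` do. A solution in one chart therefore satisfies the conditions in every
    -- null chart.
    obtain ⟨d1, d2, d3⟩ := X.data_change he he' hm' hm''
    have eE : E e' (e' m') =
        (dU (e ∘ e'.symm) (e' m')).1 * (dV (e ∘ e'.symm) (e' m')).2 * E e (e m') := by
      simp only [E, d1, e.left_inv hm', e'.left_inv hm'']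
      ring
    have eQ : Q e' (e' m') = (dU (e ∘ e'.symm) (e' m')).1 ^ 2 * Q e (e m') := by
      simp only [Q, d2, e.left_inv hm', e'.left_inv hm'']
      ring
    have eR : R e' (e' m') = (dV (e ∘ e'.symm) (e' m')).2 ^ 2 * R e (e m') := by
      simp only [R, d3, e.left_inv hm', e'.left_inv hm'']
      ring
    rw [eE, eQ, eR]
    exact h3
  have := ChartedSpace.locallyPathConnectedSpace (ℝ × ℝ) M
  obtain ⟨Y, hY⟩ := exists_global_of_local (G := ProperIsometry c')
    (Sol := FrameOn c' (lawsonH f g c') E Q R) (fun _ _ _ h => FrameOn.congr h)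
    (fun T _ _ h => h.smul T) loc (fun _ _ _ => FrameOn.exists_smul_eq)
    (fun _ _ _ _ h => FrameOn.smul_injective h.self_of_nhds)
  have hY' : ∀ e ∈ nullCharts M, ∀ p ∈ e.target, FrameAt c' (E e p) (lawsonH f g c' (e.symm p))
      (Q e p) (R e p) ((fun q => (Y q).1) ∘ e.symm) ((fun q => (Y q).2) ∘ e.symm) p := by
    intro e he p hp
    have := hY (e.symm p) e he (e.map_target hp)
    rwa [e.right_inv hp] at this
  refine ⟨TimelikeImmersion.ofFrame _ _ E Q R hY', funext fun x => ?_⟩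
  obtain ⟨h1, h2, h3⟩ := TimelikeImmersion.data_ofFrame hY' x.2.1 x.2.2
  simp only [lawsonData, h1, h2, h3, hQ, hR, Prod.mk.injEq, and_true]
  -- The conformal factor `e^ω` is twice `E`.
  linear_combination 2 * hE x.1.1 x.1.2

/-- Immersions with the same data are congruent, or become so after a time reversal. -/
theorem congruent_or [SimplyConnectedSpace M] {c : SignType}
    (hA : ∀ m, 0 < (1 + (c : ℝ) * f m ^ 2) * (1 + (c : ℝ) * g m ^ 2))
    {X Y : TimelikeImmersion M c (lawsonH f g c)} (h : lawsonData f g Y = lawsonData f g X) :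
    Y.toModuli = X.toModuli ∨ Y.toModuli = (X.map (timeFlip_mem_properIsometries c)).toModuli := by
  have : Nonempty M := inferInstance
  obtain ⟨T, hT, hXY⟩ := X.exists_isometry Y fun e he p hp => by
    have h1 := congrFun h ⟨(e, p), he, hp⟩
    simp only [lawsonData, Prod.mk.injEq] at h1
    exact ⟨mul_left_cancel₀ (hA _).ne' h1.1,
      mul_left_cancel₀ (left_ne_zero_of_mul (hA _).ne') h1.2.1,
      mul_left_cancel₀ (right_ne_zero_of_mul (hA _).ne') h1.2.2⟩
  rcases mem_identityComponent_or hT with hT' | hT'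
  · exact Or.inl (Quotient.sound ⟨T, hT', fun m => (hXY m).1⟩ : X.toModuli = Y.toModuli).symm
  · refine Or.inr (Quotient.sound ⟨_, hT', fun m => ?_⟩ :
      (X.map (timeFlip_mem_properIsometries c)).toModuli = Y.toModuli).symm
    change Y.F m = (T.1 * timeFlip c) *ᵥ (timeFlip c *ᵥ X.F m + 0) + (T.1 *ᵥ 0 + T.2)
    rw [(hXY m).1, add_zero, mulVec_mulVec, Matrix.mul_assoc, timeFlip_mul_self, Matrix.mul_one,
      mulVec_zero, zero_add]

/-- A congruence between `X` and its flipped image would act on `X` as the flip does. A proper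
isometry is determined by its action on an immersion with its normal field, so the flip would lie in
the identity component. -/
theorem toModuli_map_timeFlip_ne [Nonempty M] {c : SignType} {H : M → ℝ}
    (X : TimelikeImmersion M c H) :
    (X.map (timeFlip_mem_properIsometries c)).toModuli ≠ X.toModuli := by
  intro h
  obtain ⟨T, hT, hF⟩ := Quotient.exact h.symm
  have hT' := (mem_identityComponent_iff.1 hT).1
  have hN := (TimelikeImmersion.eq_of_isometry hT' hF).1
  have := X.isometry_unique hT' (timeFlip_mem_properIsometries c)
    fun m => ⟨(hF m).symm, (hN m).symm⟩
  exact timeFlip_not_mem_identityComponent c (this ▸ hT)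

theorem lawsonData_eq_of_isometry {c : SignType} {X Y : TimelikeImmersion M c (lawsonH f g c)}
    {T : Matrix (Fin 4) (Fin 4) ℝ × (Fin 4 → ℝ)} (hT : T ∈ properIsometries c)
    (h : ∀ m, Y.F m = T.1 *ᵥ X.F m + T.2) : lawsonData f g Y = lawsonData f g X := by
  funext x
  obtain ⟨h1, h2, h3⟩ := (TimelikeImmersion.eq_of_isometry hT h).2 _ x.2.1 _ x.2.2
  simp only [lawsonData, h1, h2, h3]

/-- The normalised data of a congruence class. -/
noncomputable def moduliData (f g : M → ℝ) (c : SignType) :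
    ModuliSpace M c (lawsonH f g c) →
      {x : OpenPartialHomeomorph M (ℝ × ℝ) × (ℝ × ℝ) // x.1 ∈ nullCharts M ∧ x.2 ∈ x.1.target} →
        ℝ × ℝ × ℝ :=
  Quotient.lift (lawsonData f g) (by
    rintro X Y ⟨T, hT, h⟩
    exact (lawsonData_eq_of_isometry (mem_identityComponent_iff.1 hT).1 h).symm)

/-- Immersions with the same data differ by a proper isometry, which acts freely. Modulo the
identity component there are exactly two such isometries, represented by the identity and the flip.
-/
theorem card_fibre [SimplyConnectedSpace M] {c : SignType}
    (hA : ∀ m, 0 < (1 + (c : ℝ) * f m ^ 2) * (1 + (c : ℝ) * g m ^ 2))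
    (X : TimelikeImmersion M c (lawsonH f g c)) :
    Nat.card {x // moduliData f g c x = lawsonData f g X} = 2 := by
  have : Nonempty M := inferInstance
  refine Nat.card_eq_two_iff.2 ⟨⟨X.toModuli, rfl⟩,
    ⟨(X.map (timeFlip_mem_properIsometries c)).toModuli, ?_⟩, ?_, ?_⟩
  · exact lawsonData_eq_of_isometry (timeFlip_mem_properIsometries c) fun m => rfl
  · intro h
    exact toModuli_map_timeFlip_ne X (congrArg Subtype.val h).symm
  · ext ⟨x, hx⟩
    induction x using Quotient.inductionOn with
    | h Y =>
      simp only [mem_univ, iff_true]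
      rcases congruent_or hA hx with h | h
      · exact Or.inl (Subtype.ext h)
      · exact Or.inr (Subtype.ext h)

/-- The fibres over the same normalised data are both empty or both have two points. The bijection
is not canonical: it amounts to a choice of time orientation in each fibre. -/
theorem nonempty_fibre_equiv [SimplyConnectedSpace M] (hf : LorentzHolomorphic f)
    (hg : LorentzAntiholomorphic g) (hfg : ∀ m, f m + g m ≠ 0) {c c' : SignType}
    (hA : ∀ m, 0 < (1 + (c : ℝ) * f m ^ 2) * (1 + (c : ℝ) * g m ^ 2))
    (hA' : ∀ m, 0 < (1 + (c' : ℝ) * f m ^ 2) * (1 + (c' : ℝ) * g m ^ 2)) (d) :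
    Nonempty ({x // moduliData f g c x = d} ≃ {x // moduliData f g c' x = d}) := by
  have key : ∀ {c c' : SignType} (hA : ∀ m, 0 < (1 + (c : ℝ) * f m ^ 2) * (1 + (c : ℝ) * g m ^ 2))
      (hA' : ∀ m, 0 < (1 + (c' : ℝ) * f m ^ 2) * (1 + (c' : ℝ) * g m ^ 2)),
      Nonempty {x // moduliData f g c x = d} → Nonempty {x // moduliData f g c' x = d} := by
    rintro c c' hA hA' ⟨x, hx⟩
    induction x using Quotient.inductionOn with
    | h X =>
      obtain ⟨Y, hY⟩ := exists_correspondent hf hg hfg hA hA' X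
      exact ⟨⟨Y.toModuli, hY.trans hx⟩⟩
  have card : ∀ {c : SignType} (hA : ∀ m, 0 < (1 + (c : ℝ) * f m ^ 2) * (1 + (c : ℝ) * g m ^ 2)),
      Nonempty {x // moduliData f g c x = d} → Nat.card {x // moduliData f g c x = d} = 2 := by
    rintro c hA ⟨x, hx⟩
    induction x using Quotient.inductionOn with
    | h X =>
      have hx' : lawsonData f g X = d := hx
      subst hx'
      exact card_fibre hA X
  by_cases h : Nonempty {x // moduliData f g c x = d}
  · have h1 := card hA h
    have h2 := card hA' (key hA hA' h)
    have f1 := Nat.finite_of_card_ne_zero (h1.trans_ne two_ne_zero)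
    have f2 := Nat.finite_of_card_ne_zero (h2.trans_ne two_ne_zero)
    exact Finite.card_eq.1 (h1.trans h2.symm)
  · have h' : ¬ Nonempty {x // moduliData f g c' x = d} := fun hn => h (key hA' hA hn)
    rw [not_nonempty_iff] at h h'
    exact ⟨Equiv.equivOfIsEmpty _ _⟩

end Lawson

theorem theorem6p4 {M : Type*} [TopologicalSpace M] [ChartedSpace (ℝ × ℝ) M] [LorentzSurface M]
    [SimplyConnectedSpace M] (f g : M → ℝ) (hf : LorentzHolomorphic f)
    (hg : LorentzAntiholomorphic g) (hfg : ∀ m, f m + g m ≠ 0) (c c' : SignType)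
    (hc : c = -1 → ∀ m, 1 < lawsonH f g c m ^ 2)
    (hc' : c' = -1 → ∀ m, 1 < lawsonH f g c' m ^ 2) :
    ∃ Φ : ModuliSpace M c (lawsonH f g c) ≃ ModuliSpace M c' (lawsonH f g c'),
      ∀ (X : TimelikeImmersion M c (lawsonH f g c))
        (Y : TimelikeImmersion M c' (lawsonH f g c')),
        Φ X.toModuli = Y.toModuli →
        ∀ e ∈ nullCharts M, ∀ p ∈ e.target,
          (1 + (c' : ℝ) * f (e.symm p) ^ 2) * (1 + (c' : ℝ) * g (e.symm p) ^ 2) * Y.expOmega e p =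
            (1 + (c : ℝ) * f (e.symm p) ^ 2) * (1 + (c : ℝ) * g (e.symm p) ^ 2) * X.expOmega e p ∧
          (1 + (c' : ℝ) * f (e.symm p) ^ 2) * Y.hopfQ e p =
            (1 + (c : ℝ) * f (e.symm p) ^ 2) * X.hopfQ e p ∧
          (1 + (c' : ℝ) * g (e.symm p) ^ 2) * Y.hopfR e p =
            (1 + (c : ℝ) * g (e.symm p) ^ 2) * X.hopfR e p := by
  -- Each moduli space is the disjoint union of the fibres over the normalised data. Bijections
  -- chosen fibre by fibre add up to one that preserves these data, which is the asserted relation.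
  let φ := fun d => (nonempty_fibre_equiv hf hg hfg (lawson_factors_pos hfg hc)
    (lawson_factors_pos hfg hc') d).some
  refine ⟨(Equiv.sigmaFiberEquiv (moduliData f g c)).symm.trans
    ((Equiv.sigmaCongrRight φ).trans (Equiv.sigmaFiberEquiv (moduliData f g c'))), ?_⟩
  intro X Y h e he p hp
  have h1 : moduliData f g c' Y.toModuli = moduliData f g c X.toModuli := by
    rw [← h]
    exact (φ (moduliData f g c X.toModuli) ⟨X.toModuli, rfl⟩).2
  have h2 : lawsonData f g Y = lawsonData f g X := h1
  have h3 := congrFun h2 ⟨(e, p), he, hp⟩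
  simp only [lawsonData, Prod.mk.injEq] at h3
  exact h3
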